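/- Let $A=\{a_1,\dots,a_s\}$ and $B=\{b_1,\dots,b_t\}$ be two finite sets of objects with $s+t=n\ge 1$. Let $c(a_i,b_j)\in\mathbb{R}$ be the cost of matching $a_i$ to $b_j$, let $\alpha_i,\alpha'_i\in\mathbb{N}$ be the demand and the capacity of $a_i$, and let $\beta_j,\beta'_j\in\mathbb{N}$ be the demand and the capacity of $b_j$. A generalized assignment is a set $M\subseteq A\times B$ of pairs such that every $a_i$ occurs in at least $\alpha_i$ and at most $\alpha'_i$ pairs of $M$ and every $b_j$ occurs in at least $\beta_j$ and at most $\beta'_j$ pairs of $M$; its cost is $\sum_{(a,b)\in M}c(a,b)$. There is an algorithm that, for every such instance that admits a generalized assignment, computes a generalized assignment of minimum cost in $O(n^4)$ time and $O(n)$ space. The model of computation is a random access machine with real-number cells (with addition, subtraction and comparison at unit cost) and word cells (with addition, truncated subtraction and comparison at unit cost), where a word has $O(\log(n+U))$ bits and $U$ is the largest capacity in the instance. The input is read-only, the output is a write-only list of the pairs of $M$, and space is the number of memory cells of the working memory. The algorithm and the constants in the bounds do not depend on the instance. -/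

import Mathlib

namespace GenAssign

noncomputable section

/-! ## The generalized assignment problem -/

/-- An instance with `A = {a_0, …, a_{s-1}}` and `B = {b_0, …, b_{t-1}}`: the demand and the
capacity of every object, and the (real) cost of matching `a_i` to `b_j`. -/
structure Problem (s t : ℕ) where
  demA : Fin s → ℕ
  capA : Fin s → ℕ
  demB : Fin t → ℕ
  capB : Fin t → ℕ
  cost : Fin s → Fin t → ℝ

namespace Problem

variable {s t : ℕ}

/-- The number of elements of `B` that `a_i` is matched to. -/
def degA (M : Finset (Fin s × Fin t)) (i : Fin s) : ℕ := (M.filter fun e => e.1 = i).card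

/-- The number of elements of `A` that `b_j` is matched to. -/
def degB (M : Finset (Fin s × Fin t)) (j : Fin t) : ℕ := (M.filter fun e => e.2 = j).card

/-- `M` is a generalized assignment: all demands are met and all capacities are respected. -/
def IsAssignment (I : Problem s t) (M : Finset (Fin s × Fin t)) : Prop :=
  (∀ i, I.demA i ≤ degA M i ∧ degA M i ≤ I.capA i) ∧
  (∀ j, I.demB j ≤ degB M j ∧ degB M j ≤ I.capB j)

/-- The sum of the matching costs. -/
def totalCost (I : Problem s t) (M : Finset (Fin s × Fin t)) : ℝ := ∑ e ∈ M, I.cost e.1 e.2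

/-- `M` is a generalized assignment of minimum cost. -/
def IsMinCostAssignment (I : Problem s t) (M : Finset (Fin s × Fin t)) : Prop :=
  I.IsAssignment M ∧ ∀ M', I.IsAssignment M' → I.totalCost M ≤ I.totalCost M'

/-- The largest capacity that occurs in the instance (`0` if there is none). -/
def maxCap (I : Problem s t) : ℕ :=
  max (Finset.univ.sup I.capA) (Finset.univ.sup I.capB)

end Problem

/-! ## A real random access machine

A program works on finitely many arrays of words (natural numbers of bounded bit length) and
finitely many arrays of reals; a scalar variable is an array that is only used at index `0`.
The input is read-only, the output is a write-only list of index pairs; the arrays are the working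
memory. Unit-cost operations are addition, (truncated) subtraction and comparison of words,
addition, subtraction and comparison of reals, indexed access to an array or to the input, and
output. There is no multiplication, no rounding, and no real constant other than the integers. -/

/-- Expressions with a word as value. -/
inductive WExp where
  | const (k : ℕ)
  /-- the cell of word array `a` with the given index -/
  | cell (a : ℕ) (i : WExp)
  | add (e₁ e₂ : WExp)
  /-- truncated subtraction -/
  | sub (e₁ e₂ : WExp)
  /-- the input `|A|` -/
  | sizeA
  /-- the input `|B|` -/
  | sizeB
  | demA (i : WExp)
  | capA (i : WExp)
  | demB (j : WExp)
  | capB (j : WExp)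

/-- Expressions with a real number as value. -/
inductive RExp where
  | const (k : ℤ)
  /-- the cell of real array `a` with the given index -/
  | cell (a : ℕ) (i : WExp)
  | add (e₁ e₂ : RExp)
  | sub (e₁ e₂ : RExp)
  /-- the input cost of the pair with the given indices -/
  | cost (i j : WExp)

/-- Tests. -/
inductive Test where
  | wordLE (e₁ e₂ : WExp)
  | realLE (e₁ e₂ : RExp)
  | not (b : Test)
  | and (b₁ b₂ : Test)

/-- Programs. -/
inductive Prog where
  | skip
  /-- store the value of `e` in the cell of word array `a` with index `i` -/
  | setWord (a : ℕ) (i e : WExp)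
  /-- store the value of `e` in the cell of real array `a` with index `i` -/
  | setReal (a : ℕ) (i : WExp) (e : RExp)
  /-- append a pair to the output -/
  | emit (i j : WExp)
  | seq (p q : Prog)
  | ite (b : Test) (p q : Prog)
  | loop (b : Test) (p : Prog)

/-- The resources of a machine: the number of word arrays (which is also the number of real
arrays), the length of each array, and the number of bits of a word. -/
structure Machine where
  arrays : ℕ
  len : ℕ
  bits : ℕ

/-- The total number of memory cells (of words and of reals). -/
def Machine.space (m : Machine) : ℕ := 2 * (m.arrays * m.len)

/-- A memory content, and the output so far. Cells outside of the bounds given by a `Machine`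
are never accessed. -/
structure State where
  word : ℕ → ℕ → ℕ
  real : ℕ → ℕ → ℝ
  out : List (ℕ × ℕ)

/-- All cells hold zero and there is no output. -/
def State.init : State := ⟨fun _ _ => 0, fun _ _ => 0, []⟩

/-- A word that does not fit is an error. -/
def Machine.fit (m : Machine) (v : ℕ) : Option ℕ := if v < 2 ^ m.bits then some v else none

/-- Read-only access to an input table; an index out of range is an error. -/
def lookup {n : ℕ} {X : Type} (f : Fin n → X) (i : ℕ) : Option X :=
  if h : i < n then some (f ⟨i, h⟩) else none

section Semantics

variable {s t : ℕ} (I : Problem s t) (m : Machine)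

/-- The value of a word expression, `none` in case of an error. -/
def WExp.eval (σ : State) : WExp → Option ℕ
  | .const k => m.fit k
  | .cell a i => (i.eval σ).bind fun u =>
      if a < m.arrays ∧ u < m.len then m.fit (σ.word a u) else none
  | .add e₁ e₂ => (e₁.eval σ).bind fun u => (e₂.eval σ).bind fun v => m.fit (u + v)
  | .sub e₁ e₂ => (e₁.eval σ).bind fun u => (e₂.eval σ).bind fun v => m.fit (u - v)
  | .sizeA => m.fit s
  | .sizeB => m.fit t
  | .demA i => (i.eval σ).bind fun u => (lookup I.demA u).bind m.fit
  | .capA i => (i.eval σ).bind fun u => (lookup I.capA u).bind m.fit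
  | .demB j => (j.eval σ).bind fun u => (lookup I.demB u).bind m.fit
  | .capB j => (j.eval σ).bind fun u => (lookup I.capB u).bind m.fit

/-- The value of a real expression, `none` in case of an error. -/
def RExp.eval (σ : State) : RExp → Option ℝ
  | .const k => some (k : ℝ)
  | .cell a i => (i.eval I m σ).bind fun u =>
      if a < m.arrays ∧ u < m.len then some (σ.real a u) else none
  | .add e₁ e₂ => (e₁.eval σ).bind fun u => (e₂.eval σ).bind fun v => some (u + v)
  | .sub e₁ e₂ => (e₁.eval σ).bind fun u => (e₂.eval σ).bind fun v => some (u - v)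
  | .cost i j => (i.eval I m σ).bind fun u => (j.eval I m σ).bind fun v =>
      (lookup I.cost u).bind fun row => lookup row v

/-- The value of a test, `none` in case of an error; conjunctions are evaluated lazily. -/
def Test.eval (σ : State) : Test → Option Bool
  | .wordLE e₁ e₂ =>
      (e₁.eval I m σ).bind fun u => (e₂.eval I m σ).bind fun v => some (decide (u ≤ v))
  | .realLE e₁ e₂ =>
      (e₁.eval I m σ).bind fun u => (e₂.eval I m σ).bind fun v => some (decide (u ≤ v))
  | .not b => (b.eval σ).bind fun v => some (!v)
  | .and b₁ b₂ => (b₁.eval σ).bind fun v => if v then b₂.eval σ else some false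

/-- The number of steps for the evaluation of a word expression: one for each operation. -/
def WExp.steps : WExp → ℕ
  | .const _ => 1
  | .cell _ i => i.steps + 1
  | .add e₁ e₂ => e₁.steps + e₂.steps + 1
  | .sub e₁ e₂ => e₁.steps + e₂.steps + 1
  | .sizeA => 1
  | .sizeB => 1
  | .demA i => i.steps + 1
  | .capA i => i.steps + 1
  | .demB j => j.steps + 1
  | .capB j => j.steps + 1

/-- The number of steps for the evaluation of a real expression. -/
def RExp.steps : RExp → ℕ
  | .const _ => 1
  | .cell _ i => i.steps + 1
  | .add e₁ e₂ => e₁.steps + e₂.steps + 1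
  | .sub e₁ e₂ => e₁.steps + e₂.steps + 1
  | .cost i j => i.steps + j.steps + 1

/-- The number of steps charged for the evaluation of a test. -/
def Test.steps : Test → ℕ
  | .wordLE e₁ e₂ => e₁.steps + e₂.steps + 1
  | .realLE e₁ e₂ => e₁.steps + e₂.steps + 1
  | .not b => b.steps + 1
  | .and b₁ b₂ => b₁.steps + b₂.steps + 1

/-- Store a word. -/
def State.setWord (σ : State) (a i v : ℕ) : State :=
  { σ with word := fun a' i' => if a' = a ∧ i' = i then v else σ.word a' i' }

/-- Store a real number. -/
def State.setReal (σ : State) (a i : ℕ) (v : ℝ) : State :=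
  { σ with real := fun a' i' => if a' = a ∧ i' = i then v else σ.real a' i' }

/-- Append a pair to the output. -/
def State.emit (σ : State) (i j : ℕ) : State := { σ with out := σ.out ++ [(i, j)] }

/-- `Exec I m p σ σ' T`: on input `I`, the program `p`, started in the state `σ` on the machine `m`,
halts without an error in the state `σ'` after `T` steps. -/
inductive Exec : Prog → State → State → ℕ → Prop
  | skip (σ : State) : Exec .skip σ σ 1
  | setWord {σ : State} {a : ℕ} {i e : WExp} {u v : ℕ}
      (hi : i.eval I m σ = some u) (he : e.eval I m σ = some v)
      (ha : a < m.arrays) (hu : u < m.len) :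
      Exec (.setWord a i e) σ (σ.setWord a u v) (i.steps + e.steps + 1)
  | setReal {σ : State} {a : ℕ} {i : WExp} {e : RExp} {u : ℕ} {v : ℝ}
      (hi : i.eval I m σ = some u) (he : e.eval I m σ = some v)
      (ha : a < m.arrays) (hu : u < m.len) :
      Exec (.setReal a i e) σ (σ.setReal a u v) (i.steps + e.steps + 1)
  | emit {σ : State} {i j : WExp} {u v : ℕ}
      (hi : i.eval I m σ = some u) (hj : j.eval I m σ = some v) :
      Exec (.emit i j) σ (σ.emit u v) (i.steps + j.steps + 1)
  | seq {p q : Prog} {σ₁ σ₂ σ₃ : State} {T₁ T₂ : ℕ}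
      (hp : Exec p σ₁ σ₂ T₁) (hq : Exec q σ₂ σ₃ T₂) :
      Exec (.seq p q) σ₁ σ₃ (T₁ + T₂)
  | iteTrue {b : Test} {p q : Prog} {σ σ' : State} {T : ℕ}
      (hb : b.eval I m σ = some true) (hp : Exec p σ σ' T) :
      Exec (.ite b p q) σ σ' (b.steps + 1 + T)
  | iteFalse {b : Test} {p q : Prog} {σ σ' : State} {T : ℕ}
      (hb : b.eval I m σ = some false) (hq : Exec q σ σ' T) :
      Exec (.ite b p q) σ σ' (b.steps + 1 + T)
  | loopTrue {b : Test} {p : Prog} {σ₁ σ₂ σ₃ : State} {T₁ T₂ : ℕ}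
      (hb : b.eval I m σ₁ = some true) (hp : Exec p σ₁ σ₂ T₁)
      (hl : Exec (.loop b p) σ₂ σ₃ T₂) :
      Exec (.loop b p) σ₁ σ₃ (b.steps + 1 + T₁ + T₂)
  | loopFalse {b : Test} {p : Prog} {σ : State}
      (hb : b.eval I m σ = some false) :
      Exec (.loop b p) σ σ (b.steps + 1)

end Semantics

/-- The output list enumerates the pairs of `M`, each exactly once, in some order. -/
def Enumerates {s t : ℕ} (out : List (ℕ × ℕ)) (M : Finset (Fin s × Fin t)) : Prop :=
  (out : Multiset (ℕ × ℕ)) = M.val.map fun e => ((e.1 : ℕ), (e.2 : ℕ))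

end

end GenAssign

/-!
The problem is a minimum cost circulation problem with unit capacities between the two sides. A
ground node `g` is added to the objects; the flow from `g` to `a ∈ A` and from `b ∈ B` to `g` is the
number of partners of the object, and has to lie between its demand and its capacity, while the flow
from `a` to `b` is `1` or `0` according to whether the pair is matched. Flows are skew-symmetric
functions on pairs of nodes, so that a single family of upper bounds (`bound`) describes capacities
and demands, and an arc is residual if its flow is below its bound.

*Correctness.* The algorithm keeps node potentials for which no residual arc has a negative reduced
cost. A circulation with this property that respects all bounds has minimum cost
(`cost_le_of_reduced`, `isMinCost_matchOf`). At the start, exactly the pairs of negative cost are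
matched and all potentials vanish. The demands and capacities may be violated then, but only on arcs
at the ground node. As long as there is a violated arc, one unit of flow is taken off it
(`undo_violation`) and is carried along a shortest residual path between its ends: Dijkstra's
algorithm (`Search.step`) finds the path, the distances yield the new potentials (`Search.reduced`),
and the unit is pushed along the tight arcs of the path (`Augment.step`). The path exists, since a
set of nodes that separates its ends and is not left by a residual arc would contradict the existence
of a generalized assignment (`exists_residual_of_cut`).

*Time.* Every unit that is carried reduces the total violation, which is at most `2 * n ^ 2` at the
start (`violation_le`), and a search takes `O(n ^ 2)` steps.

*Space.* A matching can have a quadratic number of pairs, so it cannot be stored as a list. For every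
object, the characteristic vector of the set of its partners is kept instead, as the binary expansion
of an integer in a real cell (`Rep.row`); the powers of two are tabulated. A pair is added or removed
by adding or subtracting a power of two, and all partners of an object are recovered in linear time by
comparisons and subtractions, from the highest digit downwards (`expand_spec`). Since Dijkstra's
algorithm examines all arcs at a node together, this does not increase the order of its running time.

Programs are verified by a weakest-precondition calculus for programs without loops (`Runs.flat`) and
by a rule for loops with an invariant and a decreasing measure (`Runs.loop`), both of which also
bound the number of steps.
-/

namespace GenAssign

open Finset

noncomputable section

/-! ### A weakest-precondition calculus with time bounds -/

/-- The extension by zero of an input table to all natural numbers. -/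
def ext0 {n : ℕ} (f : Fin n → ℕ) (i : ℕ) : ℕ := if h : i < n then f ⟨i, h⟩ else 0

/-- The extension by zero of the cost table to all pairs of natural numbers. -/
def cost0 {s t : ℕ} (I : Problem s t) (i j : ℕ) : ℝ :=
  if h : i < s ∧ j < t then I.cost ⟨i, h.1⟩ ⟨j, h.2⟩ else 0

/-- The machine for an instance: thirteen arrays whose cells are indexed by the objects and one
additional node. -/
def mach {s t : ℕ} (I : Problem s t) : Machine :=
  ⟨13, s + t + 1, Nat.log 2 (s + t + I.maxCap) + 5⟩

section

variable {s t : ℕ} (I : Problem s t)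

/-- A bound up to which the words of `mach I` are guaranteed to reach. -/
def top : ℕ := s + t + I.maxCap + 8

theorem top_lt_two_pow : top I < 2 ^ (mach I).bits := by
  have h := Nat.lt_pow_succ_log_self (b := 2) (by norm_num) (s + t + I.maxCap)
  have h2 : 2 ^ (mach I).bits = 2 ^ (Nat.log 2 (s + t + I.maxCap) + 1) * 16 := by
    simp only [mach]; ring
  simp only [top]
  omega

theorem fit_of_le_top {v : ℕ} (h : v ≤ top I) : (mach I).fit v = some v := by
  rw [Machine.fit, if_pos (lt_of_le_of_lt h (top_lt_two_pow I))]

theorem fit_of_le {m : Machine} {u v w : ℕ} (h : m.fit u = some w) (hv : v ≤ u) :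
    m.fit v = some v := by
  by_cases h1 : u < 2 ^ m.bits
  · exact if_pos (hv.trans_lt h1)
  · simp [Machine.fit, h1] at h

theorem fit_self {m : Machine} {u w : ℕ} (h : m.fit u = some w) : m.fit w = some w := by
  by_cases h1 : u < 2 ^ m.bits
  · rw [Machine.fit, if_pos h1, Option.some.injEq] at h
    exact h ▸ if_pos h1
  · simp [Machine.fit, h1] at h

variable {I} in
theorem WExp.eval_fit {σ : State} : ∀ {e : WExp} {v : ℕ} (_ : e.eval I (mach I) σ = some v),
    (mach I).fit v = some v
  | .const k, v, h => fit_self h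
  | .cell a i, v, h => by
    simp only [WExp.eval, Option.bind_eq_some_iff] at h
    obtain ⟨u, -, h⟩ := h
    split_ifs at h
    exact fit_self h
  | .add e₁ e₂, v, h => by
    simp only [WExp.eval, Option.bind_eq_some_iff] at h
    obtain ⟨u, -, w, -, h⟩ := h
    exact fit_self h
  | .sub e₁ e₂, v, h => by
    simp only [WExp.eval, Option.bind_eq_some_iff] at h
    obtain ⟨u, -, w, -, h⟩ := h
    exact fit_self h
  | .sizeA, v, h => fit_self h
  | .sizeB, v, h => fit_self h
  | .demA i, v, h => by
    simp only [WExp.eval, Option.bind_eq_some_iff] at h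
    obtain ⟨u, -, w, -, h⟩ := h
    exact fit_self h
  | .capA i, v, h => by
    simp only [WExp.eval, Option.bind_eq_some_iff] at h
    obtain ⟨u, -, w, -, h⟩ := h
    exact fit_self h
  | .demB i, v, h => by
    simp only [WExp.eval, Option.bind_eq_some_iff] at h
    obtain ⟨u, -, w, -, h⟩ := h
    exact fit_self h
  | .capB i, v, h => by
    simp only [WExp.eval, Option.bind_eq_some_iff] at h
    obtain ⟨u, -, w, -, h⟩ := h
    exact fit_self h

/-- All words of a state fit into the cells of the machine. -/
def WordsFit (σ : State) : Prop := ∀ a i, (mach I).fit (σ.word a i) = some (σ.word a i)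

/-- The condition under which `e` has a value without an error, and this value satisfies `Q`. -/
def WExp.wp (σ : State) : WExp → (ℕ → Prop) → Prop
  | .const k, Q => k ≤ 8 ∧ Q k
  | .cell a i, Q => i.wp σ fun u => a < 13 ∧ u ≤ s + t ∧ Q (σ.word a u)
  | .add e₁ e₂, Q => e₁.wp σ fun u => e₂.wp σ fun v => u + v ≤ top I ∧ Q (u + v)
  | .sub e₁ e₂, Q => e₁.wp σ fun u => e₂.wp σ fun v => Q (u - v)
  | .sizeA, Q => Q s
  | .sizeB, Q => Q t
  | .demA i, Q => i.wp σ fun u => u < s ∧ ext0 I.demA u ≤ top I ∧ Q (ext0 I.demA u)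
  | .capA i, Q => i.wp σ fun u => u < s ∧ ext0 I.capA u ≤ top I ∧ Q (ext0 I.capA u)
  | .demB i, Q => i.wp σ fun u => u < t ∧ ext0 I.demB u ≤ top I ∧ Q (ext0 I.demB u)
  | .capB i, Q => i.wp σ fun u => u < t ∧ ext0 I.capB u ≤ top I ∧ Q (ext0 I.capB u)

/-- The condition under which `e` has a value without an error, and this value satisfies `Q`. -/
def RExp.wp (σ : State) : RExp → (ℝ → Prop) → Prop
  | .const k, Q => Q k
  | .cell a i, Q => i.wp I σ fun u => a < 13 ∧ u ≤ s + t ∧ Q (σ.real a u)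
  | .add e₁ e₂, Q => e₁.wp σ fun u => e₂.wp σ fun v => Q (u + v)
  | .sub e₁ e₂, Q => e₁.wp σ fun u => e₂.wp σ fun v => Q (u - v)
  | .cost i j, Q => i.wp I σ fun u => j.wp I σ fun v => u < s ∧ v < t ∧ Q (cost0 I u v)

/-- The condition under which `b` has a value without an error, and the assertion that `b` is true
satisfies `Q`. -/
def Test.wp (σ : State) : Test → (Prop → Prop) → Prop
  | .wordLE e₁ e₂, Q => e₁.wp I σ fun u => e₂.wp I σ fun v => Q (u ≤ v)
  | .realLE e₁ e₂, Q => e₁.wp I σ fun u => e₂.wp I σ fun v => Q (u ≤ v)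
  | .not b, Q => b.wp σ fun P => Q (¬ P)
  | .and b₁ b₂, Q => b₁.wp σ fun P => (P → b₂.wp σ Q) ∧ (¬ P → Q False)

/-- The condition under which a program without loops halts in a state that satisfies `Q`. -/
def Prog.wp : Prog → State → (State → Prop) → Prop
  | .skip, σ, Q => Q σ
  | .setWord a i e, σ, Q =>
      i.wp I σ fun u => e.wp I σ fun v => a < 13 ∧ u ≤ s + t ∧ Q (σ.setWord a u v)
  | .setReal a i e, σ, Q =>
      i.wp I σ fun u => e.wp I σ fun v => a < 13 ∧ u ≤ s + t ∧ Q (σ.setReal a u v)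
  | .emit i j, σ, Q => i.wp I σ fun u => j.wp I σ fun v => Q (σ.emit u v)
  | .seq p q, σ, Q => p.wp σ fun σ' => q.wp σ' Q
  | .ite b p q, σ, Q => b.wp I σ fun P => (P → p.wp σ Q) ∧ (¬ P → q.wp σ Q)
  | .loop _ _, _, _ => False

/-- A bound for the running time of a program without loops. -/
def Prog.flatTime : Prog → ℕ
  | .skip => 1
  | .setWord _ i e => i.steps + e.steps + 1
  | .setReal _ i e => i.steps + e.steps + 1
  | .emit i j => i.steps + j.steps + 1
  | .seq p q => p.flatTime + q.flatTime
  | .ite b p q => b.steps + 1 + (p.flatTime + q.flatTime)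
  | .loop _ _ => 0

/-- The word arrays that a program may write to. -/
def Prog.wordWrites : Prog → List ℕ
  | .setWord a _ _ => [a]
  | .seq p q => p.wordWrites ++ q.wordWrites
  | .ite _ p q => p.wordWrites ++ q.wordWrites
  | .loop _ p => p.wordWrites
  | _ => []

/-- The real arrays that a program may write to. -/
def Prog.realWrites : Prog → List ℕ
  | .setReal a _ _ => [a]
  | .seq p q => p.realWrites ++ q.realWrites
  | .ite _ p q => p.realWrites ++ q.realWrites
  | .loop _ p => p.realWrites
  | _ => []

/-- Whether a program contains an output instruction. -/
def Prog.emits : Prog → Bool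
  | .emit _ _ => true
  | .seq p q => p.emits || q.emits
  | .ite _ p q => p.emits || q.emits
  | .loop _ p => p.emits
  | _ => false

/-- The states `σ` and `σ'` differ only in what `p` may write to. -/
structure Frame (p : Prog) (σ σ' : State) : Prop where
  word : ∀ a, a ∉ p.wordWrites → σ'.word a = σ.word a
  real : ∀ a, a ∉ p.realWrites → σ'.real a = σ.real a
  out : p.emits = false → σ'.out = σ.out

theorem Frame.refl (p : Prog) (σ : State) : Frame p σ σ :=
  ⟨fun _ _ => rfl, fun _ _ => rfl, fun _ => rfl⟩

theorem Frame.trans {p : Prog} {σ₁ σ₂ σ₃ : State} (h : Frame p σ₁ σ₂) (h' : Frame p σ₂ σ₃) :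
    Frame p σ₁ σ₃ :=
  ⟨fun a ha => (h'.word a ha).trans (h.word a ha), fun a ha => (h'.real a ha).trans (h.real a ha),
    fun he => (h'.out he).trans (h.out he)⟩

variable {I}

theorem Exec.frame {p : Prog} {σ σ' : State} {T : ℕ} (h : Exec I (mach I) p σ σ' T) :
    Frame p σ σ' := by
  induction h with
  | skip => exact Frame.refl _ _
  | setWord =>
    refine ⟨fun b hb => ?_, fun b hb => rfl, fun _ => rfl⟩
    simp only [Prog.wordWrites, List.mem_singleton] at hb
    funext i'
    simp [State.setWord, hb]
  | setReal =>
    refine ⟨fun b hb => rfl, fun b hb => ?_, fun _ => rfl⟩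
    simp only [Prog.realWrites, List.mem_singleton] at hb
    funext i'
    simp [State.setReal, hb]
  | emit => exact ⟨fun b hb => rfl, fun b hb => rfl, fun h => by simp [Prog.emits] at h⟩
  | seq _ _ h1 h2 =>
    refine ⟨fun a ha => ?_, fun a ha => ?_, fun he => ?_⟩
    · simp only [Prog.wordWrites, List.mem_append, not_or] at ha
      exact (h2.word a ha.2).trans (h1.word a ha.1)
    · simp only [Prog.realWrites, List.mem_append, not_or] at ha
      exact (h2.real a ha.2).trans (h1.real a ha.1)
    · simp only [Prog.emits, Bool.or_eq_false_iff] at he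
      exact (h2.out he.2).trans (h1.out he.1)
  | iteTrue _ _ h1 =>
    refine ⟨fun a ha => ?_, fun a ha => ?_, fun he => ?_⟩
    · simp only [Prog.wordWrites, List.mem_append, not_or] at ha
      exact h1.word a ha.1
    · simp only [Prog.realWrites, List.mem_append, not_or] at ha
      exact h1.real a ha.1
    · simp only [Prog.emits, Bool.or_eq_false_iff] at he
      exact h1.out he.1
  | iteFalse _ _ h1 =>
    refine ⟨fun a ha => ?_, fun a ha => ?_, fun he => ?_⟩
    · simp only [Prog.wordWrites, List.mem_append, not_or] at ha
      exact h1.word a ha.2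
    · simp only [Prog.realWrites, List.mem_append, not_or] at ha
      exact h1.real a ha.2
    · simp only [Prog.emits, Bool.or_eq_false_iff] at he
      exact h1.out he.2
  | loopTrue _ _ _ h1 h2 =>
    exact ⟨fun a ha => (h2.word a ha).trans (h1.word a ha),
      fun a ha => (h2.real a ha).trans (h1.real a ha), fun he => (h2.out he).trans (h1.out he)⟩
  | loopFalse => exact Frame.refl _ _

theorem Exec.wordsFit {p : Prog} {σ σ' : State} {T : ℕ} (h : Exec I (mach I) p σ σ' T)
    (hσ : WordsFit I σ) : WordsFit I σ' := by
  induction h with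
  | skip => exact hσ
  | setWord hi he ha hu =>
    intro b k
    simp only [State.setWord]
    split_ifs
    · exact WExp.eval_fit he
    · exact hσ b k
  | setReal => exact hσ
  | emit => exact hσ
  | seq _ _ h1 h2 => exact h2 (h1 hσ)
  | iteTrue _ _ h1 => exact h1 hσ
  | iteFalse _ _ h1 => exact h1 hσ
  | loopTrue _ _ _ h1 h2 => exact h2 (h1 hσ)
  | loopFalse => exact hσ

theorem lookup_ext0 {n : ℕ} (f : Fin n → ℕ) {u : ℕ} (h : u < n) :
    lookup f u = some (ext0 f u) := by
  simp [lookup, ext0, h]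

theorem WExp.wp_sound {σ : State} (hσ : WordsFit I σ) : ∀ {e : WExp} {Q : ℕ → Prop},
    e.wp I σ Q → ∃ v, e.eval I (mach I) σ = some v ∧ Q v
  | .const k, Q, h => ⟨k, fit_of_le_top I (by have := h.1; simp only [top]; omega), h.2⟩
  | .cell a i, Q, h => by
    obtain ⟨u, hu, ha, hl, hQ⟩ := wp_sound hσ (e := i) h
    refine ⟨_, ?_, hQ⟩
    simp only [WExp.eval, hu, Option.bind_some]
    rw [if_pos ⟨ha, by simp only [mach]; omega⟩, hσ]
  | .add e₁ e₂, Q, h => by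
    obtain ⟨u, hu, h⟩ := wp_sound hσ (e := e₁) h
    obtain ⟨v, hv, h, hQ⟩ := wp_sound hσ (e := e₂) h
    exact ⟨_, by simp only [WExp.eval, hu, hv, Option.bind_some, fit_of_le_top I h], hQ⟩
  | .sub e₁ e₂, Q, h => by
    obtain ⟨u, hu, h⟩ := wp_sound hσ (e := e₁) h
    obtain ⟨v, hv, hQ⟩ := wp_sound hσ (e := e₂) h
    exact ⟨_, by simp only [WExp.eval, hu, hv, Option.bind_some,
      fit_of_le (WExp.eval_fit hu) (Nat.sub_le u v)], hQ⟩
  | .sizeA, Q, h => ⟨s, fit_of_le_top I (by simp only [top]; omega), h⟩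
  | .sizeB, Q, h => ⟨t, fit_of_le_top I (by simp only [top]; omega), h⟩
  | .demA i, Q, h => by
    obtain ⟨u, hu, hl, hf, hQ⟩ := wp_sound hσ (e := i) h
    exact ⟨_, by simp only [WExp.eval, hu, Option.bind_some, lookup_ext0 _ hl,
      fit_of_le_top I hf], hQ⟩
  | .capA i, Q, h => by
    obtain ⟨u, hu, hl, hf, hQ⟩ := wp_sound hσ (e := i) h
    exact ⟨_, by simp only [WExp.eval, hu, Option.bind_some, lookup_ext0 _ hl,
      fit_of_le_top I hf], hQ⟩
  | .demB i, Q, h => by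
    obtain ⟨u, hu, hl, hf, hQ⟩ := wp_sound hσ (e := i) h
    exact ⟨_, by simp only [WExp.eval, hu, Option.bind_some, lookup_ext0 _ hl,
      fit_of_le_top I hf], hQ⟩
  | .capB i, Q, h => by
    obtain ⟨u, hu, hl, hf, hQ⟩ := wp_sound hσ (e := i) h
    exact ⟨_, by simp only [WExp.eval, hu, Option.bind_some, lookup_ext0 _ hl,
      fit_of_le_top I hf], hQ⟩

theorem RExp.wp_sound {σ : State} (hσ : WordsFit I σ) : ∀ {e : RExp} {Q : ℝ → Prop},
    e.wp I σ Q → ∃ v, e.eval I (mach I) σ = some v ∧ Q v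
  | .const k, Q, h => ⟨k, rfl, h⟩
  | .cell a i, Q, h => by
    obtain ⟨u, hu, ha, hl, hQ⟩ := WExp.wp_sound hσ (e := i) h
    refine ⟨_, ?_, hQ⟩
    simp only [RExp.eval, hu, Option.bind_some]
    rw [if_pos ⟨ha, by simp only [mach]; omega⟩]
  | .add e₁ e₂, Q, h => by
    obtain ⟨u, hu, h⟩ := wp_sound hσ (e := e₁) h
    obtain ⟨v, hv, hQ⟩ := wp_sound hσ (e := e₂) h
    exact ⟨_, by simp only [RExp.eval, hu, hv, Option.bind_some], hQ⟩
  | .sub e₁ e₂, Q, h => by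
    obtain ⟨u, hu, h⟩ := wp_sound hσ (e := e₁) h
    obtain ⟨v, hv, hQ⟩ := wp_sound hσ (e := e₂) h
    exact ⟨_, by simp only [RExp.eval, hu, hv, Option.bind_some], hQ⟩
  | .cost i j, Q, h => by
    obtain ⟨u, hu, h⟩ := WExp.wp_sound hσ (e := i) h
    obtain ⟨v, hv, hus, hvt, hQ⟩ := WExp.wp_sound hσ (e := j) h
    exact ⟨_, by simp [RExp.eval, hu, hv, lookup, hus, hvt, cost0], hQ⟩

theorem Test.wp_sound {σ : State} (hσ : WordsFit I σ) : ∀ {b : Test} {Q : Prop → Prop},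
    b.wp I σ Q → ∃ v : Bool, b.eval I (mach I) σ = some v ∧ Q (v = true)
  | .wordLE e₁ e₂, Q, h => by
    obtain ⟨u, hu, h⟩ := WExp.wp_sound hσ (e := e₁) h
    obtain ⟨v, hv, hQ⟩ := WExp.wp_sound hσ (e := e₂) h
    exact ⟨decide (u ≤ v), by simp only [Test.eval, hu, hv, Option.bind_some], by simpa using hQ⟩
  | .realLE e₁ e₂, Q, h => by
    obtain ⟨u, hu, h⟩ := RExp.wp_sound hσ (e := e₁) h
    obtain ⟨v, hv, hQ⟩ := RExp.wp_sound hσ (e := e₂) h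
    exact ⟨decide (u ≤ v), by simp only [Test.eval, hu, hv, Option.bind_some], by simpa using hQ⟩
  | .not b, Q, h => by
    obtain ⟨v, hv, hQ⟩ := wp_sound hσ (b := b) h
    exact ⟨!v, by simp only [Test.eval, hv, Option.bind_some], by simpa using hQ⟩
  | .and b₁ b₂, Q, h => by
    obtain ⟨v, hv, h1, h2⟩ := wp_sound hσ (b := b₁) h
    cases v with
    | true =>
      obtain ⟨w, hw, hQ⟩ := wp_sound hσ (b := b₂) (h1 rfl)
      exact ⟨w, by simp [Test.eval, hv, hw], hQ⟩
    | false => exact ⟨false, by simp [Test.eval, hv], by simpa using h2⟩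

variable (I) in
/-- Started in `σ`, the program `p` halts without an error after at most `T` steps, in a state that
satisfies `Q`. -/
def Runs (p : Prog) (σ : State) (Q : State → Prop) (T : ℕ) : Prop :=
  ∃ σ' T', Exec I (mach I) p σ σ' T' ∧ Q σ' ∧ T' ≤ T

theorem Runs.mono {p : Prog} {σ : State} {Q Q' : State → Prop} {T T' : ℕ}
    (h : Runs I p σ Q T) (hσ : WordsFit I σ)
    (hQ : ∀ σ', Frame p σ σ' → WordsFit I σ' → Q σ' → Q' σ') (hT : T ≤ T') : Runs I p σ Q' T' := by
  obtain ⟨σ', T₁, he, hq, ht⟩ := h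
  exact ⟨σ', T₁, he, hQ σ' he.frame (he.wordsFit hσ) hq, ht.trans hT⟩

theorem Runs.seq {p q : Prog} {σ : State} {Q R : State → Prop} {T₁ T₂ T : ℕ}
    (hσ : WordsFit I σ) (hp : Runs I p σ R T₁)
    (hq : ∀ σ', Frame p σ σ' → WordsFit I σ' → R σ' → Runs I q σ' Q T₂) (hT : T₁ + T₂ ≤ T) :
    Runs I (.seq p q) σ Q T := by
  obtain ⟨σ₁, T₁', he, hr, ht⟩ := hp
  obtain ⟨σ₂, T₂', he', hr', ht'⟩ := hq σ₁ he.frame (he.wordsFit hσ) hr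
  exact ⟨σ₂, _, .seq he he', hr', by omega⟩

theorem Runs.ite {b : Test} {p q : Prog} {σ : State} {Q : State → Prop} {T : ℕ}
    (hσ : WordsFit I σ)
    (h : b.wp I σ fun P => (P → Runs I p σ Q T) ∧ (¬ P → Runs I q σ Q T)) :
    Runs I (.ite b p q) σ Q (b.steps + 1 + T) := by
  obtain ⟨v, hv, h1, h2⟩ := Test.wp_sound hσ h
  cases v with
  | true =>
    obtain ⟨σ', T', he, hq, ht⟩ := h1 rfl
    exact ⟨σ', _, .iteTrue hv he, hq, by omega⟩
  | false =>
    obtain ⟨σ', T', he, hq, ht⟩ := h2 (by simp)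
    exact ⟨σ', _, .iteFalse hv he, hq, by omega⟩

theorem Runs.flat {p : Prog} {σ : State} {Q : State → Prop} (hσ : WordsFit I σ)
    (h : p.wp I σ Q) : Runs I p σ Q p.flatTime := by
  induction p generalizing σ Q with
  | skip => exact ⟨σ, _, .skip σ, h, le_rfl⟩
  | setWord a i e =>
    obtain ⟨u, hu, h⟩ := WExp.wp_sound hσ (e := i) h
    obtain ⟨v, hv, ha, hl, hQ⟩ := WExp.wp_sound hσ (e := e) h
    exact ⟨_, _, .setWord hu hv ha (by simp only [mach]; omega), hQ, le_rfl⟩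
  | setReal a i e =>
    obtain ⟨u, hu, h⟩ := WExp.wp_sound hσ (e := i) h
    obtain ⟨v, hv, ha, hl, hQ⟩ := RExp.wp_sound hσ (e := e) h
    exact ⟨_, _, .setReal hu hv ha (by simp only [mach]; omega), hQ, le_rfl⟩
  | emit i j =>
    obtain ⟨u, hu, h⟩ := WExp.wp_sound hσ (e := i) h
    obtain ⟨v, hv, hQ⟩ := WExp.wp_sound hσ (e := j) h
    exact ⟨_, _, .emit hu hv, hQ, le_rfl⟩
  | seq p q ihp ihq => exact Runs.seq hσ (ihp hσ h) (fun σ' _ hσ' h' => ihq hσ' h') le_rfl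
  | ite b p q ihp ihq =>
    obtain ⟨v, hv, h1, h2⟩ := Test.wp_sound hσ (b := b) h
    simp only [Prog.flatTime]
    cases v with
    | true =>
      obtain ⟨σ', T', he, hq, ht⟩ := ihp hσ (h1 rfl)
      exact ⟨σ', _, .iteTrue hv he, hq, by omega⟩
    | false =>
      obtain ⟨σ', T', he, hq, ht⟩ := ihq hσ (h2 (by simp))
      exact ⟨σ', _, .iteFalse hv he, hq, by omega⟩
  | loop b p => exact h.elim

theorem Runs.loop {b : Test} {p : Prog} {Inv Q : State → Prop} {μ : State → ℕ} {T k : ℕ}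
    {σ₀ : State} (hσ₀ : WordsFit I σ₀) (h₀ : Inv σ₀) (hk : μ σ₀ ≤ k)
    (h : ∀ σ, Frame p σ₀ σ → WordsFit I σ → Inv σ → b.wp I σ fun P =>
      (P → Runs I p σ (fun σ' => Inv σ' ∧ μ σ' < μ σ) T) ∧ (¬ P → Q σ)) :
    Runs I (.loop b p) σ₀ Q ((k + 1) * (b.steps + 1 + T)) := by
  suffices H : ∀ k σ, Frame p σ₀ σ → WordsFit I σ → Inv σ → μ σ ≤ k →
      Runs I (.loop b p) σ Q ((k + 1) * (b.steps + 1 + T)) from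
    H k σ₀ (Frame.refl _ _) hσ₀ h₀ hk
  intro k
  induction k with
  | zero =>
    intro σ hF hσ hI hm
    obtain ⟨v, hv, h1, h2⟩ := Test.wp_sound hσ (h σ hF hσ hI)
    cases v with
    | true =>
      obtain ⟨σ', T', he, ⟨_, hq⟩, ht⟩ := h1 rfl
      omega
    | false => exact ⟨σ, _, .loopFalse hv, h2 (by simp), by omega⟩
  | succ k ih =>
    intro σ hF hσ hI hm
    obtain ⟨v, hv, h1, h2⟩ := Test.wp_sound hσ (h σ hF hσ hI)
    cases v with
    | true =>
      obtain ⟨σ', T', he, ⟨hI', hq⟩, ht⟩ := h1 rfl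
      obtain ⟨σ'', T'', he', hQ, ht'⟩ :=
        ih σ' (hF.trans he.frame) (he.wordsFit hσ) hI' (by omega)
      refine ⟨σ'', _, .loopTrue hv he he', hQ, ?_⟩
      rw [Nat.succ_mul (k + 1)]
      omega
    | false =>
      exact ⟨σ, _, .loopFalse hv, h2 (by simp), by
        have := Nat.le_mul_of_pos_left (b.steps + 1 + T) (Nat.succ_pos (k + 1))
        rw [Nat.succ_eq_add_one] at this
        omega⟩

attribute [simp] WExp.wp RExp.wp Test.wp Prog.wp Prog.wordWrites Prog.realWrites Prog.emits

@[simp]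
theorem State.setWord_word (σ : State) (a i v a' i' : ℕ) :
    (σ.setWord a i v).word a' i' = if a' = a ∧ i' = i then v else σ.word a' i' := rfl

@[simp]
theorem State.setWord_real (σ : State) (a i v : ℕ) : (σ.setWord a i v).real = σ.real := rfl

@[simp]
theorem State.setWord_out (σ : State) (a i v : ℕ) : (σ.setWord a i v).out = σ.out := rfl

@[simp]
theorem State.setReal_real (σ : State) (a i : ℕ) (v : ℝ) (a' i' : ℕ) :
    (σ.setReal a i v).real a' i' = if a' = a ∧ i' = i then v else σ.real a' i' := rfl

@[simp]
theorem State.setReal_word (σ : State) (a i : ℕ) (v : ℝ) : (σ.setReal a i v).word = σ.word := rfl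

@[simp]
theorem State.emit_word (σ : State) (i j : ℕ) : (σ.emit i j).word = σ.word := rfl

@[simp]
theorem State.emit_out (σ : State) (i j : ℕ) : (σ.emit i j).out = σ.out ++ [(i, j)] := rfl

end

/-! ### Skew-symmetric flows -/

/-- The net outflow of the node `p` in a flow on the nodes `0, …, N - 1`. -/
def outflow (N : ℕ) (F : ℕ → ℕ → ℤ) (p : ℕ) : ℤ := ∑ q ∈ range N, F p q

/-- A flow that is described by its net values in both directions. -/
def Skew (F : ℕ → ℕ → ℤ) : Prop := ∀ p q, F p q = -F q p

/-- One more unit of flow from `u` to `v`. -/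
def push (F : ℕ → ℕ → ℤ) (u v : ℕ) : ℕ → ℕ → ℤ := fun p q =>
  F p q + (if p = u ∧ q = v then 1 else 0) - (if p = v ∧ q = u then 1 else 0)

theorem Skew.push {F : ℕ → ℕ → ℤ} (h : Skew F) (u v : ℕ) : Skew (push F u v) := by
  intro p q
  have := h p q
  simp only [GenAssign.push, and_comm (a := q = u), and_comm (a := q = v)]
  omega

theorem Skew.self {F : ℕ → ℕ → ℤ} (h : Skew F) (p : ℕ) : F p p = 0 := by
  have := h p p
  omega

theorem outflow_push {N : ℕ} (F : ℕ → ℕ → ℤ) {u v : ℕ} (hu : u < N) (hv : v < N) (p : ℕ) :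
    outflow N (push F u v) p =
      outflow N F p + (if p = u then 1 else 0) - (if p = v then 1 else 0) := by
  have key : ∀ a b, b < N → ∑ q ∈ range N, (if p = a ∧ q = b then (1 : ℤ) else 0) =
      if p = a then 1 else 0 := by
    intro a b hb
    by_cases h : p = a <;> simp [h, hb]
  simp only [outflow, push, sum_sub_distrib, sum_add_distrib, key u v hv, key v u hu]

/-- The flow values inside a set of nodes cancel. -/
theorem Skew.sum_inside {F : ℕ → ℕ → ℤ} (h : Skew F) (S : Finset ℕ) :
    ∑ p ∈ S, ∑ q ∈ S, F p q = 0 := by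
  have h1 : ∑ p ∈ S, ∑ q ∈ S, F p q = ∑ p ∈ S, ∑ q ∈ S, -F p q := by
    rw [sum_comm]
    exact sum_congr rfl fun p _ => sum_congr rfl fun q _ => h q p
  simp only [sum_neg_distrib] at h1
  omega

/-- If `F` has to carry one unit from `r` to `g` in order to become a circulation, and there is a
circulation `G` within the bounds `U`, then every set of nodes that separates `r` from `g` is left
by a residual arc. -/
theorem exists_residual_of_cut {N : ℕ} {F G U : ℕ → ℕ → ℤ} {r g : ℕ} (hF : Skew F) (hG : Skew G)
    (hGU : ∀ p < N, ∀ q < N, G p q ≤ U p q) (hG0 : ∀ p < N, outflow N G p = 0)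
    (hF0 : ∀ p < N, outflow N F p = (if p = g then 1 else 0) - (if p = r then 1 else 0))
    {S : Finset ℕ} (hS : S ⊆ range N) (hr : r ∈ S) (hg : g ∉ S) :
    ∃ p ∈ S, ∃ q < N, q ∉ S ∧ F p q < U p q := by
  by_contra! hcon
  have h1 : ∑ p ∈ S, (outflow N G p - outflow N F p) = 1 := by
    rw [sum_congr rfl fun p hp => by
      rw [hG0 p (mem_range.1 (hS hp)), hF0 p (mem_range.1 (hS hp))]]
    simp only [sum_sub_distrib, sum_ite_eq', hr, hg, if_true, if_false, sum_const_zero]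
    norm_num
  have h2 : ∑ p ∈ S, (outflow N G p - outflow N F p) =
      ∑ p ∈ S, ∑ q ∈ S, G p q - ∑ p ∈ S, ∑ q ∈ S, F p q +
        ∑ p ∈ S, ∑ q ∈ range N \ S, (G p q - F p q) := by
    simp only [outflow, ← sum_sub_distrib, ← sum_add_distrib]
    refine sum_congr rfl fun p _ => ?_
    rw [← sum_sdiff hS]
    ring
  rw [hG.sum_inside, hF.sum_inside] at h2
  have h3 : ∑ p ∈ S, ∑ q ∈ range N \ S, (G p q - F p q) ≤ 0 := by
    refine sum_nonpos fun p hp => sum_nonpos fun q hq => ?_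
    rw [mem_sdiff, mem_range] at hq
    have := hcon p hp q hq.1 hq.2
    have := hGU p (mem_range.1 (hS hp)) q hq.1
    omega
  omega

/-- A circulation without residual arcs of negative reduced length has minimum cost among the
circulations within the bounds. -/
theorem cost_le_of_reduced {N : ℕ} {F G U : ℕ → ℕ → ℤ} {w : ℕ → ℕ → ℝ} {π : ℕ → ℝ}
    (hF : Skew F) (hG : Skew G) (hw : ∀ p q, w p q = -w q p)
    (hGU : ∀ p < N, ∀ q < N, G p q ≤ U p q) (hG0 : ∀ p < N, outflow N G p = 0)
    (hF0 : ∀ p < N, outflow N F p = 0)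
    (hred : ∀ p < N, ∀ q < N, F p q < U p q → 0 ≤ w p q + π p - π q) :
    ∑ p ∈ range N, ∑ q ∈ range N, w p q * F p q ≤
      ∑ p ∈ range N, ∑ q ∈ range N, w p q * G p q := by
  have hpot : ∀ H : ℕ → ℕ → ℤ, Skew H → (∀ p < N, outflow N H p = 0) →
      ∑ p ∈ range N, ∑ q ∈ range N, (π p - π q) * (H p q : ℝ) = 0 := by
    intro H hH hH0
    have e1 : ∑ p ∈ range N, ∑ q ∈ range N, π p * (H p q : ℝ) = 0 := by
      refine sum_eq_zero fun p hp => ?_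
      rw [← mul_sum]
      have := hH0 p (mem_range.1 hp)
      rw [outflow] at this
      rw [← Int.cast_sum, this]
      simp
    have e2 : ∑ p ∈ range N, ∑ q ∈ range N, π q * (H p q : ℝ) = 0 := by
      rw [sum_comm]
      rw [sum_congr rfl fun q _ => sum_congr rfl fun p _ => by rw [hH p q]]
      simp only [Int.cast_neg, mul_neg, sum_neg_distrib, e1, neg_zero]
    simp only [sub_mul, sum_sub_distrib, e1, e2, sub_zero]
  have hsum : ∑ p ∈ range N, ∑ q ∈ range N, (w p q + π p - π q) * ((G p q : ℝ) - F p q) =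
      ∑ p ∈ range N, ∑ q ∈ range N, w p q * G p q -
        ∑ p ∈ range N, ∑ q ∈ range N, w p q * F p q := by
    have a := hpot G hG hG0
    have b := hpot F hF hF0
    have : ∀ p q, (w p q + π p - π q) * ((G p q : ℝ) - F p q) =
      (w p q * G p q - w p q * F p q) + ((π p - π q) * (G p q : ℝ) - (π p - π q) * (F p q : ℝ)) :=
      fun p q => by ring
    simp only [this, sum_add_distrib, sum_sub_distrib, a, b]
    ring
  have hnn : 0 ≤ ∑ p ∈ range N, ∑ q ∈ range N, (w p q + π p - π q) * ((G p q : ℝ) - F p q) := by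
    refine sum_nonneg fun p hp => sum_nonneg fun q hq => ?_
    rw [mem_range] at hp hq
    rcases lt_trichotomy (F p q) (G p q) with h | h | h
    · have h1 := hred p hp q hq (h.trans_le (hGU p hp q hq))
      have h2 : (F p q : ℝ) < G p q := by exact_mod_cast h
      exact mul_nonneg h1 (by linarith)
    · simp [h]
    · have h0 : F q p < G q p := by
        rw [hF q p, hG q p]
        omega
      have h1 := hred q hq p hp (h0.trans_le (hGU q hq p hp))
      have h2 : (G p q : ℝ) < F p q := by exact_mod_cast h
      rw [hw q p] at h1
      exact mul_nonneg_of_nonpos_of_nonpos (by linarith) (by linarith)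
  linarith

/-! ### Shortest paths -/

/-- The invariant of Dijkstra's algorithm on the nodes `0, …, N - 1` after `k` nodes are finished.
A node `v` is unseen, labelled or finished according to `st v = 0, 1, 2`; a labelled or finished
node has the tentative distance `d v` and the predecessor `par v`; `rk v` is the number of nodes
that were finished before `v`. -/
structure Search (N root : ℕ) (res : ℕ → ℕ → Prop) (len : ℕ → ℕ → ℝ) (st : ℕ → ℕ) (d : ℕ → ℝ)
    (par rk : ℕ → ℕ) (k : ℕ) : Prop where
  root_ne : st root ≠ 0
  le_two : ∀ v < N, st v ≤ 2
  par_spec : ∀ v < N, st v ≠ 0 → v ≠ root → par v < N ∧ st (par v) = 2 ∧ res (par v) v ∧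
    d v = d (par v) + len (par v) v ∧ (st v = 2 → rk (par v) < rk v)
  rank_lt : ∀ v < N, st v = 2 → rk v < k
  closed : ∀ u < N, ∀ v < N, st u = 2 → res u v → st v ≠ 0 ∧ d v ≤ d u + len u v
  mono : ∀ u < N, ∀ v < N, st u = 2 → st v = 1 → d u ≤ d v
  card_eq : ((range N).filter fun v => st v = 2).card = k

/-- The label of `v` is to be improved by the arc from the node `u`. -/
def Improves (res : ℕ → ℕ → Prop) (len : ℕ → ℕ → ℝ) (st : ℕ → ℕ) (d : ℕ → ℝ) (u v : ℕ) : Prop :=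
  res u v ∧ st v ≠ 2 ∧ (st v = 0 ∨ d u + len u v < d v)

/-- Finishing a labelled node of minimum distance and relaxing the arcs that leave it preserves the
invariant of Dijkstra's algorithm. -/
theorem Search.step {N root : ℕ} {res : ℕ → ℕ → Prop} {len : ℕ → ℕ → ℝ} {st st₁ st' : ℕ → ℕ}
    {d d' : ℕ → ℝ} {par par' rk : ℕ → ℕ} {k u : ℕ} (h : Search N root res len st d par rk k)
    (hroot : root < N) (hu : u < N) (hu1 : st u = 1) (hmin : ∀ v < N, st v = 1 → d u ≤ d v)
    (hlen : ∀ v < N, res u v → 0 ≤ len u v)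
    (hst₁ : ∀ v, st₁ v = if v = u then 2 else st v)
    (hyes : ∀ v < N, Improves res len st₁ d u v →
      st' v = 1 ∧ d' v = d u + len u v ∧ par' v = u)
    (hno : ∀ v < N, ¬ Improves res len st₁ d u v →
      st' v = st₁ v ∧ d' v = d v ∧ par' v = par v) :
    Search N root res len st' d' par' (fun v => if v = u then k else rk v) (k + 1) ∧
      ∀ v < N, (st' v = 2 → d' v ≤ d' u) ∧ (st' v = 2 ↔ st v = 2 ∨ v = u) := by
  have hu' : ¬ Improves res len st₁ d u u := fun hi => hi.2.1 (by rw [hst₁, if_pos rfl])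
  obtain ⟨su, du, -⟩ := hno u hu hu'
  rw [hst₁, if_pos rfl] at su
  -- finished nodes are not touched
  have fin : ∀ v < N, st v = 2 → st' v = 2 ∧ d' v = d v ∧ par' v = par v ∧ v ≠ u := by
    intro v hv hv2
    have hvu : v ≠ u := fun e => by rw [e, hu1] at hv2; omega
    have := hno v hv fun hi => hi.2.1 (by rw [hst₁, if_neg hvu, hv2])
    rw [hst₁, if_neg hvu] at this
    exact ⟨this.1.trans hv2, this.2.1, this.2.2, hvu⟩
  have two : ∀ v < N, st' v = 2 → st v = 2 ∨ v = u := by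
    intro v hv hv2
    by_cases hi : Improves res len st₁ d u v
    · rw [(hyes v hv hi).1] at hv2; omega
    · have := (hno v hv hi).1
      rw [hst₁] at this
      by_cases hvu : v = u
      · exact Or.inr hvu
      · rw [if_neg hvu] at this
        exact Or.inl (this.symm.trans hv2)
  have dle : ∀ v < N, st v ≠ 0 → d' v ≤ d v := by
    intro v hv hv0
    by_cases hi : Improves res len st₁ d u v
    · rw [(hyes v hv hi).2.1]
      rcases hi.2.2 with h0 | h0
      · rw [hst₁] at h0
        split_ifs at h0
        exact absurd h0 hv0
      · exact h0.le
    · exact (hno v hv hi).2.1.le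
  have pos : ∀ v < N, st v ≠ 0 → st' v ≠ 0 := by
    intro v hv hv0
    by_cases hi : Improves res len st₁ d u v
    · rw [(hyes v hv hi).1]; omega
    · rw [(hno v hv hi).1, hst₁]
      split_ifs <;> omega
  have du_le : ∀ v < N, st' v = 1 → d u ≤ d' v := by
    intro v hv hv1
    by_cases hi : Improves res len st₁ d u v
    · rw [(hyes v hv hi).2.1]
      linarith [hlen v hv hi.1]
    · obtain ⟨a, b, -⟩ := hno v hv hi
      rw [b]
      rw [hst₁] at a
      split_ifs at a with hvu
      · omega
      · exact hmin v hv (a.symm.trans hv1)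
  refine ⟨⟨?_, ?_, ?_, ?_, ?_, ?_, ?_⟩, ?_⟩
  · exact pos root hroot h.root_ne
  · intro v hv
    by_cases hi : Improves res len st₁ d u v
    · rw [(hyes v hv hi).1]; omega
    · rw [(hno v hv hi).1, hst₁]
      have := h.le_two v hv
      split_ifs <;> omega
  · intro v hv hv0 hvr
    by_cases hi : Improves res len st₁ d u v
    · obtain ⟨a, b, c⟩ := hyes v hv hi
      rw [c, a, b, du]
      exact ⟨hu, su, hi.1, rfl, by omega⟩
    · obtain ⟨a, b, c⟩ := hno v hv hi
      have hv0' : st v ≠ 0 := by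
        rw [a, hst₁] at hv0
        split_ifs at hv0 with hvu
        · rw [hvu, hu1]; omega
        · exact hv0
      obtain ⟨p1, p2, p3, p4, p5⟩ := h.par_spec v hv hv0' hvr
      obtain ⟨q1, q2, -, q4⟩ := fin _ p1 p2
      rw [c, b, q2]
      refine ⟨p1, q1, p3, p4, fun hv2 => ?_⟩
      rw [if_neg q4]
      split_ifs with hvu
      · exact h.rank_lt _ p1 p2
      · exact p5 ((two v hv hv2).resolve_right hvu)
  · intro v hv hv2
    split_ifs with hvu
    · omega
    · have := h.rank_lt v hv ((two v hv hv2).resolve_right hvu)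
      omega
  · intro a ha v hv ha2 hres
    rcases two a ha ha2 with h2 | rfl
    · obtain ⟨c1, c2⟩ := h.closed a ha v hv h2 hres
      refine ⟨pos v hv c1, ?_⟩
      rw [(fin a ha h2).2.1]
      exact (dle v hv c1).trans c2
    · rw [du]
      by_cases hi : Improves res len st₁ d a v
      · obtain ⟨a1, a2, -⟩ := hyes v hv hi
        rw [a1, a2]
        exact ⟨by omega, le_rfl⟩
      · obtain ⟨a1, a2, -⟩ := hno v hv hi
        have hi' := hi
        simp only [Improves, not_and_or, not_not, not_or, not_lt] at hi'
        rcases hi' with h1 | h1 | h1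
        · exact absurd hres h1
        · refine ⟨by rw [a1, h1]; omega, ?_⟩
          have h3 := hlen v hv hres
          rw [h1] at a1
          rcases two v hv a1 with h2 | rfl
          · have := h.mono v hv a ha h2 hu1
            rw [a2]; linarith
          · rw [a2]; linarith
        · exact ⟨by rw [a1]; exact h1.1, a2.le.trans h1.2⟩
  · intro a ha v hv ha2 hv1
    rcases two a ha ha2 with h2 | rfl
    · rw [(fin a ha h2).2.1]
      exact (h.mono a ha u hu h2 hu1).trans (du_le v hv hv1)
    · rw [du]
      exact du_le v hv hv1
  · have hins : ((range N).filter fun v => st' v = 2) =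
        insert u ((range N).filter fun v => st v = 2) := by
      ext v
      simp only [mem_filter, mem_range, mem_insert]
      constructor
      · rintro ⟨hv, hv2⟩
        exact (two v hv hv2).symm.imp id fun h2 => ⟨hv, h2⟩
      · rintro (rfl | ⟨hv, h2⟩)
        · exact ⟨hu, su⟩
        · exact ⟨hv, (fin v hv h2).1⟩
    rw [hins, card_insert_of_notMem, h.card_eq]
    intro hm
    have := (mem_filter.1 hm).2
    omega
  · intro v hv
    refine ⟨fun hv2 => ?_, two v hv, ?_⟩
    · rw [du]
      rcases two v hv hv2 with h2 | rfl
      · rw [(fin v hv h2).2.1]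
        exact h.mono v hv u hu h2 hu1
      · exact du.le
    · rintro (h2 | rfl)
      · exact (fin v hv h2).1
      · exact su

/-- Raising the potentials of the finished nodes by their distances, relative to the distance of the
target, keeps the reduced lengths of the residual arcs nonnegative. -/
theorem Search.reduced {N root : ℕ} {res : ℕ → ℕ → Prop} {w : ℕ → ℕ → ℝ} {π π' : ℕ → ℝ}
    {st : ℕ → ℕ} {d : ℕ → ℝ} {par rk : ℕ → ℕ} {k g : ℕ}
    (h : Search N root res (fun p q => w p q + π p - π q) st d par rk k)
    (hg : g < N) (hg2 : st g = 2) (hlast : ∀ v < N, st v = 2 → d v ≤ d g)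
    (hlen : ∀ p < N, ∀ q < N, res p q → 0 ≤ w p q + π p - π q)
    (hπ : ∀ v < N, π' v = if st v = 2 then π v + (d v - d g) else π v) :
    (∀ p < N, ∀ q < N, res p q → 0 ≤ w p q + π' p - π' q) ∧
      ∀ v < N, st v = 2 → v ≠ root → w (par v) v + π' (par v) - π' v = 0 := by
  constructor
  · intro p hp q hq hr
    have h0 := hlen p hp q hq hr
    rw [hπ p hp, hπ q hq]
    split_ifs with h1 h2 h2
    · have := (h.closed p hp q hq h1 hr).2
      linarith
    · have h3 := h.closed p hp q hq h1 hr
      have h4 := h.le_two q hq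
      have h5 := h.mono g hg q hq hg2 (by omega)
      linarith [h3.2]
    · linarith [hlast q hq h2]
    · exact h0
  · intro v hv hv2 hvr
    obtain ⟨p1, p2, -, p4, -⟩ := h.par_spec v hv (by omega) hvr
    rw [hπ v hv, hπ _ p1, if_pos hv2, if_pos p2]
    linarith

/-- The invariant of the augmentation along the path of predecessors, walked from the target to the
root: `F` is obtained from `F₁` by pushing a unit along the part of the path behind `v`. -/
structure Augment (N root : ℕ) (U : ℕ → ℕ → ℤ) (w : ℕ → ℕ → ℝ) (π : ℕ → ℝ) (rk : ℕ → ℕ)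
    (F₁ F : ℕ → ℕ → ℤ) (v : ℕ) : Prop where
  skew : Skew F
  le_max : ∀ p < N, ∀ q < N, F p q ≤ max (F₁ p q) (U p q)
  reduced : ∀ p < N, ∀ q < N, F p q < U p q → 0 ≤ w p q + π p - π q
  out_eq : ∀ p < N, outflow N F p = (if p = v then 1 else 0) - (if p = root then 1 else 0)
  unchanged : ∀ p q, rk p < rk v → F p q = F₁ p q

theorem Augment.step {N root : ℕ} {U : ℕ → ℕ → ℤ} {w : ℕ → ℕ → ℝ} {π : ℕ → ℝ} {rk : ℕ → ℕ}
    {F₁ F : ℕ → ℕ → ℤ} {u v : ℕ} (h : Augment N root U w π rk F₁ F v) (hu : u < N) (hv : v < N)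
    (hw : ∀ p q, w p q = -w q p) (hrk : rk u < rk v) (hres : F₁ u v < U u v)
    (htight : w u v + π u - π v = 0) :
    Augment N root U w π rk F₁ (push F u v) u ∧ F u v < U u v := by
  have hlt : F u v < U u v := by rwa [h.unchanged u v hrk]
  have huv : u ≠ v := fun e => by rw [e] at hrk; omega
  refine ⟨⟨h.skew.push u v, ?_, ?_, ?_, ?_⟩, hlt⟩
  · intro p hp q hq
    have := h.le_max p hp q hq
    simp only [push]
    by_cases h1 : p = u ∧ q = v
    · obtain ⟨rfl, rfl⟩ := h1
      rw [if_pos ⟨rfl, rfl⟩, if_neg (fun e => huv e.1)]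
      exact le_max_of_le_right (by omega)
    · rw [if_neg h1]
      split_ifs <;> omega
  · intro p hp q hq hlt'
    simp only [push] at hlt'
    by_cases h1 : p = v ∧ q = u
    · obtain ⟨rfl, rfl⟩ := h1
      rw [hw]
      linarith
    · rw [if_neg h1] at hlt'
      refine h.reduced p hp q hq ?_
      split_ifs at hlt' <;> omega
  · intro p hp
    rw [outflow_push F hu hv, h.out_eq p hp]
    ring
  · intro p q hp
    have h1 : p ≠ u := fun e => by rw [e] at hp; omega
    have h2 : p ≠ v := fun e => by rw [e] at hp; omega
    simp only [push, h1, h2, false_and, if_false]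
    rw [h.unchanged p q (hp.trans hrk)]
    ring

/-! ### The network of an instance -/

section

variable {s t : ℕ} (I : Problem s t)

/-- The word that represents the flow value `0` from the ground node to the object `v`: words are
nonnegative, and the flow to the objects of `B` is not. -/
def offset (s t v : ℕ) : ℕ := if v < s then 0 else s + t

/-- The word that represents the least admissible flow from the ground node to `v`. -/
def lowWord (v : ℕ) : ℕ :=
  if v < s then ext0 I.demA v else s + t - ext0 I.capB (v - s)

/-- The word that represents the greatest admissible flow from the ground node to `v`. -/
def highWord (v : ℕ) : ℕ :=
  if v < s then ext0 I.capA v else s + t - ext0 I.demB (v - s)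

/-- The upper bounds for the net flow of the network, which has the nodes `0, …, s - 1` for `A`, the
nodes `s, …, s + t - 1` for `B` and the ground node `s + t`. -/
def bound (p q : ℕ) : ℤ :=
  if p < s + t then
    if q < s + t then (if p < s ∧ s ≤ q then 1 else 0) else (offset s t p : ℤ) - lowWord I p
  else if q < s + t then (highWord I q : ℤ) - offset s t q else 0

/-- The cost of a unit of flow: `c(a, b)` from `a` to `b`, and its negative in the opposite
direction. -/
def arcCost (p q : ℕ) : ℝ :=
  if p < s ∧ s ≤ q ∧ q < s + t then cost0 I p (q - s)
  else if q < s ∧ s ≤ p ∧ p < s + t then -cost0 I q (p - s) else 0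

theorem arcCost_skew (p q : ℕ) : arcCost I p q = -arcCost I q p := by
  unfold arcCost
  by_cases h1 : p < s ∧ s ≤ q ∧ q < s + t
  · rw [if_pos h1, if_neg (by omega), if_pos h1, neg_neg]
  · rw [if_neg h1]
    by_cases h2 : q < s ∧ s ≤ p ∧ p < s + t
    · rw [if_pos h2, if_pos h2]
    · rw [if_neg h2, if_neg h2, if_neg h1, neg_zero]

/-- The flow between objects is within its bounds. -/
def InBox (F : ℕ → ℕ → ℤ) : Prop := ∀ p < s + t, ∀ q < s + t, F p q ≤ bound I p q

variable {I}

theorem InBox.unit {F : ℕ → ℕ → ℤ} (h : InBox I F) (hF : Skew F) {p q : ℕ} (hp : p < s)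
    (hq : s ≤ q) (hq' : q < s + t) : F p q = 0 ∨ F p q = 1 := by
  have h1 := h p (by omega) q hq'
  have h2 := h q hq' p (by omega)
  have h3 := hF p q
  rw [bound, if_pos (by omega), if_pos hq', if_pos ⟨hp, hq⟩] at h1
  rw [bound, if_pos hq', if_pos (by omega), if_neg (by omega)] at h2
  omega

theorem InBox.eq_zero {F : ℕ → ℕ → ℤ} (h : InBox I F) (hF : Skew F) {p q : ℕ} (hp : p < s + t)
    (hq : q < s + t) (hpq : p < s ↔ q < s) : F p q = 0 := by
  have h1 := h p hp q hq
  have h2 := h q hq p hp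
  have h3 := hF p q
  rw [bound, if_pos hp, if_pos hq, if_neg (by omega)] at h1
  rw [bound, if_pos hq, if_pos hp, if_neg (by omega)] at h2
  omega

/-- Between two objects there is a unit of flow in one direction or none. -/
theorem InBox.natAbs_le {F : ℕ → ℕ → ℤ} (h : InBox I F) (hF : Skew F) {p q : ℕ}
    (hp : p < s + t) (hq : q < s + t) : (F p q).natAbs ≤ 1 := by
  by_cases h1 : p < s ↔ q < s
  · simp [h.eq_zero hF hp hq h1]
  · by_cases h2 : p < s
    · rcases h.unit hF h2 (by omega) hq with h3 | h3 <;> simp [h3]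
    · rcases h.unit hF (p := q) (q := p) (by omega) (by omega) hp with h3 | h3 <;>
        simp [hF p q, h3]

theorem ground_eq_sum {F : ℕ → ℕ → ℤ} (hF : Skew F) {v : ℕ}
    (h0 : outflow (s + t + 1) F v = 0) : F (s + t) v = ∑ q ∈ range (s + t), F v q := by
  rw [outflow, sum_range_succ] at h0
  rw [hF]
  omega

theorem ground_bounds {F : ℕ → ℕ → ℤ} (h : InBox I F) (hF : Skew F) {v : ℕ} (hv : v < s + t)
    (h0 : outflow (s + t + 1) F v = 0) :
    0 ≤ F (s + t) v + offset s t v ∧ F (s + t) v + offset s t v ≤ s + t := by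
  rw [ground_eq_sum hF h0]
  by_cases hvs : v < s
  · rw [offset, if_pos hvs]
    have h1 : ∀ q ∈ range (s + t), 0 ≤ F v q ∧ F v q ≤ 1 := by
      intro q hq
      rw [mem_range] at hq
      by_cases hqs : q < s
      · have := h.eq_zero hF hv hq (by simp [hvs, hqs])
        omega
      · have := h.unit hF hvs (by omega) hq
        omega
    have h2 := sum_nonneg fun q hq => (h1 q hq).1
    have h3 := sum_le_sum fun q hq => (h1 q hq).2
    simp only [sum_const, card_range, nsmul_eq_mul, mul_one] at h3
    push_cast at h3 ⊢
    omega
  · rw [offset, if_neg hvs]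
    have h1 : ∀ q ∈ range (s + t), -1 ≤ F v q ∧ F v q ≤ 0 := by
      intro q hq
      rw [mem_range] at hq
      by_cases hqs : q < s
      · have := h.unit hF (p := q) (q := v) hqs (by omega) hv
        have := hF v q
        omega
      · have := h.eq_zero hF hv hq (by simp [hvs, hqs])
        omega
    have h2 := sum_nonpos fun q hq => (h1 q hq).2
    have h3 := sum_le_sum fun q hq => (h1 q hq).1
    simp only [sum_const, card_range, nsmul_eq_mul] at h3
    push_cast at h3 ⊢
    omega

/-! ### Matchings as flows -/

/-- The incidence function of the pairs of `M`, as pairs of nodes. -/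
def pairCount (M : Finset (Fin s × Fin t)) (p q : ℕ) : ℤ :=
  ∑ e ∈ M, if p = e.1 ∧ q = s + e.2 then 1 else 0

/-- The flow that sends a unit from `a` to `b` for every pair `(a, b)` of `M`, and is balanced by
the ground node. -/
def flowOf (M : Finset (Fin s × Fin t)) (p q : ℕ) : ℤ :=
  if p < s + t then
    if q < s + t then pairCount M p q - pairCount M q p
    else -∑ r ∈ range (s + t), (pairCount M p r - pairCount M r p)
  else if q < s + t then ∑ r ∈ range (s + t), (pairCount M q r - pairCount M r q) else 0

theorem flowOf_skew (M : Finset (Fin s × Fin t)) : Skew (flowOf M) := by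
  intro p q
  unfold flowOf
  split_ifs <;> ring

theorem outflow_flowOf (M : Finset (Fin s × Fin t)) {p : ℕ} (hp : p < s + t + 1) :
    outflow (s + t + 1) (flowOf M) p = 0 := by
  rw [outflow, sum_range_succ]
  by_cases h : p < s + t
  · have : ∀ q ∈ range (s + t), flowOf M p q = pairCount M p q - pairCount M q p := by
      intro q hq
      rw [flowOf, if_pos h, if_pos (mem_range.1 hq)]
    rw [sum_congr rfl this, flowOf, if_pos h, if_neg (lt_irrefl _)]
    ring
  · obtain rfl : p = s + t := by omega
    have : ∀ q ∈ range (s + t), flowOf M (s + t) q =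
        ∑ r ∈ range (s + t), (pairCount M q r - pairCount M r q) := by
      intro q hq
      rw [flowOf, if_neg h, if_pos (mem_range.1 hq)]
    rw [sum_congr rfl this, (flowOf_skew M).self, add_zero]
    exact Skew.sum_inside (F := fun p q => pairCount M p q - pairCount M q p)
      (fun p q => by ring) _

theorem pairCount_eq (M : Finset (Fin s × Fin t)) (i : Fin s) (j : Fin t) :
    pairCount M i (s + j) = if (i, j) ∈ M then 1 else 0 := by
  have : ∀ e : Fin s × Fin t, ((i : ℕ) = e.1 ∧ s + (j : ℕ) = s + e.2) ↔ (i, j) = e := by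
    rintro ⟨a, b⟩
    simp [Fin.ext_iff]
  simp only [pairCount, this, sum_ite_eq]

theorem pairCount_eq_zero (M : Finset (Fin s × Fin t)) {p q : ℕ} (h : ¬ (p < s ∧ s ≤ q)) :
    pairCount M p q = 0 := by
  refine sum_eq_zero fun e _ => if_neg ?_
  have := e.1.2
  omega

theorem sum_pairCount_left (M : Finset (Fin s × Fin t)) (i : Fin s) :
    ∑ r ∈ range (s + t), (pairCount M i r - pairCount M r i) = Problem.degA M i := by
  have h0 : ∀ r, pairCount M r i = 0 := fun r =>
    pairCount_eq_zero M (by have := i.2; omega)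
  simp only [h0, sub_zero]
  simp only [pairCount]
  rw [sum_comm, Problem.degA, card_filter]
  push_cast
  refine sum_congr rfl fun e _ => ?_
  have := e.2.2
  by_cases h : e.1 = i
  · simp [h]
  · have h' : ¬ (i : ℕ) = e.1 := fun hh => h (Fin.ext hh.symm)
    simp [h, h']

theorem sum_pairCount_right (M : Finset (Fin s × Fin t)) (j : Fin t) :
    ∑ r ∈ range (s + t), (pairCount M (s + j) r - pairCount M r (s + j)) =
      -(Problem.degB M j : ℤ) := by
  have h0 : ∀ r, pairCount M (s + j) r = 0 := fun r =>
    pairCount_eq_zero M (by omega)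
  simp only [h0, zero_sub, sum_neg_distrib]
  simp only [pairCount]
  rw [sum_comm, Problem.degB, card_filter]
  push_cast
  congr 1
  refine sum_congr rfl fun e _ => ?_
  have := e.1.2
  have h2 : (e.1 : ℕ) < s + t := by omega
  by_cases h : e.2 = j
  · simp [h, h2]
  · have h' : ¬ (j : ℕ) = e.2 := fun hh => h (Fin.ext hh.symm)
    simp [h, h']

theorem flowOf_left (M : Finset (Fin s × Fin t)) (i : Fin s) :
    flowOf M (s + t) i = Problem.degA M i := by
  have := i.2
  rw [flowOf, if_neg (lt_irrefl _), if_pos (by omega), sum_pairCount_left]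

theorem flowOf_right (M : Finset (Fin s × Fin t)) (j : Fin t) :
    flowOf M (s + t) (s + j) = -(Problem.degB M j : ℤ) := by
  have := j.2
  rw [flowOf, if_neg (lt_irrefl _), if_pos (by omega), sum_pairCount_right]

theorem degB_le (M : Finset (Fin s × Fin t)) (j : Fin t) : Problem.degB M j ≤ s := by
  have h : (M.filter fun e => e.2 = j) ⊆ univ.image fun i : Fin s => (i, j) := by
    intro e he
    rw [mem_filter] at he
    exact mem_image.2 ⟨e.1, mem_univ _, by rw [← he.2]⟩
  exact (card_le_card h).trans (card_image_le.trans (by simp))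

/-- The words that bound the flow describe the demands and capacities, where a capacity beyond the
number of objects does not matter. -/
theorem isAssignment_iff (hdem : ∀ j, I.demB j ≤ s) (M : Finset (Fin s × Fin t)) :
    I.IsAssignment M ↔ ∀ v < s + t, (lowWord I v : ℤ) ≤ flowOf M (s + t) v + offset s t v ∧
      flowOf M (s + t) v + offset s t v ≤ highWord I v := by
  have hA : ∀ i : Fin s, ((lowWord I i : ℤ) ≤ flowOf M (s + t) i + offset s t i ∧
      flowOf M (s + t) i + offset s t i ≤ highWord I i) ↔
      (I.demA i ≤ Problem.degA M i ∧ Problem.degA M i ≤ I.capA i) := by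
    intro i
    rw [flowOf_left]
    simp [lowWord, highWord, offset, ext0]
  have hB : ∀ j : Fin t, ((lowWord I (s + j) : ℤ) ≤ flowOf M (s + t) (s + j) + offset s t (s + j) ∧
      flowOf M (s + t) (s + j) + offset s t (s + j) ≤ highWord I (s + j)) ↔
      (I.demB j ≤ Problem.degB M j ∧ Problem.degB M j ≤ I.capB j) := by
    intro j
    rw [flowOf_right]
    have := degB_le M j
    have := hdem j
    simp only [lowWord, highWord, offset, ext0, add_tsub_cancel_left, Fin.is_lt, dif_pos, Fin.eta,
      if_neg (show ¬ s + (j : ℕ) < s by omega)]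
    omega
  constructor
  · intro h v hv
    by_cases hvs : v < s
    · exact (hA ⟨v, hvs⟩).2 (h.1 _)
    · have := (hB ⟨v - s, by omega⟩).2 (h.2 _)
      simp only [show s + (v - s) = v by omega] at this
      exact this
  · intro h
    exact ⟨fun i => (hA i).1 (h i (by have := i.2; omega)),
      fun j => (hB j).1 (h (s + j) (by have := j.2; omega))⟩

theorem inBox_flowOf (M : Finset (Fin s × Fin t)) : InBox I (flowOf M) := by
  intro p hp q hq
  rw [flowOf, if_pos hp, if_pos hq, bound, if_pos hp, if_pos hq]
  by_cases h : p < s ∧ s ≤ q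
  · rw [if_pos h, pairCount_eq_zero M (p := q) (by omega)]
    have := pairCount_eq M ⟨p, h.1⟩ ⟨q - s, by omega⟩
    simp only [show s + (q - s) = q by omega] at this
    rw [this]
    split_ifs <;> simp
  · rw [if_neg h, pairCount_eq_zero M h]
    have : 0 ≤ pairCount M q p := sum_nonneg fun e _ => by split_ifs <;> simp
    omega

/-- A generalized assignment gives a circulation within the bounds of the network. -/
theorem flowOf_le_bound (hdem : ∀ j, I.demB j ≤ s) {M : Finset (Fin s × Fin t)}
    (h : I.IsAssignment M) :
    ∀ p < s + t + 1, ∀ q < s + t + 1, flowOf M p q ≤ bound I p q := by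
  rw [isAssignment_iff hdem] at h
  intro p hp q hq
  by_cases hp' : p < s + t
  · by_cases hq' : q < s + t
    · exact inBox_flowOf M p hp' q hq'
    · obtain rfl : q = s + t := by omega
      have := h p hp'
      rw [flowOf_skew M, bound, if_pos hp', if_neg hq']
      omega
  · obtain rfl : p = s + t := by omega
    by_cases hq' : q < s + t
    · have := h q hq'
      rw [bound, if_neg hp', if_pos hq']
      omega
    · obtain rfl : q = s + t := by omega
      rw [(flowOf_skew M).self, bound, if_neg hp', if_neg hp']

variable (s t) in
/-- The pairs of objects that carry a unit of flow. -/
def matchOf (F : ℕ → ℕ → ℤ) : Finset (Fin s × Fin t) :=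
  univ.filter fun e => F e.1 (s + e.2) = 1

theorem flowOf_matchOf {F : ℕ → ℕ → ℤ} (h : InBox I F) (hF : Skew F)
    (h0 : ∀ p < s + t, outflow (s + t + 1) F p = 0) {p q : ℕ} (hp : p < s + t + 1)
    (hq : q < s + t + 1) : flowOf (matchOf s t F) p q = F p q := by
  have key : ∀ p < s, ∀ q, s ≤ q → q < s + t → pairCount (matchOf s t F) p q = F p q := by
    intro p hp q hq hq'
    have := pairCount_eq (matchOf s t F) ⟨p, hp⟩ ⟨q - s, by omega⟩
    simp only [show s + (q - s) = q by omega, matchOf, mem_filter, mem_univ, true_and] at this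
    rw [matchOf, this]
    rcases h.unit hF hp hq hq' with h1 | h1 <;> simp [h1]
  have inner : ∀ p < s + t, ∀ q < s + t,
      pairCount (matchOf s t F) p q - pairCount (matchOf s t F) q p = F p q := by
    intro p hp q hq
    by_cases h1 : p < s
    · by_cases h2 : q < s
      · rw [pairCount_eq_zero _ (by omega), pairCount_eq_zero _ (by omega),
          h.eq_zero hF hp hq (by simp [h1, h2]), sub_zero]
      · rw [key p h1 q (by omega) hq, pairCount_eq_zero _ (by omega), sub_zero]
    · by_cases h2 : q < s
      · rw [key q h2 p (by omega) hp, pairCount_eq_zero _ (by omega), zero_sub, hF p q]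
      · rw [pairCount_eq_zero _ (by omega), pairCount_eq_zero _ (by omega),
          h.eq_zero hF hp hq (by simp [h1, h2]), sub_zero]
  have ground : ∀ p < s + t, ∑ r ∈ range (s + t),
      (pairCount (matchOf s t F) p r - pairCount (matchOf s t F) r p) = F (s + t) p := by
    intro p hp
    rw [ground_eq_sum hF (h0 p hp)]
    exact sum_congr rfl fun r hr => inner p hp r (mem_range.1 hr)
  rw [flowOf]
  split_ifs with h1 h2 h2
  · exact inner p h1 q h2
  · obtain rfl : q = s + t := by omega
    rw [ground p h1, hF p]
  · obtain rfl : p = s + t := by omega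
    exact ground q h2
  · obtain rfl : p = s + t := by omega
    obtain rfl : q = s + t := by omega
    rw [hF.self]

/-- Every pair is counted in both directions. -/
theorem sum_arcCost (M : Finset (Fin s × Fin t)) :
    ∑ p ∈ range (s + t + 1), ∑ q ∈ range (s + t + 1), arcCost I p q * (flowOf M p q : ℝ) =
      2 * I.totalCost M := by
  have h1 : ∀ p ∈ range (s + t + 1), ∀ q ∈ range (s + t + 1),
      arcCost I p q * (flowOf M p q : ℝ) =
        arcCost I p q * (pairCount M p q : ℝ) + arcCost I q p * (pairCount M q p : ℝ) := by
    intro p _ q _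
    by_cases h : p < s + t ∧ q < s + t
    · rw [flowOf, if_pos h.1, if_pos h.2, arcCost_skew I q p]
      push_cast
      ring
    · have e1 : arcCost I p q = 0 := by
        rw [arcCost, if_neg (by omega), if_neg (by omega)]
      rw [arcCost_skew I q p, e1]
      ring
  rw [sum_congr rfl fun p hp => sum_congr rfl (h1 p hp)]
  simp only [sum_add_distrib]
  rw [sum_comm (f := fun p q => arcCost I q p * (pairCount M q p : ℝ)), ← two_mul]
  congr 1
  simp only [pairCount, Int.cast_sum, mul_sum, Problem.totalCost]
  rw [sum_congr rfl fun p _ => sum_comm, sum_comm]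
  refine sum_congr rfl fun e _ => ?_
  have ha := e.1.2
  have hb := e.2.2
  rw [sum_eq_single (e.1 : ℕ), sum_eq_single (s + e.2 : ℕ)]
  · simp [arcCost, cost0]
  · intro q _ hq
    simp [hq]
  · intro hh
    exact absurd (mem_range.2 (by omega)) hh
  · intro p _ hp
    exact sum_eq_zero fun q _ => by simp [hp]
  · intro hh
    exact absurd (mem_range.2 (by omega)) hh

/-- A circulation that respects the demands and capacities, and has no residual arc of negative
reduced length, gives a generalized assignment of minimum cost. -/
theorem isMinCost_matchOf (hdem : ∀ j, I.demB j ≤ s) {F : ℕ → ℕ → ℤ} {π : ℕ → ℝ}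
    (h : InBox I F) (hF : Skew F) (h0 : ∀ p < s + t + 1, outflow (s + t + 1) F p = 0)
    (hred : ∀ p < s + t + 1, ∀ q < s + t + 1, F p q < bound I p q →
      0 ≤ arcCost I p q + π p - π q)
    (hword : ∀ v < s + t, (lowWord I v : ℤ) ≤ F (s + t) v + offset s t v ∧
      F (s + t) v + offset s t v ≤ highWord I v) :
    I.IsMinCostAssignment (matchOf s t F) := by
  have heq : ∀ {p q : ℕ}, p < s + t + 1 → q < s + t + 1 → flowOf (matchOf s t F) p q = F p q :=
    flowOf_matchOf h hF fun p hp => h0 p (by omega)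
  refine ⟨(isAssignment_iff hdem _).2 fun v hv => ?_, fun M' hM' => ?_⟩
  · rw [heq (by omega) (by omega)]
    exact hword v hv
  · have := cost_le_of_reduced hF (flowOf_skew M') (arcCost_skew I) (flowOf_le_bound hdem hM')
      (fun p hp => outflow_flowOf M' hp) h0 hred
    rw [sum_arcCost, ← sum_congr rfl fun p hp => sum_congr rfl fun q hq => by
      rw [← heq (mem_range.1 hp) (mem_range.1 hq)], sum_arcCost] at this
    linarith

end

/-! ### Unpacking the residual arcs at a node

The word arrays are indexed by the nodes: the flow from the ground node (`aFlow`), its bounds (`aLow`,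
`aHigh`), the status (`aStat`) and the predecessor (`aPred`) in a search, and the presence of an arc
from the node `U` (`aArc`). The scalars are the object under repair (`aMain`), the ends of a path
(`aRoot`, `aGoal`) and the nodes `U` and `V` of an arc. The real arrays hold the potentials (`rPot`),
the distances (`rDist`), the packed rows of the matching (`rRow`), the powers of two (`rPow`), the
costs of the arcs from `U` (`rCost`) and the digits that remain to be unpacked (`rRest`). -/

notation "aFlow" => (0 : ℕ)
notation "aLow" => (1 : ℕ)
notation "aHigh" => (2 : ℕ)
notation "aStat" => (3 : ℕ)
notation "aPred" => (4 : ℕ)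
notation "aArc" => (5 : ℕ)
notation "aMain" => (6 : ℕ)
notation "aRoot" => (7 : ℕ)
notation "aGoal" => (8 : ℕ)
notation "aU" => (9 : ℕ)
notation "aV" => (10 : ℕ)
notation "rPot" => (0 : ℕ)
notation "rDist" => (1 : ℕ)
notation "rRow" => (2 : ℕ)
notation "rPow" => (3 : ℕ)
notation "rCost" => (4 : ℕ)
notation "rRest" => (5 : ℕ)

infixr:60 " ;; " => Prog.seq

/-- A scalar variable. -/
abbrev WExp.var (a : ℕ) : WExp := .cell a (.const 0)

/-- The number of objects, which is the index of the ground node. -/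
abbrev WExp.size : WExp := .add .sizeA .sizeB

/-- Assignment to a scalar variable. -/
abbrev Prog.assign (a : ℕ) (e : WExp) : Prog := .setWord a (.const 0) e

/-- Record the arc from node `U` to node `V` as absent. -/
abbrev noArc : Prog := .setWord aArc (.var aV) (.const 0)

/-- Record the arc from node `U` to node `V` as present, with the cost `e`. -/
abbrev newArc (e : RExp) : Prog :=
  .setWord aArc (.var aV) (.const 1) ;; .setReal rCost (.var aV) e

/-- Determine whether the arc from `U` to `V` is residual, where the rest of the packed row of `U`
has no binary digit above position `V`. -/
def expandBody : Prog :=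
  .assign aV (.sub (.var aV) (.const 1)) ;;
  .ite (.wordLE .size (.var aU))
    (.ite (.wordLE (.cell aHigh (.var aV)) (.cell aFlow (.var aV))) noArc (newArc (.const 0)))
    (.ite (.realLE (.cell rPow (.var aV)) (.cell rRest (.const 0)))
      (.setReal rRest (.const 0) (.sub (.cell rRest (.const 0)) (.cell rPow (.var aV))) ;;
        .ite (.wordLE .sizeA (.var aV)) noArc
          (newArc (.sub (.const 0) (.cost (.var aV) (.sub (.var aU) .sizeA)))))
      (.ite (.and (.not (.wordLE .sizeA (.var aU))) (.wordLE .sizeA (.var aV)))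
        (newArc (.cost (.var aU) (.sub (.var aV) .sizeA))) noArc))

/-- The part of `expand` before its loop: the arc from `U` to the ground node. -/
def expandInit : Prog :=
  .assign aV .size ;;
  .setReal rRest (.const 0) (.cell rRow (.var aU)) ;;
  .ite (.wordLE .size (.var aU)) noArc
    (.ite (.wordLE (.cell aFlow (.var aU)) (.cell aLow (.var aU))) noArc (newArc (.const 0)))

/-- Determine the residual arcs that leave the node `U`. -/
def expand : Prog :=
  expandInit ;; .loop (.wordLE (.const 1) (.var aV)) expandBody

section

variable {s t : ℕ} {I : Problem s t}

variable (I) in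
/-- The memory represents the flow `F`: the flow between the ground node and the objects is stored
as words, and for every object the flow to the other objects is the sequence of binary digits of
an integer, which is stored as a real number. -/
structure Rep (σ : State) (F : ℕ → ℕ → ℤ) : Prop where
  flow : ∀ v < s + t, (σ.word aFlow v : ℤ) = F (s + t) v + offset s t v
  low : ∀ v < s + t, σ.word aLow v = lowWord I v
  high : ∀ v < s + t, σ.word aHigh v = highWord I v
  row : ∀ u < s + t, σ.real rRow u = ∑ v ∈ range (s + t), ((F u v).natAbs : ℝ) * 2 ^ v
  pow : ∀ v < s + t, σ.real rPow v = 2 ^ v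
  skew : Skew F
  box : InBox I F

theorem Rep.congr {σ σ' : State} {F : ℕ → ℕ → ℤ} (h : Rep I σ F)
    (h0 : σ'.word aFlow = σ.word aFlow) (h1 : σ'.word aLow = σ.word aLow)
    (h2 : σ'.word aHigh = σ.word aHigh) (h3 : σ'.real rRow = σ.real rRow)
    (h4 : σ'.real rPow = σ.real rPow) : Rep I σ' F :=
  ⟨by rw [h0]; exact h.flow, by rw [h1]; exact h.low, by rw [h2]; exact h.high,
    by rw [h3]; exact h.row, by rw [h4]; exact h.pow, h.skew, h.box⟩

/-- The digits below position `k` sum up to less than `2 ^ k`. -/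
theorem sum_digits_lt (c : ℕ → ℕ) (hc : ∀ v, c v ≤ 1) (k : ℕ) :
    ∑ v ∈ range k, (c v : ℝ) * 2 ^ v < 2 ^ k := by
  induction k with
  | zero => simp
  | succ k ih =>
    rw [sum_range_succ, pow_succ]
    have h1 : (c k : ℝ) ≤ 1 := by exact_mod_cast hc k
    have h2 : (0 : ℝ) < 2 ^ k := by positivity
    nlinarith

variable (I) in
/-- The arrays `aArc` and `rCost` describe the arc from `u` to `v`. -/
def ArcAt (F : ℕ → ℕ → ℤ) (u : ℕ) (σ : State) (v : ℕ) : Prop :=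
  (F u v < bound I u v → σ.word aArc v = 1 ∧ σ.real rCost v = arcCost I u v) ∧
    (¬ F u v < bound I u v → σ.word aArc v = 0)

variable (I) in
/-- The loop invariant of `expand`. -/
def Expanding (F : ℕ → ℕ → ℤ) (u : ℕ) (σ : State) : Prop :=
  σ.word aV 0 ≤ s + t ∧
    (u < s + t → σ.real rRest 0 = ∑ v ∈ range (σ.word aV 0), ((F u v).natAbs : ℝ) * 2 ^ v) ∧
    ∀ v, σ.word aV 0 ≤ v → v ≤ s + t → ArcAt I F u σ v

theorem Expanding.next {F : ℕ → ℕ → ℤ} {u j : ℕ} {σ σ' : State} (h : Expanding I F u σ)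
    (hj : σ.word aV 0 = j + 1) (hj' : σ'.word aV 0 = j)
    (hrest : u < s + t → σ'.real rRest 0 = ∑ v ∈ range j, ((F u v).natAbs : ℝ) * 2 ^ v)
    (hat : ArcAt I F u σ' j)
    (hsame : ∀ v, v ≠ j → σ'.word aArc v = σ.word aArc v ∧ σ'.real rCost v = σ.real rCost v) :
    Expanding I F u σ' := by
  refine ⟨by have := h.1; omega, by rwa [hj'], fun v h1 h2 => ?_⟩
  by_cases hv : v = j
  · rwa [hv]
  · have := h.2.2 v (by omega) h2
    rw [ArcAt] at this ⊢
    rwa [(hsame v hv).1, (hsame v hv).2]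

theorem expand_spec : ∃ K : ℕ, ∀ {s t : ℕ} {I : Problem s t} {σ : State} {F : ℕ → ℕ → ℤ},
    WordsFit I σ → Rep I σ F → σ.word aU 0 ≤ s + t →
    Runs I expand σ (fun σ' => ∀ v ≤ s + t, ArcAt I F (σ.word aU 0) σ' v)
      (K * (s + t + 1)) := by
  refine ⟨expandInit.flatTime +
    ((Test.wordLE (.const 1) (.var aV)).steps + 1 + expandBody.flatTime), ?_⟩
  intro s t I σ F hσ hR hu
  obtain ⟨u, hudef⟩ : ∃ u, σ.word aU 0 = u := ⟨_, rfl⟩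
  rw [hudef] at hu ⊢
  refine Runs.seq (T₁ := expandInit.flatTime) (T₂ := (s + t + 1) *
    ((Test.wordLE (.const 1) (.var aV)).steps + 1 + expandBody.flatTime))
    (R := fun σ' => σ'.word aV 0 = s + t ∧ σ'.real rRest 0 = σ.real rRow u ∧
      ArcAt I F u σ' (s + t)) hσ ?_ ?_ (by nlinarith)
  · refine Runs.flat hσ ?_
    have h1 := hR.flow u
    have h2 := hR.low u
    have h3 := hR.skew u (s + t)
    have h4 : arcCost I u (s + t) = 0 := by
      rw [arcCost, if_neg (by omega), if_neg (by omega)]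
    have h5 : s + t ≤ top I := by simp only [top]; omega
    simp [expandInit, hudef, hu, h5, h4, bound, ArcAt]
    refine ⟨fun hle => ?_, fun hlt => ⟨fun hle => ?_, fun hlt' => ?_⟩⟩
    · obtain rfl : u = s + t := by omega
      simp [hR.skew.self]
    · rw [if_pos hlt]
      have := h1 hlt
      have := h2 hlt
      omega
    · rw [if_pos hlt]
      have := h1 hlt
      have := h2 hlt
      omega
  · rintro σ₁ hF₁ hσ₁ ⟨hV, hrest, hg⟩
    have eR := hR.congr (hF₁.word aFlow (by simp [expandInit])) (hF₁.word aLow (by simp [expandInit]))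
      (hF₁.word aHigh (by simp [expandInit])) (hF₁.real rRow (by simp [expandInit]))
      (hF₁.real rPow (by simp [expandInit]))
    have hU₁ : σ₁.word aU 0 = u := by rw [hF₁.word aU (by simp [expandInit]), hudef]
    rw [← hF₁.real rRow (by simp [expandInit])] at hrest
    clear hF₁ hσ hR hudef
    refine Runs.loop (Inv := Expanding I F u) (μ := fun σ' => σ'.word aV 0) hσ₁ ?_ (by omega) ?_
    · refine ⟨by omega, fun h => ?_, fun v h1 h2 => ?_⟩
      · rw [hrest, eR.row u h, hV]
      · obtain rfl : v = s + t := by omega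
        exact hg
    · rintro σ₂ hF₂ hσ₂ hE
      have eR₂ := eR.congr (hF₂.word aFlow (by simp [expandBody]))
        (hF₂.word aLow (by simp [expandBody])) (hF₂.word aHigh (by simp [expandBody]))
        (hF₂.real rRow (by simp [expandBody])) (hF₂.real rPow (by simp [expandBody]))
      have hU₂ : σ₂.word aU 0 = u := by rw [hF₂.word aU (by simp [expandBody]), hU₁]
      simp only [WExp.wp, Test.wp, Nat.reduceLeDiff, Nat.reduceLT, Nat.zero_le, true_and]
      refine ⟨fun hpos => ?_, fun hneg v hv => hE.2.2 v (by omega) hv⟩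
      refine Runs.flat hσ₂ ?_
      obtain ⟨j, hj⟩ : ∃ j, σ₂.word aV 0 = j + 1 := ⟨σ₂.word aV 0 - 1, by omega⟩
      have hjn := hE.1
      have hdig := hE.2.1
      rw [hj] at hjn hdig
      have h5 : s + t ≤ top I := by simp only [top]; omega
      have hjn' : j ≤ s + t := by omega
      have hflow := eR₂.flow j (by omega)
      have hhigh := eR₂.high j (by omega)
      have hpow := eR₂.pow j (by omega)
      simp only [expandBody, Prog.wp, WExp.wp, Test.wp, RExp.wp, State.setWord_word,
        State.setReal_word, State.setWord_real, hj, hU₂, h5]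
      simp only [Nat.reduceLeDiff, Nat.reduceLT, Nat.zero_le, true_and, and_true, and_self,
        if_true, Nat.add_sub_cancel, Nat.reduceEqDiff, false_and, if_false, hjn']
      refine ⟨fun hun => ⟨fun hle => ?_, fun hlt => ?_⟩, fun hun => ?_⟩
      · refine ⟨hE.next hj (by simp) (fun h => absurd hun (by omega)) ?_ ?_, by simp⟩
        · obtain rfl : u = s + t := by omega
          refine ⟨fun h => ?_, fun _ => by simp⟩
          rw [bound, if_neg (by omega), if_pos (by omega)] at h
          omega
        · intro v hv; simp [hv]
      · refine ⟨hE.next hj (by simp) (fun h => absurd hun (by omega)) ?_ ?_, by simp⟩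
        · obtain rfl : u = s + t := by omega
          refine ⟨fun h => ?_, fun h => ?_⟩
          · rw [arcCost, if_neg (by omega), if_neg (by omega)]
            simp
          · rw [bound, if_neg (by omega), if_pos (by omega)] at h
            omega
        · intro v hv; simp [hv]
      · have hun' : u < s + t := by omega
        have hbd : bound I u j = if u < s ∧ s ≤ j then 1 else 0 := by
          rw [bound, if_pos hun', if_pos (by omega)]
        have hone := eR₂.box.natAbs_le eR₂.skew hun' (q := j) (by omega)
        have hlt := sum_digits_lt (fun v => if v < s + t then (F u v).natAbs else 0) (fun v => by
          split_ifs with h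
          · exact eR₂.box.natAbs_le eR₂.skew hun' h
          · simp) j
        rw [sum_congr rfl fun v hv => by
          rw [if_pos (show v < s + t by have := mem_range.1 hv; omega)]] at hlt
        have hnn : 0 ≤ ∑ v ∈ range j, ((F u v).natAbs : ℝ) * 2 ^ v :=
          sum_nonneg fun v _ => by positivity
        have hd := hdig hun'
        rw [sum_range_succ] at hd
        have hzero := fun h => eR₂.box.eq_zero eR₂.skew hun' (q := j) (by omega) h
        refine ⟨fun hle => ?_, fun hgt => ?_⟩
        · have h1 : (F u j).natAbs = 1 := by
            by_contra hne
            rw [show (F u j).natAbs = 0 by omega] at hd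
            rw [Nat.cast_zero, zero_mul, add_zero] at hd
            rw [hpow, hd] at hle
            linarith
          have hrest' : σ₂.real rRest 0 - σ₂.real rPow j =
              ∑ v ∈ range j, ((F u v).natAbs : ℝ) * 2 ^ v := by
            rw [hd, hpow, h1]
            simp
          refine ⟨fun hsj => ?_, fun hsj => ?_⟩
          · refine ⟨hE.next hj (by simp) (fun _ => by simpa using hrest') ?_ ?_, by simp⟩
            · refine ⟨fun h => ?_, fun _ => by simp⟩
              have := eR₂.box.unit eR₂.skew (p := u) (q := j)
              rw [hbd] at h
              split_ifs at h <;> omega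
            · intro v hv; simp [hv]
          · refine ⟨by omega, by omega, hE.next hj (by simp) (fun _ => by simpa using hrest') ?_ ?_,
              by simp⟩
            · have h2 := eR₂.box.unit eR₂.skew (p := j) (q := u)
              have h3 := eR₂.skew u j
              refine ⟨fun h => ?_, fun h => ?_⟩
              · rw [arcCost, if_neg (by omega), if_pos (by omega)]
                simp
              · rw [hbd, if_neg (by omega)] at h
                omega
            · intro v hv; simp [hv]
        · have h1 : F u j = 0 := by
            by_contra hne
            rw [show (F u j).natAbs = 1 by omega] at hd
            rw [Nat.cast_one, one_mul] at hd
            rw [hpow, hd] at hgt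
            linarith
          have hrest' : σ₂.real rRest 0 = ∑ v ∈ range j, ((F u v).natAbs : ℝ) * 2 ^ v := by
            rw [hd, h1]
            simp
          refine ⟨fun hsu => ⟨fun hsj => ?_, fun hsj => ?_⟩, fun hsu => ?_⟩
          · refine ⟨by omega, by omega, hE.next hj (by simp) (fun _ => by simpa using hrest') ?_ ?_,
              by simp⟩
            · refine ⟨fun h => ?_, fun h => ?_⟩
              · rw [arcCost, if_pos (by omega)]
                simp
              · rw [hbd, if_pos (by omega)] at h
                omega
            · intro v hv; simp [hv]
          · refine ⟨hE.next hj (by simp) (fun _ => by simpa using hrest') ?_ ?_, by simp⟩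
            · refine ⟨fun h => ?_, fun _ => by simp⟩
              rw [hbd, if_neg (by omega)] at h
              omega
            · intro v hv; simp [hv]
          · refine ⟨False.elim, fun _ =>
              ⟨hE.next hj (by simp) (fun _ => by simpa using hrest') ?_ ?_, by simp⟩⟩
            · refine ⟨fun h => ?_, fun _ => by simp⟩
              rw [hbd, if_neg (by omega)] at h
              omega
            · intro v hv; simp [hv]

end

/-! ### Relaxing arcs and selecting a node -/

/-- Advance the node variable `V`. -/
abbrev nextV : Prog := .assign aV (.add (.var aV) (.const 1))

/-- The tentative distance of `V` along the arc from `U`. -/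
abbrev viaU : RExp :=
  .add (.cell rDist (.var aU))
    (.sub (.add (.cell rCost (.var aV)) (.cell rPot (.var aU))) (.cell rPot (.var aV)))

/-- Relax the arc from `U` to `V`. -/
def relaxBody : Prog :=
  .ite (.and (.wordLE (.const 1) (.cell aArc (.var aV)))
      (.wordLE (.cell aStat (.var aV)) (.const 1)))
    (.ite (.and (.wordLE (.const 1) (.cell aStat (.var aV)))
        (.realLE (.cell rDist (.var aV)) viaU)) .skip
      (.setReal rDist (.var aV) viaU ;; .setWord aStat (.var aV) (.const 1) ;;
        .setWord aPred (.var aV) (.var aU))) .skip ;;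
  nextV

/-- Relax all arcs that leave `U`. -/
def relax : Prog :=
  .assign aV (.const 0) ;; .loop (.wordLE (.var aV) .size) relaxBody

/-- Replace `U` by `V` if `V` is labelled and is closer than `U`. -/
def pickBody : Prog :=
  .ite (.and (.wordLE (.const 1) (.cell aStat (.var aV)))
      (.wordLE (.cell aStat (.var aV)) (.const 1)))
    (.ite (.and (.wordLE (.var aU) .size)
        (.realLE (.cell rDist (.var aU)) (.cell rDist (.var aV)))) .skip
      (.assign aU (.var aV))) .skip ;;
  nextV

/-- The initialization of `pick`, where no node is found yet. -/
def pickInit : Prog := .assign aU (.add .size (.const 1)) ;; .assign aV (.const 0)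

/-- Let `U` be a labelled node of minimum distance. -/
def pick : Prog := pickInit ;; .loop (.wordLE (.var aV) .size) pickBody

section

variable {s t : ℕ} {I : Problem s t}

variable (I) in
/-- Residual arcs of the flow `F`. -/
def Residual (F : ℕ → ℕ → ℤ) (p q : ℕ) : Prop := F p q < bound I p q

variable (I) in
/-- Lengths of arcs that are reduced by the potential `π`. -/
def redCost (π : ℕ → ℝ) (p q : ℕ) : ℝ := arcCost I p q + π p - π q

variable (I) in
/-- The outcome `σ'` of relaxing the arc from `u` to `v` in the state `σ`. -/
def RelaxAt (F : ℕ → ℕ → ℤ) (u : ℕ) (σ σ' : State) (v : ℕ) : Prop :=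
  (Improves (Residual I F) (redCost I (σ.real rPot)) (σ.word aStat) (σ.real rDist) u v →
    σ'.word aStat v = 1 ∧ σ'.real rDist v = σ.real rDist u + redCost I (σ.real rPot) u v ∧
      σ'.word aPred v = u) ∧
  (¬ Improves (Residual I F) (redCost I (σ.real rPot)) (σ.word aStat) (σ.real rDist) u v →
    σ'.word aStat v = σ.word aStat v ∧ σ'.real rDist v = σ.real rDist v ∧
      σ'.word aPred v = σ.word aPred v)

variable (I) in
/-- The loop invariant of `relax`. -/
def Relaxing (F : ℕ → ℕ → ℤ) (u : ℕ) (σ σ' : State) : Prop :=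
  σ'.word aV 0 ≤ s + t + 1 ∧ (∀ v < σ'.word aV 0, RelaxAt I F u σ σ' v) ∧
    ∀ v, σ'.word aV 0 ≤ v → σ'.word aStat v = σ.word aStat v ∧
      σ'.real rDist v = σ.real rDist v ∧ σ'.word aPred v = σ.word aPred v

theorem Relaxing.next {F : ℕ → ℕ → ℤ} {u j : ℕ} {σ σ₁ σ₂ : State} (h : Relaxing I F u σ σ₁)
    (hj : σ₁.word aV 0 = j) (hj' : σ₂.word aV 0 = j + 1) (hjn : j ≤ s + t)
    (hat : RelaxAt I F u σ σ₂ j)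
    (hsame : ∀ v, v ≠ j → σ₂.word aStat v = σ₁.word aStat v ∧
      σ₂.real rDist v = σ₁.real rDist v ∧ σ₂.word aPred v = σ₁.word aPred v) :
    Relaxing I F u σ σ₂ := by
  refine ⟨by omega, fun v hv => ?_, fun v hv => ?_⟩
  · by_cases hvj : v = j
    · rwa [hvj]
    · have := h.2.1 v (by omega)
      obtain ⟨a, b, c⟩ := hsame v hvj
      rw [RelaxAt] at this ⊢
      rwa [a, b, c]
  · obtain ⟨a, b, c⟩ := hsame v (by omega)
    rw [a, b, c]
    exact h.2.2 v (by omega)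

theorem relax_spec : ∃ K : ℕ, ∀ {s t : ℕ} {I : Problem s t} {σ : State} {F : ℕ → ℕ → ℤ} {u : ℕ},
    WordsFit I σ → σ.word aU 0 = u → u ≤ s + t → σ.word aStat u = 2 →
    (∀ v ≤ s + t, σ.word aStat v ≤ 2) → (∀ v ≤ s + t, ArcAt I F u σ v) →
    Runs I relax σ (fun σ' => ∀ v ≤ s + t, RelaxAt I F u σ σ' v) (K * (s + t + 1)) := by
  refine ⟨(Prog.assign aV (.const 0)).flatTime +
    2 * ((Test.wordLE (.var aV) .size).steps + 1 + relaxBody.flatTime), ?_⟩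
  intro s t I σ F u hσ hU hu hu2 h2 hA
  refine Runs.seq (T₁ := (Prog.assign aV (.const 0)).flatTime) (T₂ := (s + t + 1 + 1) *
    ((Test.wordLE (.var aV) .size).steps + 1 + relaxBody.flatTime))
    (R := fun σ' => σ'.word aV 0 = 0 ∧ Relaxing I F u σ σ') hσ ?_ ?_ (by nlinarith)
  · refine Runs.flat hσ ?_
    simp [Relaxing]
  · rintro σ₁ hF₁ hσ₁ ⟨hV₁, hR₁⟩
    have eA : ∀ v ≤ s + t, ArcAt I F u σ₁ v := by
      intro v hv
      have := hA v hv
      rw [ArcAt] at this ⊢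
      rwa [hF₁.word aArc (by simp), hF₁.real rCost (by simp)]
    have eU : σ₁.word aU 0 = u := by rw [hF₁.word aU (by simp), hU]
    have eP : σ₁.real rPot = σ.real rPot := hF₁.real rPot (by simp)
    clear hF₁ hA
    refine Runs.loop (Inv := Relaxing I F u σ) (μ := fun σ' => s + t + 1 - σ'.word aV 0) hσ₁ hR₁
      (by omega) ?_
    rintro σ₂ hF₂ hσ₂ hR
    obtain ⟨j, hj⟩ : ∃ j, σ₂.word aV 0 = j := ⟨_, rfl⟩
    have h5 : s + t + 8 ≤ top I := by simp only [top]; omega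
    have h6 : s + t ≤ top I := by omega
    simp only [WExp.wp, Test.wp, Nat.reduceLT, Nat.zero_le, true_and, hj, h6]
    refine ⟨fun hle => ?_, fun hgt v hv => hR.2.1 v (by omega)⟩
    refine Runs.flat hσ₂ ?_
    have eU₂ : σ₂.word aU 0 = u := by rw [hF₂.word aU (by simp [relaxBody]), eU]
    have eP₂ : σ₂.real rPot = σ.real rPot := by rw [hF₂.real rPot (by simp [relaxBody]), eP]
    have eA₂ : ArcAt I F u σ₂ j := by
      have := eA j hle
      rw [ArcAt] at this ⊢
      rwa [hF₂.word aArc (by simp [relaxBody]), hF₂.real rCost (by simp [relaxBody])]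
    have h7 : j + 1 ≤ top I := by omega
    have hsame := hR.2.2 j hj.le
    have hdu : σ₂.real rDist u = σ.real rDist u := by
      by_cases huj : u < j
      · exact ((hR.2.1 u (by omega)).2 fun hi => hi.2.1 hu2).2.1
      · exact (hR.2.2 u (by omega)).2.1
    simp only [relaxBody, Prog.wp, WExp.wp, Test.wp, RExp.wp, State.setWord_word,
        State.setReal_word, hj, eU₂, hle, hu]
    simp only [Nat.reduceLeDiff, Nat.reduceLT, Nat.zero_le, true_and, and_self,
        if_true, Nat.reduceEqDiff, false_and, if_false, hle, h7, eP₂, hdu,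
        false_imp_iff, not_false_eq_true, true_imp_iff]
    have hcost : ∀ _ : Residual I F u j, σ.real rDist u +
        (σ₂.real rCost j + σ.real rPot u - σ.real rPot j) =
        σ.real rDist u + redCost I (σ.real rPot) u j := by
      intro hres
      rw [redCost, (eA₂.1 hres).2]
    have hno : ∀ σ₃ : State, σ₃.word aV 0 = j + 1 → (∀ v, σ₃.word aStat v = σ₂.word aStat v ∧
        σ₃.real rDist v = σ₂.real rDist v ∧ σ₃.word aPred v = σ₂.word aPred v) →
        ¬ Improves (Residual I F) (redCost I (σ.real rPot)) (σ.word aStat) (σ.real rDist) u j →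
        Relaxing I F u σ σ₃ := by
      intro σ₃ h0 h1 hn
      refine hR.next hj h0 hle ⟨fun h => absurd h hn, fun _ => ?_⟩ fun v _ => h1 v
      obtain ⟨a, b, c⟩ := h1 j
      rw [a, b, c]
      exact hsame
    have hyes : ∀ σ₃ : State, σ₃.word aV 0 = j + 1 → (σ₃.word aStat j = 1 ∧
        σ₃.real rDist j = σ.real rDist u + redCost I (σ.real rPot) u j ∧ σ₃.word aPred j = u) →
        (∀ v, v ≠ j → σ₃.word aStat v = σ₂.word aStat v ∧
          σ₃.real rDist v = σ₂.real rDist v ∧ σ₃.word aPred v = σ₂.word aPred v) →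
        Improves (Residual I F) (redCost I (σ.real rPot)) (σ.word aStat) (σ.real rDist) u j →
        Relaxing I F u σ σ₃ := by
      intro σ₃ h0 h1 h2 hy
      exact hR.next hj h0 hle ⟨fun _ => h1, fun h => absurd hy h⟩ h2
    have hdec : s + t + 1 - (j + 1) < s + t + 1 - j := by omega
    have hres : 1 ≤ σ₂.word aArc j → Residual I F u j := by
      intro h
      by_contra hn
      rw [eA₂.2 hn] at h
      omega
    rw [hsame.1, hsame.2.1]
    refine ⟨fun harc => ⟨fun hs => ⟨fun hs1 => ⟨fun hd => ?_, fun hd => ?_⟩, fun hs0 => ?_⟩,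
      fun hs2 => ?_⟩, fun harc => ?_⟩
    · refine ⟨hno _ (by simp) (by simp) fun hi => ?_, hdec⟩
      rw [hcost (hres harc)] at hd
      rcases hi.2.2 with h | h
      · omega
      · exact absurd hd (not_le.2 h)
    · rw [hcost (hres harc)] at hd ⊢
      exact ⟨hyes _ (by simp) (by simp) (fun v hv => by simp [hv])
        ⟨hres harc, by omega, Or.inr (not_le.1 hd)⟩, hdec⟩
    · rw [hcost (hres harc)]
      exact ⟨hyes _ (by simp) (by simp) (fun v hv => by simp [hv])
        ⟨hres harc, by omega, Or.inl (by omega)⟩, hdec⟩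
    · refine ⟨hno _ (by simp) (by simp) fun hi => ?_, hdec⟩
      have := hi.2.1
      have := h2 j hle
      omega
    · refine ⟨hno _ (by simp) (by simp) fun hi => ?_, hdec⟩
      rw [(eA₂.1 hi.1).1] at harc
      omega

theorem pick_spec : ∃ K : ℕ, ∀ {s t : ℕ} {I : Problem s t} {σ : State},
    WordsFit I σ → (∃ v ≤ s + t, σ.word aStat v = 1) →
    Runs I pick σ (fun σ' => σ'.word aU 0 ≤ s + t ∧ σ.word aStat (σ'.word aU 0) = 1 ∧
      ∀ v ≤ s + t, σ.word aStat v = 1 → σ.real rDist (σ'.word aU 0) ≤ σ.real rDist v)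
      (K * (s + t + 1)) := by
  refine ⟨pickInit.flatTime +
    2 * ((Test.wordLE (.var aV) .size).steps + 1 + pickBody.flatTime), ?_⟩
  rintro s t I σ hσ ⟨v₀, hv₀, hv₁⟩
  have h5 : s + t + 8 ≤ top I := by simp only [top]; omega
  have h6 : s + t ≤ top I := by omega
  have h8 : s + t + 1 ≤ top I := by omega
  refine Runs.seq (T₁ := pickInit.flatTime) (T₂ := (s + t + 1 + 1) *
    ((Test.wordLE (.var aV) .size).steps + 1 + pickBody.flatTime))
    (R := fun σ' => σ'.word aV 0 = 0 ∧ σ'.word aU 0 = s + t + 1) hσ ?_ ?_ (by nlinarith)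
  · refine Runs.flat hσ ?_
    simp [pickInit, h6, h8]
  · rintro σ₁ hF₁ hσ₁ ⟨hV₁, hU₁⟩
    have eS : σ₁.word aStat = σ.word aStat := hF₁.word aStat (by simp [pickInit])
    have eD : σ₁.real rDist = σ.real rDist := hF₁.real rDist (by simp [pickInit])
    clear hF₁
    refine Runs.loop (Inv := fun σ' => σ'.word aV 0 ≤ s + t + 1 ∧
      (∀ v < σ'.word aV 0, σ.word aStat v = 1 → σ'.word aU 0 ≤ s + t ∧
        σ.real rDist (σ'.word aU 0) ≤ σ.real rDist v) ∧
      (σ'.word aU 0 ≤ s + t → σ.word aStat (σ'.word aU 0) = 1))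
      (μ := fun σ' => s + t + 1 - σ'.word aV 0) hσ₁
      ⟨by omega, fun v hv => by omega, fun h => by omega⟩ (by omega) ?_
    rintro σ₂ hF₂ hσ₂ ⟨hle, hmin, hlab⟩
    obtain ⟨j, hj⟩ : ∃ j, σ₂.word aV 0 = j := ⟨_, rfl⟩
    obtain ⟨u, hu⟩ : ∃ u, σ₂.word aU 0 = u := ⟨_, rfl⟩
    rw [hj] at hle hmin
    rw [hu] at hmin hlab
    simp only [WExp.wp, Test.wp, Nat.reduceLT, Nat.zero_le, true_and, hj, h6]
    refine ⟨fun hle' => ?_, fun hgt => ?_⟩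
    · refine Runs.flat hσ₂ ?_
      have eS₂ : σ₂.word aStat = σ.word aStat := by rw [hF₂.word aStat (by simp [pickBody]), eS]
      have eD₂ : σ₂.real rDist = σ.real rDist := by rw [hF₂.real rDist (by simp [pickBody]), eD]
      have h7 : j + 1 ≤ top I := by omega
      simp only [pickBody, Prog.wp, WExp.wp, Test.wp, RExp.wp, State.setWord_word,
          hj, hu, hle', eS₂, eD₂, h6]
      simp only [Nat.reduceLeDiff, Nat.reduceLT, Nat.zero_le, true_and, and_true, and_self,
          if_true, Nat.reduceEqDiff, if_false, hle', h7,
          false_imp_iff, not_false_eq_true, true_imp_iff]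
      have hdec : s + t + 1 - (j + 1) < s + t + 1 - j := by omega
      have hskip : σ.word aStat j ≠ 1 → (∀ v < j + 1, σ.word aStat v = 1 →
          u ≤ s + t ∧ σ.real rDist u ≤ σ.real rDist v) := by
        intro hne v hv h
        exact hmin v (by have : v ≠ j := fun e => hne (e ▸ h)
                         omega) h
      refine ⟨fun h1 => ⟨fun h2 => ⟨fun hun => ⟨hun, fun hd => ?_, fun hd => ?_⟩, fun hun => ?_⟩,
        fun h2 => ?_⟩, fun h1 => ?_⟩
      · refine ⟨⟨fun v hv h => ?_, hlab⟩, hdec⟩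
        rcases Nat.lt_succ_iff_lt_or_eq.1 hv with hv | rfl
        · exact hmin v hv h
        · exact ⟨hun, hd⟩
      · refine ⟨⟨fun v hv h => ?_, by omega⟩, hdec⟩
        rcases Nat.lt_succ_iff_lt_or_eq.1 hv with hv | rfl
        · exact (not_le.1 hd).le.trans (hmin v hv h).2
        · exact le_rfl
      · refine ⟨⟨fun v hv h => ?_, by omega⟩, hdec⟩
        rcases Nat.lt_succ_iff_lt_or_eq.1 hv with hv | rfl
        · exact absurd (hmin v hv h).1 hun
        · exact le_rfl
      · exact ⟨⟨hskip (by omega), hlab⟩, hdec⟩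
      · exact ⟨⟨hskip (by omega), hlab⟩, hdec⟩
    · obtain ⟨a, b⟩ := hmin v₀ (by omega) hv₁
      rw [hu]
      exact ⟨a, hlab a, fun v hv h => (hmin v (by omega) h).2⟩

end

/-! ### Dijkstra's algorithm as a program -/

/-- Mark `V` as unseen. -/
def clearBody : Prog := .setWord aStat (.var aV) (.const 0) ;; nextV

/-- Label the root with distance zero. -/
def labelRoot : Prog :=
  .setWord aStat (.var aRoot) (.const 1) ;; .setReal rDist (.var aRoot) (.const 0)

/-- Start a search: only the root is labelled. -/
def searchInit : Prog :=
  .assign aV (.const 0) ;; .loop (.wordLE (.var aV) .size) clearBody ;; labelRoot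

/-- Finish the node `U`. -/
def finishU : Prog := .setWord aStat (.var aU) (.const 2)

/-- Finish a node of minimum distance. -/
def searchBody : Prog := pick ;; finishU ;; expand ;; relax

/-- Dijkstra's algorithm, up to the moment when the goal is finished. -/
def search : Prog :=
  searchInit ;; .loop (.wordLE (.cell aStat (.var aGoal)) (.const 1)) searchBody

section

variable {s t : ℕ} {I : Problem s t}

theorem searchInit_spec : ∃ K : ℕ, ∀ {s t : ℕ} {I : Problem s t} {σ : State} {r : ℕ},
    WordsFit I σ → σ.word aRoot 0 = r → r ≤ s + t →
    Runs I searchInit σ (fun σ' => ∀ v ≤ s + t, σ'.word aStat v = if v = r then 1 else 0)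
      (K * (s + t + 1)) := by
  refine ⟨(Prog.assign aV (.const 0)).flatTime +
    2 * ((Test.wordLE (.var aV) .size).steps + 1 + clearBody.flatTime) + labelRoot.flatTime, ?_⟩
  intro s t I σ r hσ hr hrn
  have h5 : s + t + 8 ≤ top I := by simp only [top]; omega
  have h6 : s + t ≤ top I := by omega
  refine Runs.seq (T₁ := (Prog.assign aV (.const 0)).flatTime)
    (T₂ := (s + t + 1 + 1) * ((Test.wordLE (.var aV) .size).steps + 1 + clearBody.flatTime) +
      labelRoot.flatTime) (R := fun σ' => σ'.word aV 0 = 0) hσ ?_ ?_ (by nlinarith)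
  · refine Runs.flat hσ ?_
    simp
  · rintro σ₁ hF₁ hσ₁ hV₁
    have hr₁ : σ₁.word aRoot 0 = r := by rw [hF₁.word aRoot (by simp), hr]
    refine Runs.seq (R := fun σ' => ∀ v ≤ s + t, σ'.word aStat v = 0) hσ₁
      (Runs.loop (Inv := fun σ' => ∀ v < σ'.word aV 0, σ'.word aStat v = 0)
      (μ := fun σ' => s + t + 1 - σ'.word aV 0) (k := s + t + 1) hσ₁ (by simp [hV₁])
      (by omega) ?_) ?_ le_rfl
    · rintro σ₂ hF₂ hσ₂ hI
      obtain ⟨j, hj⟩ : ∃ j, σ₂.word aV 0 = j := ⟨_, rfl⟩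
      rw [hj] at hI
      simp only [WExp.wp, Test.wp, Nat.reduceLT, Nat.zero_le, true_and, hj, h6]
      refine ⟨fun hle => ?_, fun hgt v hv => hI v (by omega)⟩
      refine Runs.flat hσ₂ ?_
      have h7 : j + 1 ≤ top I := by omega
      simp [clearBody, hj, hle, h7]
      refine ⟨fun v hv hvj => hI v (by omega), by omega⟩
    · rintro σ₂ hF₂ hσ₂ hI
      have hr₂ : σ₂.word aRoot 0 = r := by rw [hF₂.word aRoot (by simp [clearBody]), hr₁]
      refine Runs.flat hσ₂ ?_
      simp [labelRoot, hr₂, hrn]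
      intro v hv
      split_ifs
      · rfl
      · exact hI v hv

variable (I) in
/-- The invariant of `search`, for the flow `F`, from the root `r` to the goal `g`. -/
def Searching (F : ℕ → ℕ → ℤ) (π : ℕ → ℝ) (r g : ℕ) (σ : State) : Prop :=
  (∃ rk k, Search (s + t + 1) r (Residual I F) (redCost I π) (σ.word aStat) (σ.real rDist)
    (σ.word aPred) rk k) ∧
  (σ.word aStat g = 2 → ∀ v < s + t + 1, σ.word aStat v = 2 → σ.real rDist v ≤ σ.real rDist g)

variable (I) in
/-- The flow `F` has to carry one unit from `r` to `g` in order to become a circulation, and there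
is a circulation within the bounds. -/
structure Pending (F : ℕ → ℕ → ℤ) (r g : ℕ) : Prop where
  root_le : r ≤ s + t
  goal_le : g ≤ s + t
  ne : r ≠ g
  skew : Skew F
  out_eq : ∀ p < s + t + 1,
    outflow (s + t + 1) F p = (if p = g then 1 else 0) - (if p = r then 1 else 0)
  feasible : ∃ G : ℕ → ℕ → ℤ, Skew G ∧
    (∀ p < s + t + 1, ∀ q < s + t + 1, G p q ≤ bound I p q) ∧
    ∀ p < s + t + 1, outflow (s + t + 1) G p = 0

variable (I) in
/-- No residual arc has a negative reduced cost. -/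
def Reduced (F : ℕ → ℕ → ℤ) (π : ℕ → ℝ) : Prop :=
  ∀ p < s + t + 1, ∀ q < s + t + 1, Residual I F p q → 0 ≤ redCost I π p q

theorem Searching.exists_labelled {F : ℕ → ℕ → ℤ} {π : ℕ → ℝ} {r g : ℕ} {σ : State}
    (h : Searching I F π r g σ) (hP : Pending I F r g) (hg : σ.word aStat g ≠ 2) :
    ∃ v ≤ s + t, σ.word aStat v = 1 := by
  obtain ⟨⟨rk, k, hS⟩, -⟩ := h
  by_cases hr : σ.word aStat r = 2
  · obtain ⟨G, hG, hGU, hG0⟩ := hP.feasible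
    obtain ⟨p, hp, q, hq, hqS, hres⟩ := exists_residual_of_cut (r := r) (g := g) hP.skew hG hGU hG0
      hP.out_eq (S := (range (s + t + 1)).filter fun v => σ.word aStat v = 2)
      (filter_subset _ _) (mem_filter.2 ⟨mem_range.2 (by have := hP.root_le; omega), hr⟩)
      (fun hm => hg (mem_filter.1 hm).2)
    rw [mem_filter, mem_range] at hp
    have hq2 : σ.word aStat q ≠ 2 := fun e => hqS (mem_filter.2 ⟨mem_range.2 hq, e⟩)
    have h1 := (hS.closed p hp.1 q hq hp.2 hres).1
    have h2 := hS.le_two q hq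
    exact ⟨q, by omega, by omega⟩
  · have h1 := hS.root_ne
    have h2 := hS.le_two r (by have := hP.root_le; omega)
    exact ⟨r, hP.root_le, by omega⟩

theorem searchBody_spec : ∃ K : ℕ, ∀ {s t : ℕ} {I : Problem s t} {σ : State} {F : ℕ → ℕ → ℤ}
    {r g : ℕ}, WordsFit I σ → Rep I σ F → Pending I F r g → Reduced I F (σ.real rPot) →
    Searching I F (σ.real rPot) r g σ → σ.word aStat g ≠ 2 →
    Runs I searchBody σ (fun σ' => Searching I F (σ.real rPot) r g σ' ∧
      ((range (s + t + 1)).filter fun v => σ'.word aStat v ≠ 2).card <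
        ((range (s + t + 1)).filter fun v => σ.word aStat v ≠ 2).card)
      (K * (s + t + 1)) := by
  obtain ⟨K₁, hpick⟩ := pick_spec
  obtain ⟨K₂, hexpand⟩ := expand_spec
  obtain ⟨K₃, hrelax⟩ := relax_spec
  refine ⟨K₁ + finishU.flatTime + K₂ + K₃, ?_⟩
  intro s t I σ F r g hσ hR hP hred hS hg
  obtain ⟨⟨rk, k, hS'⟩, -⟩ := id hS
  refine Runs.seq (T₂ := finishU.flatTime + (K₂ * (s + t + 1) + K₃ * (s + t + 1))) hσ
    (hpick hσ (hS.exists_labelled hP hg)) ?_ (by nlinarith)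
  rintro σ₁ hF₁ hσ₁ ⟨hu, hu1, hmin⟩
  obtain ⟨u, hU⟩ : ∃ u, σ₁.word aU 0 = u := ⟨_, rfl⟩
  rw [hU] at hu hu1 hmin
  have eS₁ : σ₁.word aStat = σ.word aStat := hF₁.word aStat (by simp [pick, pickInit, pickBody])
  refine Runs.seq (R := fun σ' => ∀ v, σ'.word aStat v = if v = u then 2 else σ.word aStat v) hσ₁
    (Runs.flat hσ₁ ?_) ?_ le_rfl
  · simp only [finishU, Prog.wp, WExp.wp, hU, State.setWord_word, eS₁]
    simp [hu]
  intro σ₂ hF₂ hσ₂ hst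
  have hU₂ : σ₂.word aU 0 = u := by rw [hF₂.word aU (by simp [finishU]), hU]
  have hR₂ : Rep I σ₂ F := by
    refine hR.congr ?_ ?_ ?_ ?_ ?_
    · rw [hF₂.word aFlow (by simp [finishU]), hF₁.word aFlow (by simp [pick, pickInit, pickBody])]
    · rw [hF₂.word aLow (by simp [finishU]), hF₁.word aLow (by simp [pick, pickInit, pickBody])]
    · rw [hF₂.word aHigh (by simp [finishU]), hF₁.word aHigh (by simp [pick, pickInit, pickBody])]
    · rw [hF₂.real rRow (by simp [finishU]), hF₁.real rRow (by simp [pick, pickInit, pickBody])]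
    · rw [hF₂.real rPow (by simp [finishU]), hF₁.real rPow (by simp [pick, pickInit, pickBody])]
  refine Runs.seq hσ₂ (hexpand hσ₂ hR₂ (by omega)) ?_ le_rfl
  intro σ₃ hF₃ hσ₃ hA
  rw [hU₂] at hA
  have hU₃ : σ₃.word aU 0 = u := by
    rw [hF₃.word aU (by simp [expand, expandInit, expandBody]), hU₂]
  have eS₃ : σ₃.word aStat = σ₂.word aStat :=
    hF₃.word aStat (by simp [expand, expandInit, expandBody])
  have eD₃ : σ₃.real rDist = σ.real rDist := by
    rw [hF₃.real rDist (by simp [expand, expandInit, expandBody]),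
      hF₂.real rDist (by simp [finishU]), hF₁.real rDist (by simp [pick, pickInit, pickBody])]
  have eP₃ : σ₃.real rPot = σ.real rPot := by
    rw [hF₃.real rPot (by simp [expand, expandInit, expandBody]),
      hF₂.real rPot (by simp [finishU]), hF₁.real rPot (by simp [pick, pickInit, pickBody])]
  have ePr₃ : σ₃.word aPred = σ.word aPred := by
    rw [hF₃.word aPred (by simp [expand, expandInit, expandBody]),
      hF₂.word aPred (by simp [finishU]), hF₁.word aPred (by simp [pick, pickInit, pickBody])]
  refine (hrelax hσ₃ hU₃ hu (by rw [eS₃, hst, if_pos rfl]) (fun v hv => ?_) hA).mono hσ₃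
    (fun σ₄ _ _ hrel => ?_) le_rfl
  · rw [eS₃, hst]
    have := hS'.le_two v (by omega)
    split_ifs <;> omega
  simp only [RelaxAt, eS₃, eD₃, eP₃, ePr₃] at hrel
  obtain ⟨hstep, hlast⟩ := hS'.step (u := u) (st₁ := σ₂.word aStat) (st' := σ₄.word aStat)
    (d' := σ₄.real rDist) (par' := σ₄.word aPred) (by have := hP.root_le; omega) (by omega) hu1
    (fun v hv => hmin v (by omega)) (fun v hv => hred u (by omega) v hv) hst
    (fun v hv => (hrel v (by omega)).1) (fun v hv => (hrel v (by omega)).2)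
  have hgle := hP.goal_le
  refine ⟨⟨⟨_, _, hstep⟩, fun hg2 v hv hv2 => ?_⟩, ?_⟩
  · obtain rfl := ((hlast g (by omega)).2.1 hg2).resolve_left hg
    exact (hlast v hv).1 hv2
  · refine card_lt_card (ssubset_iff_of_subset ?_ |>.2 ⟨u, ?_, ?_⟩)
    · intro v hv
      rw [mem_filter, mem_range] at hv ⊢
      exact ⟨hv.1, fun h2 => hv.2 ((hlast v hv.1).2.2 (Or.inl h2))⟩
    · rw [mem_filter, mem_range]
      omega
    · rw [mem_filter, mem_range, not_and_not_right]
      exact fun h => (hlast u h).2.2 (Or.inr rfl)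

theorem search_spec : ∃ K : ℕ, ∀ {s t : ℕ} {I : Problem s t} {σ : State} {F : ℕ → ℕ → ℤ}
    {r g : ℕ}, WordsFit I σ → Rep I σ F → Pending I F r g → Reduced I F (σ.real rPot) →
    σ.word aRoot 0 = r → σ.word aGoal 0 = g →
    Runs I search σ (fun σ' => Searching I F (σ.real rPot) r g σ' ∧ σ'.word aStat g = 2)
      (K * (s + t + 1) ^ 2) := by
  obtain ⟨K₁, hinit⟩ := searchInit_spec
  obtain ⟨K₂, hbody⟩ := searchBody_spec
  refine ⟨K₁ + 2 * ((Test.wordLE (.cell aStat (.var aGoal)) (.const 1)).steps + 1 + K₂), ?_⟩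
  intro s t I σ F r g hσ hR hP hred hr hg
  have hrn := hP.root_le
  have hgn := hP.goal_le
  refine Runs.seq hσ (hinit hσ hr hP.root_le) (T₂ := (s + t + 1 + 1) *
    ((Test.wordLE (.cell aStat (.var aGoal)) (.const 1)).steps + 1 + K₂ * (s + t + 1))) ?_ ?_
  · intro σ₁ hF₁ hσ₁ hst
    have hR₁ : Rep I σ₁ F := hR.congr (hF₁.word aFlow (by simp [searchInit, clearBody, labelRoot]))
      (hF₁.word aLow (by simp [searchInit, clearBody, labelRoot]))
      (hF₁.word aHigh (by simp [searchInit, clearBody, labelRoot]))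
      (hF₁.real rRow (by simp [searchInit, clearBody, labelRoot]))
      (hF₁.real rPow (by simp [searchInit, clearBody, labelRoot]))
    have hg₁ : σ₁.word aGoal 0 = g := by
      rw [hF₁.word aGoal (by simp [searchInit, clearBody, labelRoot]), hg]
    have eP₁ : σ₁.real rPot = σ.real rPot :=
      hF₁.real rPot (by simp [searchInit, clearBody, labelRoot])
    have hcard : ((range (s + t + 1)).filter fun v => σ₁.word aStat v ≠ 2).card ≤ s + t + 1 :=
      (card_filter_le _ _).trans (by simp)
    refine Runs.loop (Inv := Searching I F (σ.real rPot) r g)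
      (μ := fun σ' => ((range (s + t + 1)).filter fun v => σ'.word aStat v ≠ 2).card) hσ₁ ?_
      hcard ?_
    · refine ⟨⟨fun _ => 0, 0, ?_⟩, ?_⟩
      · have hne : ∀ v < s + t + 1, σ₁.word aStat v ≠ 2 := by
          intro v hv
          rw [hst v (by omega)]
          split_ifs <;> omega
        refine ⟨?_, ?_, ?_, fun v hv h => absurd h (hne v hv),
          fun u hu v _ h => absurd h (hne u hu), fun u hu v _ h => absurd h (hne u hu),
          card_eq_zero.2 (filter_eq_empty_iff.2 fun v hv => hne v (mem_range.1 hv))⟩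
        · rw [hst r hrn, if_pos rfl]
          omega
        · intro v hv
          rw [hst v (by omega)]
          split_ifs <;> omega
        · intro v hv h0 hvr
          rw [hst v (by omega), if_neg hvr] at h0
          exact absurd rfl h0
      · intro h
        rw [hst g hgn] at h
        split_ifs at h
        all_goals omega
    · intro σ₂ hF₂ hσ₂ hS
      have hg₂ : σ₂.word aGoal 0 = g := by
        rw [hF₂.word aGoal (by simp [searchBody, finishU, pick, pickInit, pickBody, expand,
          expandInit, expandBody, relax, relaxBody]), hg₁]
      have eP₂ : σ₂.real rPot = σ.real rPot := by
        rw [hF₂.real rPot (by simp [searchBody, finishU, pick, pickInit, pickBody, expand,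
          expandInit, expandBody, relax, relaxBody]), eP₁]
      have hR₂ : Rep I σ₂ F := by
        refine hR₁.congr (hF₂.word aFlow ?_) (hF₂.word aLow ?_) (hF₂.word aHigh ?_)
          (hF₂.real rRow ?_) (hF₂.real rPow ?_) <;>
        simp [searchBody, finishU, pick, pickInit, pickBody, expand, expandInit, expandBody, relax,
          relaxBody]
      obtain ⟨⟨rk, k, hS'⟩, -⟩ := id hS
      have hle2 := hS'.le_two g (by omega)
      simp only [WExp.wp, Test.wp, Nat.reduceLeDiff, Nat.reduceLT, Nat.zero_le, true_and, hg₂, hgn]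
      refine ⟨fun hle => ?_, fun hgt => ⟨hS, by omega⟩⟩
      rw [← eP₂] at hred hS ⊢
      exact hbody hσ₂ hR₂ hP hred hS (by omega)
  · have : 1 ≤ s + t + 1 := by omega
    generalize s + t + 1 = n at *
    generalize (Test.wordLE (.cell aStat (.var aGoal)) (.const 1)).steps = c
    have e1 : K₁ * n ≤ K₁ * n ^ 2 := Nat.mul_le_mul_left _ (by nlinarith)
    have e2 : (n + 1) * (c + 1 + K₂ * n) ≤ (2 * n) * ((c + 1 + K₂) * n) :=
      Nat.mul_le_mul (by omega) (by nlinarith)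
    nlinarith

end

/-! ### Carrying a unit of flow -/

/-- Update the potential of `V`. -/
def repriceBody : Prog :=
  .ite (.wordLE (.const 2) (.cell aStat (.var aV)))
    (.setReal rPot (.var aV) (.add (.cell rPot (.var aV))
      (.sub (.cell rDist (.var aV)) (.cell rDist (.var aGoal))))) .skip ;;
  nextV

/-- Update the potentials after a search. -/
def reprice : Prog :=
  .assign aV (.const 0) ;; .loop (.wordLE (.var aV) .size) repriceBody

/-- Push a unit of flow from `U` to `V`. -/
def pushUV : Prog :=
  .ite (.wordLE .size (.var aU))
    (.setWord aFlow (.var aV) (.add (.cell aFlow (.var aV)) (.const 1)))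
    (.ite (.wordLE .size (.var aV))
      (.setWord aFlow (.var aU) (.sub (.cell aFlow (.var aU)) (.const 1)))
      (.ite (.wordLE .sizeA (.var aU))
        (.setReal rRow (.var aU) (.sub (.cell rRow (.var aU)) (.cell rPow (.var aV))) ;;
          .setReal rRow (.var aV) (.sub (.cell rRow (.var aV)) (.cell rPow (.var aU))))
        (.setReal rRow (.var aU) (.add (.cell rRow (.var aU)) (.cell rPow (.var aV))) ;;
          .setReal rRow (.var aV) (.add (.cell rRow (.var aV)) (.cell rPow (.var aU))))))

/-- Proceed to the predecessor of `V`. -/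
def augmentBody : Prog :=
  .assign aU (.cell aPred (.var aV)) ;; pushUV ;; .assign aV (.var aU)

/-- Push a unit of flow along the path of predecessors that leads from the root to the goal. -/
def augment : Prog :=
  .assign aV (.var aGoal) ;;
  .loop (.not (.and (.wordLE (.var aV) (.var aRoot)) (.wordLE (.var aRoot) (.var aV)))) augmentBody

/-- Carry a unit of flow from the root to the goal. -/
def carry : Prog := search ;; reprice ;; augment

section

variable {s t : ℕ} {I : Problem s t}

theorem reprice_spec : ∃ K : ℕ, ∀ {s t : ℕ} {I : Problem s t} {σ : State} {g : ℕ},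
    WordsFit I σ → σ.word aGoal 0 = g → g ≤ s + t →
    (∀ v < s + t + 1, σ.word aStat v ≤ 2) →
    Runs I reprice σ (fun σ' => ∀ v < s + t + 1, σ'.real rPot v =
      if σ.word aStat v = 2 then σ.real rPot v + (σ.real rDist v - σ.real rDist g)
      else σ.real rPot v) (K * (s + t + 1)) := by
  refine ⟨(Prog.assign aV (.const 0)).flatTime +
    2 * ((Test.wordLE (.var aV) .size).steps + 1 + repriceBody.flatTime), ?_⟩
  intro s t I σ g hσ hg hgn hle2
  have h5 : s + t + 8 ≤ top I := by simp only [top]; omega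
  have h6 : s + t ≤ top I := by omega
  refine Runs.seq (T₁ := (Prog.assign aV (.const 0)).flatTime) (T₂ := (s + t + 1 + 1) *
    ((Test.wordLE (.var aV) .size).steps + 1 + repriceBody.flatTime))
    (R := fun σ' => σ'.word aV 0 = 0) hσ (Runs.flat hσ (by simp)) ?_ (by nlinarith)
  intro σ₁ hF₁ hσ₁ hV₁
  have hg₁ : σ₁.word aGoal 0 = g := by rw [hF₁.word aGoal (by simp), hg]
  have eS₁ : σ₁.word aStat = σ.word aStat := hF₁.word aStat (by simp)
  have eD₁ : σ₁.real rDist = σ.real rDist := hF₁.real rDist (by simp)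
  have eP₁ : σ₁.real rPot = σ.real rPot := hF₁.real rPot (by simp)
  refine Runs.loop (Inv := fun σ' => (∀ v < σ'.word aV 0, σ'.real rPot v =
      if σ.word aStat v = 2 then σ.real rPot v + (σ.real rDist v - σ.real rDist g)
      else σ.real rPot v) ∧ ∀ v, σ'.word aV 0 ≤ v → σ'.real rPot v = σ.real rPot v)
    (μ := fun σ' => s + t + 1 - σ'.word aV 0) (k := s + t + 1) hσ₁
    ⟨by simp [hV₁], fun v _ => by rw [eP₁]⟩ (by omega) ?_
  rintro σ₂ hF₂ hσ₂ ⟨hI, hI'⟩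
  obtain ⟨j, hj⟩ : ∃ j, σ₂.word aV 0 = j := ⟨_, rfl⟩
  rw [hj] at hI hI'
  have hg₂ : σ₂.word aGoal 0 = g := by rw [hF₂.word aGoal (by simp [repriceBody]), hg₁]
  have eS₂ : σ₂.word aStat = σ.word aStat := by rw [hF₂.word aStat (by simp [repriceBody]), eS₁]
  have eD₂ : σ₂.real rDist = σ.real rDist := by rw [hF₂.real rDist (by simp [repriceBody]), eD₁]
  simp only [WExp.wp, Test.wp, Nat.reduceLT, Nat.zero_le, true_and, hj, h6]
  refine ⟨fun hle => ?_, fun hgt v hv => hI v (by omega)⟩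
  refine Runs.flat hσ₂ ?_
  have h7 : j + 1 ≤ top I := by omega
  simp only [repriceBody, Prog.wp, WExp.wp, Test.wp, RExp.wp, State.setReal_word,
    State.setWord_word, State.setWord_real, State.setReal_real, hj, hle, hg₂, hgn, eS₂, eD₂]
  simp only [Nat.reduceLeDiff, Nat.reduceLT, Nat.zero_le, true_and, and_self, if_true, h7]
  refine ⟨fun h2 => ⟨⟨fun v hv => ?_, fun v hv => ?_⟩, by omega⟩,
    fun h2 => ⟨⟨fun v hv => ?_, fun v hv => ?_⟩, by omega⟩⟩
  · by_cases hvj : v = j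
    · subst hvj
      have := hle2 v (by omega)
      rw [if_pos rfl, if_pos (by omega), hI' v le_rfl]
    · rw [if_neg hvj]
      exact hI v (by omega)
  · rw [if_neg (by omega)]
    exact hI' v (by omega)
  · by_cases hvj : v = j
    · subst hvj
      rw [if_neg (by omega)]
      exact hI' v le_rfl
    · exact hI v (by omega)
  · exact hI' v (by omega)

theorem InBox.natAbs_eq {F : ℕ → ℕ → ℤ} (h : InBox I F) (hF : Skew F) {p q : ℕ}
    (hp : p < s + t) (hq : q < s + t) :
    ((F p q).natAbs : ℝ) = (if p < s then 1 else -1) * F p q := by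
  by_cases h1 : p < s ↔ q < s
  · simp [h.eq_zero hF hp hq h1]
  · by_cases h2 : p < s
    · rcases h.unit hF h2 (by omega) hq with h3 | h3 <;> simp [h3, h2]
    · rcases h.unit hF (p := q) (q := p) (by omega) (by omega) hp with h3 | h3 <;>
        simp [hF p q, h3, h2]

/-- The effect of a push on the packed rows. -/
theorem row_push {F : ℕ → ℕ → ℤ} (h : InBox I F) (hF : Skew F) {u v : ℕ}
    (h' : InBox I (push F u v)) {p : ℕ} (hp : p < s + t) (hu : u < s + t) (hv : v < s + t) :
    ∑ q ∈ range (s + t), ((push F u v p q).natAbs : ℝ) * 2 ^ q =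
      ∑ q ∈ range (s + t), ((F p q).natAbs : ℝ) * 2 ^ q +
        (if p < s then 1 else -1) * ((if p = u then 2 ^ v else 0) - (if p = v then 2 ^ u else 0)) := by
  have e1 : ∀ q ∈ range (s + t), ((push F u v p q).natAbs : ℝ) * 2 ^ q =
      ((F p q).natAbs : ℝ) * 2 ^ q + (if p < s then 1 else -1) *
        ((if q = v then (if p = u then 2 ^ v else 0) else 0) -
          (if q = u then (if p = v then 2 ^ u else 0) else 0)) := by
    intro q hq
    rw [mem_range] at hq
    rw [h'.natAbs_eq (hF.push u v) hp hq, h.natAbs_eq hF hp hq, push]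
    generalize (if p < s then (1 : ℝ) else -1) = c
    push_cast
    have a1 : (if p = u ∧ q = v then (1 : ℝ) else 0) * 2 ^ q =
        if q = v then (if p = u then 2 ^ v else 0) else 0 := by
      by_cases a : p = u <;> by_cases b : q = v <;> simp [a, b]
    have a2 : (if p = v ∧ q = u then (1 : ℝ) else 0) * 2 ^ q =
        if q = u then (if p = v then 2 ^ u else 0) else 0 := by
      by_cases a : p = v <;> by_cases b : q = u <;> simp [a, b]
    rw [← a1, ← a2]
    ring
  rw [sum_congr rfl e1, sum_add_distrib, ← mul_sum, sum_sub_distrib, sum_ite_eq', sum_ite_eq',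
    if_pos (mem_range.2 hv), if_pos (mem_range.2 hu)]

theorem push_outer (F : ℕ → ℕ → ℤ) {u v : ℕ}
    (huv : s + t ≤ u ∨ s + t ≤ v) : ∀ p < s + t, ∀ q < s + t, push F u v p q = F p q := by
  intro p hp q hq
  rw [push, if_neg (by omega), if_neg (by omega)]
  ring

theorem InBox.push_inner {F : ℕ → ℕ → ℤ} (h : InBox I F) {u v : ℕ} (huv : u ≠ v)
    (hres : Residual I F u v) : InBox I (push F u v) := by
  intro p hp q hq
  have h1 := h p hp q hq
  rw [push]
  by_cases h2 : p = u ∧ q = v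
  · obtain ⟨rfl, rfl⟩ := h2
    rw [Residual] at hres
    rw [if_pos ⟨rfl, rfl⟩, if_neg (fun e => huv e.1)]
    omega
  · rw [if_neg h2]
    split_ifs <;> omega

/-- A push from the ground node to `v`. -/
theorem Rep.push_in {σ σ' : State} {F : ℕ → ℕ → ℤ} (h : Rep I σ F) {v : ℕ} (hv : v < s + t)
    (h0 : ∀ w < s + t, σ'.word aFlow w = if w = v then σ.word aFlow v + 1 else σ.word aFlow w)
    (h1 : σ'.word aLow = σ.word aLow) (h2 : σ'.word aHigh = σ.word aHigh)
    (h3 : σ'.real rRow = σ.real rRow) (h4 : σ'.real rPow = σ.real rPow) :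
    Rep I σ' (push F (s + t) v) := by
  have hin := push_outer F (u := s + t) (v := v) (Or.inl le_rfl)
  refine ⟨fun w hw => ?_, by rw [h1]; exact h.low, by rw [h2]; exact h.high, ?_,
    by rw [h4]; exact h.pow, h.skew.push _ _, fun p hp q hq => by
      rw [hin p hp q hq]; exact h.box p hp q hq⟩
  · rw [h0 w hw, push]
    have := h.flow w hw
    have hne : v ≠ s + t := by omega
    by_cases hwv : w = v
    · subst hwv
      simp only [hne.symm, hne, and_self, if_true, if_false]
      push_cast
      omega
    · simp only [hwv, hne.symm, and_false, false_and, if_false]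
      omega
  · intro u hu
    rw [h3, h.row u hu]
    exact sum_congr rfl fun q hq => by rw [hin u hu q (mem_range.1 hq)]

/-- A push from `v` to the ground node. -/
theorem Rep.push_out {σ σ' : State} {F : ℕ → ℕ → ℤ} (h : Rep I σ F) {v : ℕ} (hv : v < s + t)
    (hpos : 1 ≤ σ.word aFlow v)
    (h0 : ∀ w < s + t, σ'.word aFlow w = if w = v then σ.word aFlow v - 1 else σ.word aFlow w)
    (h1 : σ'.word aLow = σ.word aLow) (h2 : σ'.word aHigh = σ.word aHigh)
    (h3 : σ'.real rRow = σ.real rRow) (h4 : σ'.real rPow = σ.real rPow) :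
    Rep I σ' (push F v (s + t)) := by
  have hin := push_outer F (u := v) (v := s + t) (Or.inr le_rfl)
  refine ⟨fun w hw => ?_, by rw [h1]; exact h.low, by rw [h2]; exact h.high, ?_,
    by rw [h4]; exact h.pow, h.skew.push _ _, fun p hp q hq => by
      rw [hin p hp q hq]; exact h.box p hp q hq⟩
  · rw [h0 w hw, push]
    have := h.flow w hw
    have hne : v ≠ s + t := by omega
    by_cases hwv : w = v
    · subst hwv
      simp only [hne.symm, hne, and_self, if_true, if_false]
      push_cast [hpos]
      omega
    · simp only [hwv, hne.symm, and_false, false_and, if_false]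
      omega
  · intro u hu
    rw [h3, h.row u hu]
    exact sum_congr rfl fun q hq => by rw [hin u hu q (mem_range.1 hq)]

/-- A push between two objects. -/
theorem Rep.push_inner {σ σ' : State} {F : ℕ → ℕ → ℤ} (h : Rep I σ F) {u v : ℕ} (hu : u < s + t)
    (hv : v < s + t) (hres : Residual I F u v)
    (h0 : σ'.word aFlow = σ.word aFlow)
    (h1 : σ'.word aLow = σ.word aLow) (h2 : σ'.word aHigh = σ.word aHigh)
    (h3 : ∀ p, σ'.real rRow p = σ.real rRow p +
      (if u < s then 1 else -1) * ((if p = u then σ.real rPow v else 0) +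
        (if p = v then σ.real rPow u else 0)))
    (h4 : σ'.real rPow = σ.real rPow) :
    Rep I σ' (push F u v) := by
  have huv : ¬ (u < s ↔ v < s) := by
    intro hiff
    rw [Residual, h.box.eq_zero h.skew hu hv hiff, bound, if_pos hu, if_pos hv,
      if_neg (by omega)] at hres
    exact lt_irrefl _ hres
  have hne : u ≠ v := fun e => huv (by rw [e])
  have hbox := h.box.push_inner hne hres
  refine ⟨fun w hw => ?_, by rw [h1]; exact h.low, by rw [h2]; exact h.high, ?_,
    by rw [h4]; exact h.pow, h.skew.push _ _, hbox⟩
  · rw [h0, push, if_neg (by omega), if_neg (by omega), h.flow w hw]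
    ring
  · intro p hp
    rw [row_push h.box h.skew hbox hp hu hv, h3, h.row p hp, h.pow u hu, h.pow v hv]
    congr 1
    by_cases hpu : p = u
    · subst hpu
      simp [hne]
    · by_cases hpv : p = v
      · subst hpv
        by_cases hps : p < s
        · have : ¬ u < s := by omega
          simp [hpu, hps, this]
        · have : u < s := by omega
          simp [hpu, hps, this]
      · simp [hpu, hpv]

theorem highWord_le_top (v : ℕ) : highWord I v ≤ top I := by
  rw [highWord, top, Problem.maxCap]
  split_ifs with h
  · rw [ext0]
    split_ifs
    have : I.capA ⟨v, h⟩ ≤ univ.sup I.capA := le_sup (f := I.capA) (mem_univ _)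
    have := le_max_left (univ.sup I.capA) (univ.sup I.capB)
    omega
  · omega

theorem pushUV_spec {σ : State} {F : ℕ → ℕ → ℤ} {u v : ℕ} (hσ : WordsFit I σ) (hR : Rep I σ F)
    (hU : σ.word aU 0 = u) (hV : σ.word aV 0 = v) (hu : u ≤ s + t) (hv : v ≤ s + t)
    (hres : Residual I F u v) :
    Runs I pushUV σ (fun σ' => Rep I σ' (push F u v)) pushUV.flatTime := by
  refine Runs.flat hσ ?_
  have h5 : s + t + 8 ≤ top I := by simp only [top]; omega
  have h6 : s + t ≤ top I := by omega
  simp only [pushUV, Prog.wp, WExp.wp, Test.wp, RExp.wp, State.setReal_real, State.setReal_word,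
    hU, hV, h6, hu, hv]
  simp only [Nat.reduceLeDiff, Nat.reduceLT, Nat.zero_le, true_and, and_true]
  refine ⟨fun h1 => ?_, fun h1 => ⟨fun h2 => ?_, fun h2 => ⟨fun h3 => ?_, fun h3 => ?_⟩⟩⟩
  · obtain rfl : u = s + t := by omega
    have hvn : v < s + t := by
      by_contra hcon
      obtain rfl : v = s + t := by omega
      rw [Residual, hR.skew.self, bound, if_neg h1.not_gt, if_neg h1.not_gt] at hres
      exact lt_irrefl _ hres
    have h7 : σ.word aFlow v + 1 ≤ top I := by
      rw [Residual, bound, if_neg h1.not_gt, if_pos hvn] at hres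
      have := hR.flow v hvn
      have := highWord_le_top (I := I) v
      omega
    exact ⟨h7, hR.push_in hvn (by simp [State.setWord_word]) (by ext; simp) (by ext; simp) rfl rfl⟩
  · obtain rfl : v = s + t := by omega
    have hun : u < s + t := by omega
    refine hR.push_out hun ?_ (by simp [State.setWord_word]) (by ext; simp) (by ext; simp) rfl rfl
    rw [Residual, bound, if_pos hun, if_neg h2.not_gt] at hres
    have := hR.flow u hun
    have := hR.skew u (s + t)
    omega
  · have huv : u ≠ v := by
      rintro rfl
      rw [Residual, hR.skew.self, bound, if_pos (by omega), if_pos (by omega),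
        if_neg (by omega)] at hres
      exact lt_irrefl _ hres
    refine hR.push_inner (by omega) (by omega) hres rfl rfl rfl (fun p => ?_) (by ext; simp)
    have hus : ¬ u < s := by omega
    by_cases hpv : p = v
    · subst hpv
      simp [huv.symm, hus]
      ring
    · by_cases hpu : p = u
      · subst hpu
        simp [huv, hus]
        ring
      · simp [hpu, hpv]
  · have huv : u ≠ v := by
      rintro rfl
      rw [Residual, hR.skew.self, bound, if_pos (by omega), if_pos (by omega),
        if_neg (by omega)] at hres
      exact lt_irrefl _ hres
    refine hR.push_inner (by omega) (by omega) hres rfl rfl rfl (fun p => ?_) (by ext; simp)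
    have hus : u < s := by omega
    by_cases hpv : p = v
    · subst hpv
      simp [huv.symm, hus]
    · by_cases hpu : p = u
      · subst hpu
        simp [huv, hus]
      · simp [hpu, hpv]

variable (I) in
/-- The memory represents a circulation without residual arcs of negative reduced cost. -/
structure Settled (σ : State) (F : ℕ → ℕ → ℤ) : Prop where
  rep : Rep I σ F
  out_eq : ∀ p < s + t + 1, outflow (s + t + 1) F p = 0
  reduced : Reduced I F (σ.real rPot)

theorem augment_spec : ∃ K : ℕ, ∀ {s t : ℕ} {I : Problem s t} {σ : State} {F : ℕ → ℕ → ℤ}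
    {r g : ℕ} {rk : ℕ → ℕ} {k : ℕ} {len : ℕ → ℕ → ℝ}, WordsFit I σ → Rep I σ F →
    Pending I F r g → Reduced I F (σ.real rPot) →
    Search (s + t + 1) r (Residual I F) len (σ.word aStat) (σ.real rDist)
      (σ.word aPred) rk k → σ.word aStat g = 2 →
    (∀ v < s + t + 1, σ.word aStat v = 2 → v ≠ r →
      redCost I (σ.real rPot) (σ.word aPred v) v = 0) →
    σ.word aRoot 0 = r → σ.word aGoal 0 = g →
    Runs I augment σ (fun σ' => ∃ F', Settled I σ' F' ∧
      ∀ p < s + t + 1, ∀ q < s + t + 1, F' p q ≤ max (F p q) (bound I p q))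
      (K * (s + t + 1)) := by
  refine ⟨(Prog.assign aV (.var aGoal)).flatTime +
    2 * ((Test.not (.and (.wordLE (.var aV) (.var aRoot)) (.wordLE (.var aRoot) (.var aV)))).steps +
      1 + ((Prog.assign aU (.cell aPred (.var aV))).flatTime + (pushUV.flatTime +
        (Prog.assign aV (.var aU)).flatTime))), ?_⟩
  intro s t I σ F r g rk k len hσ hR hP hred hS hg2 htight hr hg
  have hgn := hP.goal_le
  have hrn := hP.root_le
  have hk : k ≤ s + t + 1 := by
    rw [← hS.card_eq]
    exact (card_filter_le _ _).trans (by simp)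
  refine Runs.seq (R := fun σ' => σ'.word aV 0 = g) hσ (Runs.flat hσ (by simp [hg]))
    (T₂ := (s + t + 1 + 1) * ((Test.not (.and (.wordLE (.var aV) (.var aRoot))
      (.wordLE (.var aRoot) (.var aV)))).steps +
      1 + ((Prog.assign aU (.cell aPred (.var aV))).flatTime + (pushUV.flatTime +
        (Prog.assign aV (.var aU)).flatTime)))) ?_ (by nlinarith)
  intro σ₁ hF₁ hσ₁ hV₁
  have hR₁ : Rep I σ₁ F := hR.congr (hF₁.word aFlow (by simp)) (hF₁.word aLow (by simp))
    (hF₁.word aHigh (by simp)) (hF₁.real rRow (by simp)) (hF₁.real rPow (by simp))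
  have hr₁ : σ₁.word aRoot 0 = r := by rw [hF₁.word aRoot (by simp), hr]
  have ePr₁ : σ₁.word aPred = σ.word aPred := hF₁.word aPred (by simp)
  have eP₁ : σ₁.real rPot = σ.real rPot := hF₁.real rPot (by simp)
  have hrank := hS.rank_lt g (by omega) hg2
  refine Runs.loop (Inv := fun σ' => σ'.word aV 0 < s + t + 1 ∧ σ.word aStat (σ'.word aV 0) = 2 ∧
      ∃ F', Rep I σ' F' ∧
        Augment (s + t + 1) r (bound I) (arcCost I) (σ.real rPot) rk F F' (σ'.word aV 0))
    (μ := fun σ' => rk (σ'.word aV 0)) (k := s + t + 1) hσ₁ ?_ (by simp only [hV₁]; omega) ?_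
  · rw [hV₁]
    exact ⟨by omega, hg2, F, hR₁, hP.skew, fun p _ q _ => le_max_left _ _, hred, hP.out_eq,
      fun p q _ => rfl⟩
  · rintro σ₂ hF₂ hσ₂ ⟨hvn, hv2, F', hR₂, hA⟩
    obtain ⟨v, hv⟩ : ∃ v, σ₂.word aV 0 = v := ⟨_, rfl⟩
    rw [hv] at hvn hv2 hA
    have hr₂ : σ₂.word aRoot 0 = r := by
      rw [hF₂.word aRoot (by simp [augmentBody, pushUV]), hr₁]
    have ePr₂ : σ₂.word aPred = σ.word aPred := by
      rw [hF₂.word aPred (by simp [augmentBody, pushUV]), ePr₁]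
    have eP₂ : σ₂.real rPot = σ.real rPot := by
      rw [hF₂.real rPot (by simp [augmentBody, pushUV]), eP₁]
    simp only [WExp.wp, Test.wp, Nat.reduceLT, Nat.zero_le, true_and, hv, hr₂,
      not_false_eq_true]
    have hstep : v ≠ r → Runs I augmentBody σ₂ (fun σ' => (σ'.word aV 0 < s + t + 1 ∧
        σ.word aStat (σ'.word aV 0) = 2 ∧ ∃ F', Rep I σ' F' ∧ Augment (s + t + 1) r (bound I)
          (arcCost I) (σ.real rPot) rk F F' (σ'.word aV 0)) ∧ rk (σ'.word aV 0) < rk v)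
        ((Prog.assign aU (.cell aPred (.var aV))).flatTime + (pushUV.flatTime +
          (Prog.assign aV (.var aU)).flatTime)) := by
      intro hvr
      obtain ⟨hu, hu2, hures, -, hrk⟩ := hS.par_spec v hvn (by omega) hvr
      obtain ⟨u, hpu⟩ : ∃ u, σ.word aPred v = u := ⟨_, rfl⟩
      have ht := htight v hvn hv2 hvr
      have hrk := hrk hv2
      rw [hpu] at hu hu2 hures hrk ht
      obtain ⟨hA', hres'⟩ := hA.step hu hvn (arcCost_skew I) hrk hures ht
      refine Runs.seq (R := fun σ' => σ'.word aU 0 = u) hσ₂ (Runs.flat hσ₂ ?_) ?_ le_rfl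
      · simp [hv, ePr₂, hpu]
        omega
      intro σ₃ hF₃ hσ₃ hU₃
      have hV₃ : σ₃.word aV 0 = v := by rw [hF₃.word aV (by simp), hv]
      have hR₃ : Rep I σ₃ F' := hR₂.congr (hF₃.word aFlow (by simp)) (hF₃.word aLow (by simp))
        (hF₃.word aHigh (by simp)) (hF₃.real rRow (by simp)) (hF₃.real rPow (by simp))
      refine Runs.seq hσ₃ (pushUV_spec hσ₃ hR₃ hU₃ hV₃ (by omega) (by omega) hres') ?_ le_rfl
      intro σ₄ hF₄ hσ₄ hR₄
      have hU₄ : σ₄.word aU 0 = u := by rw [hF₄.word aU (by simp [pushUV]), hU₃]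
      refine Runs.flat hσ₄ ?_
      simp only [Prog.wp, WExp.wp, hU₄, State.setWord_word, Nat.zero_le, Nat.reduceLT,
        true_and, and_self, if_true]
      exact ⟨⟨hu, hu2, _, hR₄.congr (by ext; simp) (by ext; simp) (by ext; simp) rfl rfl, hA'⟩, hrk⟩
    refine ⟨fun h1 => ⟨fun h2 => hstep (by omega), fun h2 => ?_⟩,
      fun h1 => ⟨fun _ => hstep (by omega), fun h2 => absurd trivial h2⟩⟩
    obtain rfl : v = r := by omega
    refine ⟨F', ⟨hR₂, fun p hp => ?_, ?_⟩, hA.le_max⟩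
    · rw [hA.out_eq p hp]
      ring
    · rw [eP₂]
      exact hA.reduced

theorem carry_spec : ∃ K : ℕ, ∀ {s t : ℕ} {I : Problem s t} {σ : State} {F : ℕ → ℕ → ℤ}
    {r g : ℕ}, WordsFit I σ → Rep I σ F → Pending I F r g → Reduced I F (σ.real rPot) →
    σ.word aRoot 0 = r → σ.word aGoal 0 = g →
    Runs I carry σ (fun σ' => ∃ F', Settled I σ' F' ∧
      ∀ p < s + t + 1, ∀ q < s + t + 1, F' p q ≤ max (F p q) (bound I p q))
      (K * (s + t + 1) ^ 2) := by
  obtain ⟨K₁, hsearch⟩ := search_spec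
  obtain ⟨K₂, hreprice⟩ := reprice_spec
  obtain ⟨K₃, haugment⟩ := augment_spec
  refine ⟨K₁ + K₂ + K₃, ?_⟩
  intro s t I σ F r g hσ hR hP hred hr hg
  have hgn := hP.goal_le
  have hrn := hP.root_le
  refine Runs.seq (T₂ := K₂ * (s + t + 1) + K₃ * (s + t + 1)) hσ
    (hsearch hσ hR hP hred hr hg) ?_ ?_
  · rintro σ₁ hF₁ hσ₁ ⟨⟨⟨rk, k, hS⟩, hlast⟩, hg2⟩
    have fr : ∀ a, a = aFlow ∨ a = aLow ∨ a = aHigh ∨ a = aRoot ∨ a = aGoal →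
        σ₁.word a = σ.word a := by
      intro a ha
      refine hF₁.word a ?_
      rcases ha with rfl | rfl | rfl | rfl | rfl <;>
      simp [search, searchInit, clearBody, labelRoot, searchBody, finishU, pick, pickInit, pickBody,
        expand, expandInit, expandBody, relax, relaxBody]
    have fr' : ∀ a, a = rPot ∨ a = rRow ∨ a = rPow → σ₁.real a = σ.real a := by
      intro a ha
      refine hF₁.real a ?_
      rcases ha with rfl | rfl | rfl <;>
      simp [search, searchInit, clearBody, labelRoot, searchBody, finishU, pick, pickInit, pickBody,
        expand, expandInit, expandBody, relax, relaxBody]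
    have hR₁ : Rep I σ₁ F := hR.congr (fr _ (by simp)) (fr _ (by simp)) (fr _ (by simp))
      (fr' _ (by simp)) (fr' _ (by simp))
    have hg₁ : σ₁.word aGoal 0 = g := by rw [fr aGoal (by simp), hg]
    have hr₁ : σ₁.word aRoot 0 = r := by rw [fr aRoot (by simp), hr]
    refine Runs.seq hσ₁ (hreprice hσ₁ hg₁ hgn hS.le_two) ?_ le_rfl
    intro σ₂ hF₂ hσ₂ hpot
    have eS₂ : σ₂.word aStat = σ₁.word aStat := hF₂.word aStat (by simp [reprice, repriceBody])
    have eD₂ : σ₂.real rDist = σ₁.real rDist := hF₂.real rDist (by simp [reprice, repriceBody])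
    have ePr₂ : σ₂.word aPred = σ₁.word aPred := hF₂.word aPred (by simp [reprice, repriceBody])
    have hR₂ : Rep I σ₂ F := hR₁.congr (hF₂.word aFlow (by simp [reprice, repriceBody]))
      (hF₂.word aLow (by simp [reprice, repriceBody]))
      (hF₂.word aHigh (by simp [reprice, repriceBody]))
      (hF₂.real rRow (by simp [reprice, repriceBody]))
      (hF₂.real rPow (by simp [reprice, repriceBody]))
    rw [fr' rPot (by simp)] at hpot
    obtain ⟨hred', htight⟩ := Search.reduced (w := arcCost I) (π := σ.real rPot)
      (π' := σ₂.real rPot) hS (by omega) hg2 (hlast hg2) hred hpot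
    rw [← eS₂, ← eD₂, ← ePr₂] at hS
    rw [← eS₂, ← ePr₂] at htight
    exact haugment hσ₂ hR₂ hP hred' hS (by rw [eS₂, hg2]) htight
      (by rw [hF₂.word aRoot (by simp [reprice, repriceBody]), hr₁])
      (by rw [hF₂.word aGoal (by simp [reprice, repriceBody]), hg₁])
  · have : 1 ≤ s + t + 1 := by omega
    generalize s + t + 1 = n at *
    have : n ≤ n ^ 2 := by nlinarith
    nlinarith [Nat.mul_le_mul_left K₂ this, Nat.mul_le_mul_left K₃ this]

end

/-! ### Repairing violated demands and capacities -/

/-- Raise the flow of an object and carry the surplus back to the ground node. -/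
def raise : Prog :=
  .setWord aFlow (.var aMain) (.add (.cell aFlow (.var aMain)) (.const 1)) ;;
    .assign aRoot (.var aMain) ;; .assign aGoal .size

/-- Lower the flow of an object and let the ground node make up for the deficit. -/
def lower : Prog :=
  .setWord aFlow (.var aMain) (.sub (.cell aFlow (.var aMain)) (.const 1)) ;;
    .assign aRoot .size ;; .assign aGoal (.var aMain)

/-- Reduce the violation of the bounds at the current object, or proceed to the next object. -/
def repairBody : Prog :=
  .ite (.not (.wordLE (.cell aLow (.var aMain)) (.cell aFlow (.var aMain)))) (raise ;; carry)
    (.ite (.not (.wordLE (.cell aFlow (.var aMain)) (.cell aHigh (.var aMain)))) (lower ;; carry)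
      (.assign aMain (.add (.var aMain) (.const 1))))

/-- Repair all violations of the bounds. -/
def repair : Prog :=
  .assign aMain (.const 0) ;; .loop (.not (.wordLE .size (.var aMain))) repairBody

section

variable {s t : ℕ} {I : Problem s t}

variable (I) in
/-- The total violation of the demands and capacities. -/
def violation (F : ℕ → ℕ → ℤ) : ℕ :=
  ∑ w ∈ range (s + t), ((F w (s + t) - bound I w (s + t)).toNat +
    (F (s + t) w - bound I (s + t) w).toNat)

variable (I) in
/-- The demands of the objects of `B` can be met individually, and there is a generalized
assignment. -/
structure Feasible : Prop where
  demB_le : ∀ j, I.demB j ≤ s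
  exists_assignment : ∃ M, I.IsAssignment M

theorem Feasible.circulation (h : Feasible I) : ∃ G : ℕ → ℕ → ℤ, Skew G ∧
    (∀ p < s + t + 1, ∀ q < s + t + 1, G p q ≤ bound I p q) ∧
    ∀ p < s + t + 1, outflow (s + t + 1) G p = 0 := by
  obtain ⟨M, hM⟩ := h.exists_assignment
  exact ⟨flowOf M, flowOf_skew M, flowOf_le_bound h.demB_le hM, fun p hp => outflow_flowOf M hp⟩

theorem Feasible.low_le (h : Feasible I) {v : ℕ} (hv : v < s + t) :
    lowWord I v ≤ highWord I v ∧ lowWord I v ≤ s + t := by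
  obtain ⟨M, hM⟩ := h.exists_assignment
  have h1 := (isAssignment_iff h.demB_le M).1 hM v hv
  have h2 := ground_bounds (inBox_flowOf (I := I) M) (flowOf_skew M) hv
    (outflow_flowOf M (by omega))
  omega

theorem violation_mono {F F' : ℕ → ℕ → ℤ}
    (h : ∀ p < s + t + 1, ∀ q < s + t + 1, F' p q ≤ max (F p q) (bound I p q)) :
    violation I F' ≤ violation I F := by
  refine sum_le_sum fun w hw => ?_
  rw [mem_range] at hw
  have h1 := h w (by omega) (s + t) (by omega)
  have h2 := h (s + t) (by omega) w (by omega)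
  omega

/-- Undoing a unit of flow in a direction in which the bound is violated: the violation decreases,
no new residual arc arises, and the unit has to be carried along another path. -/
theorem undo_violation (hf : Feasible I) {F : ℕ → ℕ → ℤ} {π : ℕ → ℝ} {v p q : ℕ} (hF : Skew F)
    (h0 : ∀ p < s + t + 1, outflow (s + t + 1) F p = 0) (hred : Reduced I F π)
    (hv : v < s + t) (hpq : (p = v ∧ q = s + t) ∨ (p = s + t ∧ q = v))
    (hviol : bound I p q < F p q) :
    Pending I (push F q p) p q ∧ Reduced I (push F q p) π ∧
      violation I (push F q p) < violation I F := by
  have hlow := (hf.low_le hv).1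
  have hb : -bound I p q ≤ bound I q p := by
    rcases hpq with ⟨rfl, rfl⟩ | ⟨rfl, rfl⟩
    · rw [bound, if_pos hv, if_neg (lt_irrefl _), bound, if_neg (lt_irrefl _), if_pos hv]
      omega
    · rw [bound, if_neg (lt_irrefl _), if_pos hv, bound, if_pos hv, if_neg (lt_irrefl _)]
      omega
  have hne : p ≠ q := by omega
  have hp : p < s + t + 1 := by omega
  have hq : q < s + t + 1 := by omega
  have hskew := hF p q
  refine ⟨⟨by omega, by omega, hne, hF.push _ _, fun x hx => ?_, hf.circulation⟩, ?_, ?_⟩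
  · rw [outflow_push F hq hp, h0 x hx]
    ring
  · intro x hx y hy hres
    refine hred x hx y hy ?_
    rw [Residual, push] at hres
    rw [Residual]
    by_cases h1 : x = p ∧ y = q
    · obtain ⟨rfl, rfl⟩ := h1
      rw [if_neg (fun e => hne e.1), if_pos ⟨rfl, rfl⟩] at hres
      omega
    · rw [if_neg h1] at hres
      split_ifs at hres <;> omega
  · have e1 : push F q p p q = F p q - 1 := by
      rw [push, if_neg (fun e => hne e.1), if_pos ⟨rfl, rfl⟩]
      ring
    have e2 : push F q p q p = F q p + 1 := by
      rw [push, if_pos ⟨rfl, rfl⟩, if_neg (fun e => hne e.2)]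
      ring
    have e3 : ∀ w < s + t, w ≠ v → push F q p w (s + t) = F w (s + t) ∧
        push F q p (s + t) w = F (s + t) w := by
      intro w hw hwv
      simp only [push]
      constructor
      · rw [if_neg (by omega), if_neg (by omega)]
        ring
      · rw [if_neg (by omega), if_neg (by omega)]
        ring
    have main : (push F q p v (s + t) - bound I v (s + t)).toNat +
        (push F q p (s + t) v - bound I (s + t) v).toNat <
        (F v (s + t) - bound I v (s + t)).toNat + (F (s + t) v - bound I (s + t) v).toNat := by
      rcases hpq with ⟨rfl, rfl⟩ | ⟨rfl, rfl⟩ <;> omega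
    refine sum_lt_sum (fun w hw => ?_) ⟨v, mem_range.2 hv, main⟩
    by_cases hwv : w = v
    · rw [hwv]
      exact main.le
    · obtain ⟨a, b⟩ := e3 w (mem_range.1 hw) hwv
      rw [a, b]

variable (s t) in
/-- The total violation of the demands and capacities, as far as it can be read off the memory. -/
def wordViolation (σ : State) : ℕ :=
  ∑ w ∈ range (s + t), ((σ.word aLow w - σ.word aFlow w) + (σ.word aFlow w - σ.word aHigh w))

theorem Rep.violation_eq {σ : State} {F : ℕ → ℕ → ℤ} (h : Rep I σ F) :
    wordViolation s t σ = violation I F := by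
  refine sum_congr rfl fun w hw => ?_
  rw [mem_range] at hw
  have h1 := h.flow w hw
  have h2 := h.low w hw
  have h3 := h.high w hw
  have h4 := h.skew w (s + t)
  have e1 : bound I w (s + t) = (offset s t w : ℤ) - lowWord I w := by
    rw [bound, if_pos hw, if_neg (lt_irrefl _)]
  have e2 : bound I (s + t) w = (highWord I w : ℤ) - offset s t w := by
    rw [bound, if_neg (lt_irrefl _), if_pos hw]
  omega

theorem violation_le (hf : Feasible I) {σ : State} {F : ℕ → ℕ → ℤ} (h : Settled I σ F) :
    violation I F ≤ 2 * (s + t) * (s + t) := by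
  have : ∀ w ∈ range (s + t), (F w (s + t) - bound I w (s + t)).toNat +
    (F (s + t) w - bound I (s + t) w).toNat ≤ 2 * (s + t) := by
    intro w hw
    rw [mem_range] at hw
    have h1 := ground_bounds h.rep.box h.rep.skew hw (h.out_eq w (by omega))
    have h2 := (hf.low_le hw).2
    have h4 := h.rep.skew w (s + t)
    have e1 : bound I w (s + t) = (offset s t w : ℤ) - lowWord I w := by
      rw [bound, if_pos hw, if_neg (lt_irrefl _)]
    have e2 : bound I (s + t) w = (highWord I w : ℤ) - offset s t w := by
      rw [bound, if_neg (lt_irrefl _), if_pos hw]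
    omega
  refine (sum_le_sum this).trans ?_
  rw [sum_const, card_range, smul_eq_mul]
  exact le_of_eq (by ring)

theorem carry_frame {σ σ' : State} (h : Frame carry σ σ') : σ'.word aMain = σ.word aMain :=
  h.word _ (by simp [carry, search, searchInit, clearBody, labelRoot, searchBody, finishU, pick,
    pickInit, pickBody, expand, expandInit, expandBody, relax, relaxBody, reprice, repriceBody,
    augment, augmentBody, pushUV])

variable (I) in
/-- The loop invariant of `repair`: the objects before the current one respect the bounds. -/
def Repairing (σ : State) : Prop :=
  σ.word aMain 0 ≤ s + t ∧ ∃ F, Settled I σ F ∧ ∀ w < σ.word aMain 0,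
    F w (s + t) ≤ bound I w (s + t) ∧ F (s + t) w ≤ bound I (s + t) w

/-- Carrying the unit that was undone at the current object preserves the invariant of `repair` and
reduces the violation. -/
theorem carry_repairs : ∃ K : ℕ, ∀ {s t : ℕ} {I : Problem s t} {σ : State} {F : ℕ → ℕ → ℤ}
    {v p q : ℕ}, Feasible I → WordsFit I σ → Skew F →
    (∀ p < s + t + 1, outflow (s + t + 1) F p = 0) → Reduced I F (σ.real rPot) →
    (∀ w < v, F w (s + t) ≤ bound I w (s + t) ∧ F (s + t) w ≤ bound I (s + t) w) →
    v < s + t → (p = v ∧ q = s + t) ∨ (p = s + t ∧ q = v) → bound I p q < F p q →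
    Rep I σ (push F q p) → σ.word aMain 0 = v → σ.word aRoot 0 = p → σ.word aGoal 0 = q →
    Runs I carry σ (fun σ' => Repairing I σ' ∧ σ'.word aMain 0 = v ∧
      wordViolation s t σ' < violation I F) (K * (s + t + 1) ^ 2) := by
  obtain ⟨K, hcarry⟩ := carry_spec
  refine ⟨K, ?_⟩
  intro s t I σ F v p q hf hσ hF h0 hred hdone hv hpq hviol hR hM hr hg
  obtain ⟨h1, h2, h3⟩ := undo_violation hf hF h0 hred hv hpq hviol
  refine (hcarry hσ hR h1 h2 hr hg).mono hσ ?_ le_rfl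
  rintro σ' hF' hσ' ⟨F', hS, hle⟩
  have hM' : σ'.word aMain 0 = v := by rw [carry_frame hF', hM]
  refine ⟨⟨by omega, F', hS, fun w hw => ?_⟩, hM', ?_⟩
  · rw [hM'] at hw
    have a := hle w (by omega) (s + t) (by omega)
    have b := hle (s + t) (by omega) w (by omega)
    rw [push, if_neg (by omega), if_neg (by omega)] at a b
    have := hdone w hw
    omega
  · rw [hS.rep.violation_eq]
    exact (violation_mono hle).trans_lt h3

theorem repairBody_spec : ∃ K : ℕ, ∀ {s t : ℕ} {I : Problem s t} {σ : State}, Feasible I →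
    WordsFit I σ → Repairing I σ → σ.word aMain 0 < s + t →
    Runs I repairBody σ (fun σ' => Repairing I σ' ∧
      s + t - σ'.word aMain 0 + wordViolation s t σ' < s + t - σ.word aMain 0 + wordViolation s t σ)
      (K * (s + t + 1) ^ 2) := by
  obtain ⟨K, hcarry⟩ := carry_repairs
  refine ⟨(Test.not (.wordLE (.cell aLow (.var aMain)) (.cell aFlow (.var aMain)))).steps + 1 +
    ((Test.not (.wordLE (.cell aFlow (.var aMain)) (.cell aHigh (.var aMain)))).steps + 1 +
      (raise.flatTime + lower.flatTime +
        (Prog.assign aMain (.add (.var aMain) (.const 1))).flatTime + K)), ?_⟩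
  rintro s t I σ hf hσ ⟨-, F, hS, hdone⟩ hlt
  obtain ⟨v, hv⟩ : ∃ v, σ.word aMain 0 = v := ⟨_, rfl⟩
  rw [hv] at hdone hlt ⊢
  have h5 : s + t + 8 ≤ top I := by simp only [top]; omega
  have h6 : s + t ≤ top I := by omega
  have hvn : v ≤ s + t := by omega
  have hsq : 1 ≤ (s + t + 1) ^ 2 := Nat.one_le_pow _ _ (by omega)
  have hfl := hS.rep.flow v hlt
  have hlo := hS.rep.low v hlt
  have hhi := hS.rep.high v hlt
  have hsk := hS.rep.skew v (s + t)
  have e1 : bound I v (s + t) = (offset s t v : ℤ) - lowWord I v := by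
    rw [bound, if_pos hlt, if_neg (lt_irrefl _)]
  have e2 : bound I (s + t) v = (highWord I v : ℤ) - offset s t v := by
    rw [bound, if_neg (lt_irrefl _), if_pos hlt]
  rw [hS.rep.violation_eq]
  generalize hN : (s + t + 1) ^ 2 = N at *
  refine (Runs.ite (T := (Test.not (.wordLE (.cell aFlow (.var aMain))
    (.cell aHigh (.var aMain)))).steps + 1 + (raise.flatTime + lower.flatTime +
        (Prog.assign aMain (.add (.var aMain) (.const 1))).flatTime + K * N)) hσ ?_).mono hσ
    (fun _ _ _ h => h) (by nlinarith)
  simp only [Test.wp, WExp.wp, hv, hvn, Nat.reduceLT, Nat.zero_le, true_and]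
  refine ⟨fun h1 => ?_, fun h1 => ?_⟩
  · have hadd : σ.word aFlow v + 1 ≤ top I := by
      have := hf.low_le hlt
      omega
    refine Runs.seq (T₁ := raise.flatTime) (T₂ := K * N) hσ (R := fun σ' =>
      Rep I σ' (push F (s + t) v) ∧ σ'.word aMain 0 = v ∧ σ'.word aRoot 0 = v ∧
        σ'.word aGoal 0 = s + t) (Runs.flat hσ ?_) ?_ (by omega)
    · simp [raise, hv, hvn, hadd, h6]
      exact hS.rep.push_in hlt (by simp) (by ext; simp) (by ext; simp) rfl rfl
    · rintro σ₁ hF₁ hσ₁ ⟨hR₁, a, b, c⟩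
      refine (hcarry hf hσ₁ hS.rep.skew hS.out_eq ?_ hdone hlt
        (Or.inl ⟨rfl, rfl⟩) (by omega) hR₁ a b c).mono hσ₁ ?_ (by rw [hN])
      · rw [hF₁.real rPot (by simp [raise])]
        exact hS.reduced
      · rintro σ₂ - - ⟨x, y, z⟩
        exact ⟨x, by omega⟩
  · refine (Runs.ite (T := raise.flatTime + lower.flatTime +
        (Prog.assign aMain (.add (.var aMain) (.const 1))).flatTime + K * N) hσ ?_)
    simp only [Test.wp, WExp.wp, hv, hvn, Nat.reduceLT, Nat.zero_le, true_and]
    refine ⟨fun h2 => ?_, fun h2 => ?_⟩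
    · refine Runs.seq (T₁ := lower.flatTime) (T₂ := K * N) hσ (R := fun σ' =>
        Rep I σ' (push F v (s + t)) ∧ σ'.word aMain 0 = v ∧ σ'.word aRoot 0 = s + t ∧
          σ'.word aGoal 0 = v) (Runs.flat hσ ?_) ?_ (by omega)
      · simp [lower, hv, hvn, h6]
        exact hS.rep.push_out hlt (by omega) (by simp) (by ext; simp) (by ext; simp) rfl rfl
      · rintro σ₁ hF₁ hσ₁ ⟨hR₁, a, b, c⟩
        refine (hcarry hf hσ₁ hS.rep.skew hS.out_eq ?_ hdone hlt
          (Or.inr ⟨rfl, rfl⟩) (by omega) hR₁ a b c).mono hσ₁ ?_ (by rw [hN])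
        · rw [hF₁.real rPot (by simp [lower])]
          exact hS.reduced
        · rintro σ₂ - - ⟨x, y, z⟩
          exact ⟨x, by omega⟩
    · refine (Runs.flat (p := .assign aMain (.add (.var aMain) (.const 1))) hσ ?_).mono hσ
        (fun _ _ _ h => h) (by omega)
      have hadd : v + 1 ≤ top I := by omega
      have hstep : Settled I (σ.setWord aMain 0 (v + 1)) F :=
        ⟨hS.rep.congr (by ext; simp) (by ext; simp) (by ext; simp) rfl rfl, hS.out_eq, hS.reduced⟩
      simp only [Prog.wp, WExp.wp, hv, Nat.reduceLeDiff, Nat.reduceLT, Nat.zero_le, true_and, hadd]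
      refine ⟨⟨by simp; omega, F, hstep, fun w hw => ?_⟩, ?_⟩
      · simp only [State.setWord_word, and_self, if_true] at hw
        rcases Nat.lt_succ_iff_lt_or_eq.1 hw with hw | rfl
        · exact hdone w hw
        · omega
      · rw [hstep.rep.violation_eq]
        simp only [State.setWord_word, and_self, if_true]
        omega

theorem repair_spec : ∃ K : ℕ, ∀ {s t : ℕ} {I : Problem s t} {σ : State} {F : ℕ → ℕ → ℤ},
    Feasible I → WordsFit I σ → Settled I σ F →
    Runs I repair σ (fun σ' => ∃ F', Settled I σ' F' ∧ I.IsMinCostAssignment (matchOf s t F'))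
      (K * (s + t + 1) ^ 4) := by
  obtain ⟨K, hbody⟩ := repairBody_spec
  refine ⟨(Prog.assign aMain (.const 0)).flatTime +
    2 * ((Test.not (.wordLE .size (.var aMain))).steps + 1 + K), ?_⟩
  intro s t I σ F hf hσ hS
  have h5 : s + t + 8 ≤ top I := by simp only [top]; omega
  have h6 : s + t ≤ top I := by omega
  refine Runs.seq (R := fun σ' => σ'.word aMain 0 = 0) hσ (Runs.flat hσ (by simp))
    (T₂ := (s + t + 2 * (s + t) * (s + t) + 1) *
      ((Test.not (.wordLE .size (.var aMain))).steps + 1 + K * (s + t + 1) ^ 2)) ?_ ?_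
  · intro σ₁ hF₁ hσ₁ hM₁
    have hS₁ : Settled I σ₁ F := ⟨hS.rep.congr (hF₁.word _ (by simp)) (hF₁.word _ (by simp))
      (hF₁.word _ (by simp)) (hF₁.real _ (by simp)) (hF₁.real _ (by simp)), hS.out_eq, by
        rw [hF₁.real rPot (by simp)]; exact hS.reduced⟩
    refine Runs.loop (Inv := Repairing I)
      (μ := fun σ' => s + t - σ'.word aMain 0 + wordViolation s t σ') hσ₁
      ⟨by omega, F, hS₁, fun w hw => by omega⟩ ?_ ?_
    · simp only [hM₁, hS₁.rep.violation_eq]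
      have := violation_le hf hS₁
      omega
    · intro σ₂ hF₂ hσ₂ hI
      simp only [Test.wp, WExp.wp, Nat.reduceLT, Nat.zero_le, true_and, h6]
      refine ⟨fun h => hbody hf hσ₂ hI (by omega), fun h => ?_⟩
      obtain ⟨hle, F', hS', hdone⟩ := hI
      refine ⟨F', hS', isMinCost_matchOf hf.demB_le hS'.rep.box hS'.rep.skew hS'.out_eq hS'.reduced
        fun w hw => ?_⟩
      have h1 := hdone w (by omega)
      have h4 := hS'.rep.skew w (s + t)
      have e1 : bound I w (s + t) = (offset s t w : ℤ) - lowWord I w := by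
        rw [bound, if_pos hw, if_neg (lt_irrefl _)]
      have e2 : bound I (s + t) w = (highWord I w : ℤ) - offset s t w := by
        rw [bound, if_neg (lt_irrefl _), if_pos hw]
      omega
  · generalize hn : s + t = n
    generalize (Test.not (.wordLE .size (.var aMain))).steps = c
    generalize (Prog.assign aMain (.const 0)).flatTime = d
    have e1 : d ≤ d * (n + 1) ^ 4 := Nat.le_mul_of_pos_right _ (by positivity)
    have e2 : c + 1 + K * (n + 1) ^ 2 ≤ (c + 1 + K) * (n + 1) ^ 2 := by
      have : 1 ≤ (n + 1) ^ 2 := Nat.one_le_pow _ _ (by omega)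
      nlinarith
    have e3 : n + 2 * n * n + 1 ≤ 2 * (n + 1) ^ 2 := by nlinarith
    have e4 := Nat.mul_le_mul e3 e2
    calc d + (n + 2 * n * n + 1) * (c + 1 + K * (n + 1) ^ 2)
        ≤ d * (n + 1) ^ 4 + 2 * (n + 1) ^ 2 * ((c + 1 + K) * (n + 1) ^ 2) := add_le_add e1 e4
      _ = _ := by ring

end

/-! ### Initialization -/

/-- Compute the next power of two. -/
def powBody : Prog :=
  .setReal rPow (.var aV) (.add (.cell rPow (.sub (.var aV) (.const 1)))
    (.cell rPow (.sub (.var aV) (.const 1)))) ;;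
  nextV

/-- The initialization of `powers`. -/
def powInit : Prog := .setReal rPow (.const 0) (.const 1) ;; .assign aV (.const 1)

/-- Compute the powers of two. -/
def powers : Prog := powInit ;; .loop (.wordLE (.var aV) .size) powBody

/-- Store the flow `0` and its bounds at the object `V`. -/
def boundsBody : Prog :=
  .ite (.wordLE .sizeA (.var aV))
    (.setWord aFlow (.var aV) .size ;;
      .setWord aLow (.var aV) (.sub .size (.capB (.sub (.var aV) .sizeA))) ;;
      .setWord aHigh (.var aV) (.sub .size (.demB (.sub (.var aV) .sizeA))))
    (.setWord aFlow (.var aV) (.const 0) ;; .setWord aLow (.var aV) (.demA (.var aV)) ;;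
      .setWord aHigh (.var aV) (.capA (.var aV))) ;;
  nextV

/-- Store the flow `0` and its bounds at all objects. -/
def bounds : Prog :=
  .assign aV (.const 0) ;; .loop (.not (.wordLE .size (.var aV))) boundsBody

/-- Match `U` to `V` if the cost is negative. -/
def seedBody : Prog :=
  .ite (.realLE (.const 0) (.cost (.var aU) (.sub (.var aV) .sizeA))) .skip
    (.setWord aFlow (.var aU) (.add (.cell aFlow (.var aU)) (.const 1)) ;;
      .setWord aFlow (.var aV) (.sub (.cell aFlow (.var aV)) (.const 1)) ;;
      .setReal rRow (.var aU) (.add (.cell rRow (.var aU)) (.cell rPow (.var aV))) ;;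
      .setReal rRow (.var aV) (.add (.cell rRow (.var aV)) (.cell rPow (.var aU)))) ;;
  nextV

/-- Match `U` to the objects for which the cost is negative. -/
def seedRow : Prog :=
  .assign aV .sizeA ;; .loop (.not (.wordLE .size (.var aV))) seedBody ;;
  .assign aU (.add (.var aU) (.const 1))

/-- Match all pairs of negative cost. -/
def seed : Prog :=
  .assign aU (.const 0) ;; .loop (.not (.wordLE .sizeA (.var aU))) seedRow

/-- Output the pair of `U` and `V` if it belongs to the matching. -/
def emitBody : Prog :=
  .ite (.wordLE (.const 1) (.cell aArc (.var aV))) .skip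
    (.emit (.var aU) (.sub (.var aV) .sizeA)) ;;
  nextV

/-- Output the pairs of `U`. -/
def emitRow : Prog :=
  expand ;; .assign aV .sizeA ;; .loop (.not (.wordLE .size (.var aV))) emitBody ;;
  .assign aU (.add (.var aU) (.const 1))

/-- Output the matching. -/
def emitAll : Prog :=
  .assign aU (.const 0) ;; .loop (.not (.wordLE .sizeA (.var aU))) emitRow

/-- The algorithm. -/
def algorithm : Prog := powers ;; bounds ;; seed ;; repair ;; emitAll

section

variable {s t : ℕ} {I : Problem s t}

theorem powers_spec : ∃ K : ℕ, ∀ {s t : ℕ} {I : Problem s t} {σ : State}, WordsFit I σ →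
    Runs I powers σ (fun σ' => ∀ v ≤ s + t, σ'.real rPow v = 2 ^ v) (K * (s + t + 1)) := by
  refine ⟨powInit.flatTime + 2 * ((Test.wordLE (.var aV) .size).steps + 1 + powBody.flatTime), ?_⟩
  intro s t I σ hσ
  have h5 : s + t + 8 ≤ top I := by simp only [top]; omega
  have h6 : s + t ≤ top I := by omega
  refine Runs.seq (R := fun σ' => σ'.word aV 0 = 1 ∧ σ'.real rPow 0 = 1) hσ
    (Runs.flat hσ (by simp [powInit])) (T₂ := (s + t + 1 + 1) *
    ((Test.wordLE (.var aV) .size).steps + 1 + powBody.flatTime)) ?_ (by nlinarith)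
  rintro σ₁ - hσ₁ ⟨hV, h0⟩
  refine Runs.loop (Inv := fun σ' => 1 ≤ σ'.word aV 0 ∧ ∀ v < σ'.word aV 0, σ'.real rPow v = 2 ^ v)
    (μ := fun σ' => s + t + 1 - σ'.word aV 0) hσ₁ ⟨by omega, fun v hv => ?_⟩ (by omega) ?_
  · obtain rfl : v = 0 := by omega
    simpa using h0
  rintro σ₂ - hσ₂ ⟨h1, hI⟩
  obtain ⟨j, hj⟩ : ∃ j, σ₂.word aV 0 = j + 1 := ⟨σ₂.word aV 0 - 1, by omega⟩
  rw [hj] at hI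
  simp only [WExp.wp, Test.wp, Nat.reduceLT, Nat.zero_le, true_and, hj, h6]
  refine ⟨fun hle => Runs.flat hσ₂ ?_, fun hgt v hv => hI v (by omega)⟩
  have h7 : j + 1 + 1 ≤ top I := by omega
  have h8 : j ≤ s + t := by omega
  have h9 := hI j (by omega)
  simp [powBody, hj, h7, h8, hle, h9]
  refine ⟨fun v hv => ?_, by omega⟩
  split_ifs with h
  · rw [h, pow_succ]
    ring
  · exact hI v (by omega)

theorem capA_le_top (v : ℕ) : ext0 I.capA v ≤ top I := by
  rw [ext0, top, Problem.maxCap]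
  split_ifs with h
  · have : I.capA ⟨v, h⟩ ≤ univ.sup I.capA := le_sup (f := I.capA) (mem_univ _)
    have := le_max_left (univ.sup I.capA) (univ.sup I.capB)
    omega
  · omega

theorem capB_le_top (v : ℕ) : ext0 I.capB v ≤ top I := by
  rw [ext0, top, Problem.maxCap]
  split_ifs with h
  · have : I.capB ⟨v, h⟩ ≤ univ.sup I.capB := le_sup (f := I.capB) (mem_univ _)
    have := le_max_right (univ.sup I.capA) (univ.sup I.capB)
    omega
  · omega

theorem Feasible.dem_le_top (h : Feasible I) (v : ℕ) :
    ext0 I.demA v ≤ top I ∧ ext0 I.demB v ≤ top I := by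
  obtain ⟨M, hM⟩ := h.exists_assignment
  constructor
  · refine le_trans ?_ (capA_le_top (I := I) v)
    rw [ext0, ext0]
    split_ifs with hv
    · exact (hM.1 ⟨v, hv⟩).1.trans (hM.1 ⟨v, hv⟩).2
    · exact le_rfl
  · refine le_trans ?_ (capB_le_top (I := I) v)
    rw [ext0, ext0]
    split_ifs with hv
    · exact (hM.2 ⟨v, hv⟩).1.trans (hM.2 ⟨v, hv⟩).2
    · exact le_rfl

theorem bounds_spec : ∃ K : ℕ, ∀ {s t : ℕ} {I : Problem s t} {σ : State}, Feasible I →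
    WordsFit I σ → Runs I bounds σ (fun σ' => ∀ v < s + t, σ'.word aFlow v = offset s t v ∧
      σ'.word aLow v = lowWord I v ∧ σ'.word aHigh v = highWord I v) (K * (s + t + 1)) := by
  refine ⟨(Prog.assign aV (.const 0)).flatTime +
    ((Test.not (.wordLE .size (.var aV))).steps + 1 + boundsBody.flatTime), ?_⟩
  intro s t I σ hf hσ
  have h5 : s + t + 8 ≤ top I := by simp only [top]; omega
  have h6 : s + t ≤ top I := by omega
  refine Runs.seq (R := fun σ' => σ'.word aV 0 = 0) hσ
    (Runs.flat hσ (by simp)) (T₂ := (s + t + 1) *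
    ((Test.not (.wordLE .size (.var aV))).steps + 1 + boundsBody.flatTime)) ?_ (by nlinarith)
  rintro σ₁ - hσ₁ hV
  refine Runs.loop (Inv := fun σ' => ∀ v < σ'.word aV 0, σ'.word aFlow v = offset s t v ∧
      σ'.word aLow v = lowWord I v ∧ σ'.word aHigh v = highWord I v)
    (μ := fun σ' => s + t - σ'.word aV 0) hσ₁ (fun v hv => by omega) (by omega) ?_
  rintro σ₂ - hσ₂ hI
  obtain ⟨j, hj⟩ : ∃ j, σ₂.word aV 0 = j := ⟨_, rfl⟩
  rw [hj] at hI
  simp only [WExp.wp, Test.wp, Nat.reduceLT, Nat.zero_le, true_and, hj, h6]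
  refine ⟨fun hle => Runs.flat hσ₂ ?_, fun hgt v hv => hI v (by omega)⟩
  have h7 : j + 1 ≤ top I := by omega
  have h8 : j ≤ s + t := by omega
  have h9 := hf.dem_le_top j
  have h10 := hf.dem_le_top (j - s)
  simp [boundsBody, hj, h7, h8, h6, h9, h10, capA_le_top, capB_le_top]
  refine ⟨fun hs => ⟨by omega, fun v hv => ?_, by omega⟩, fun hs => ⟨hs, fun v hv => ?_, by omega⟩⟩
  · by_cases hvj : v = j
    · subst hvj
      simp [offset, lowWord, highWord, hs.not_gt]
    · simpa [hvj] using hI v (by omega)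
  · by_cases hvj : v = j
    · subst hvj
      simp [offset, lowWord, highWord, hs]
    · simpa [hvj] using hI v (by omega)

variable (I) in
/-- The memory represents the circulation that matches the pairs of negative cost before the pair
`(u, v)` in lexicographic order. -/
def Seeded (u v : ℕ) (σ : State) : Prop :=
  ∃ F, Rep I σ F ∧ (∀ p < s + t + 1, outflow (s + t + 1) F p = 0) ∧
    ∀ p < s, ∀ q, s ≤ q → q < s + t →
      F p q = if (p < u ∨ (p = u ∧ q < v)) ∧ cost0 I p (q - s) < 0 then 1 else 0

theorem seedBody_spec {σ : State} {u v : ℕ} (hσ : WordsFit I σ) (hU : σ.word aU 0 = u)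
    (hV : σ.word aV 0 = v) (hu : u < s) (hsv : s ≤ v) (hv : v < s + t) (h : Seeded I u v σ) :
    Runs I seedBody σ (fun σ' => Seeded I u (v + 1) σ' ∧ σ'.word aV 0 = v + 1)
      seedBody.flatTime := by
  obtain ⟨F, hR, h0, hF⟩ := h
  have h5 : s + t + 8 ≤ top I := by simp only [top]; omega
  have h7 : v + 1 ≤ top I := by omega
  have hun : u ≤ s + t := by omega
  have hvn : v ≤ s + t := by omega
  have huv : u ≠ v := by omega
  have hFuv : F u v = 0 := by
    rw [hF u hu v hsv hv, if_neg (by omega)]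
  have hfu : σ.word aFlow u + 1 ≤ top I := by
    have := ground_bounds hR.box hR.skew (v := u) (by omega) (h0 u (by omega))
    have := hR.flow u (by omega)
    omega
  -- the pair `(u, v)` is not yet matched, so `v` is matched to less than all objects
  have hfv : 1 ≤ σ.word aFlow v := by
    have h1 := hR.flow v hv
    rw [ground_eq_sum hR.skew (h0 v (by omega)), offset, if_neg (by omega)] at h1
    have h2 : F v u + 1 ≤ ∑ q ∈ range (s + t), (F v q + 1) :=
      single_le_sum (f := fun q => F v q + 1) (fun q hq => by
        have := hR.box.natAbs_le hR.skew hv (mem_range.1 hq)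
        omega) (mem_range.2 (by omega))
    rw [sum_add_distrib, hR.skew v u, hFuv] at h2
    simp only [sum_const, card_range, nsmul_eq_mul, mul_one] at h2
    push_cast at h1 h2
    omega
  refine Runs.flat hσ ?_
  simp only [seedBody, Prog.wp, WExp.wp, Test.wp, RExp.wp, State.setReal_word, State.setWord_word,
    State.setWord_real, State.setReal_real, hU, hV, hun]
  simp only [Nat.reduceLeDiff, Nat.reduceLT, Nat.reduceEqDiff, Nat.zero_le, true_and, false_and,
    and_self, and_true, if_true, if_false, h7, huv.symm, hfu, hvn, hun]
  refine ⟨hu, by omega, fun hc => ⟨F, ?_, h0, fun p hp q hq hq' => ?_⟩, fun hc => ?_⟩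
  · exact hR.congr (by ext; simp) (by ext; simp) (by ext; simp) rfl rfl
  · rw [hF p hp q hq hq']
    refine if_congr ?_ rfl rfl
    constructor
    · rintro ⟨a, b⟩
      exact ⟨by omega, b⟩
    · rintro ⟨a, b⟩
      refine ⟨?_, b⟩
      by_contra hcon
      obtain rfl : p = u := by omega
      obtain rfl : q = v := by omega
      exact hc.not_gt (by exact_mod_cast b)
  · have hR₁ : Rep I (σ.setWord aFlow u (σ.word aFlow u + 1)) (push F (s + t) u) :=
      hR.push_in (by omega) (by simp) (by ext; simp) (by ext; simp) rfl rfl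
    have hR₂ : Rep I ((σ.setWord aFlow u (σ.word aFlow u + 1)).setWord aFlow v
        (σ.word aFlow v - 1)) (push (push F (s + t) u) v (s + t)) :=
      hR₁.push_out hv (by simpa [huv.symm] using hfv) (by simp [huv.symm]) (by ext; simp)
        (by ext; simp) rfl rfl
    have hval : ∀ p < s + t, ∀ q < s + t, push (push F (s + t) u) v (s + t) p q = F p q :=
      fun p hp q hq => by
        rw [push_outer _ (Or.inr le_rfl) p hp q hq, push_outer _ (Or.inl le_rfl) p hp q hq]
    have hres : Residual I (push (push F (s + t) u) v (s + t)) u v := by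
      rw [Residual, hval u (by omega) v hv, hFuv, bound, if_pos (by omega), if_pos hv,
        if_pos ⟨hu, hsv⟩]
      exact zero_lt_one
    refine ⟨push (push (push F (s + t) u) v (s + t)) u v, hR₂.push_inner (by omega) hv hres
      (by ext; simp) (by ext; simp) (by ext; simp) (fun p => ?_) (by ext; simp), fun p hp => ?_,
      fun p hp q hq hq' => ?_⟩
    · simp only [State.setWord_real, State.setReal_real, if_pos hu, one_mul, true_and]
      by_cases hpv : p = v
      · subst hpv
        simp [huv.symm]
      · by_cases hpu : p = u
        · subst hpu
          simp [huv]
        · simp [hpu, hpv]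
    · rw [outflow_push _ (by omega) (by omega), outflow_push _ (by omega) (by omega),
        outflow_push _ (by omega) (by omega), h0 p hp]
      ring
    · rw [push, hval p (by omega) q (by omega), hF p hp q hq hq',
        if_neg (show ¬ (p = v ∧ q = u) by omega)]
      by_cases hpq : p = u ∧ q = v
      · obtain ⟨rfl, rfl⟩ := hpq
        have : cost0 I p (q - s) < 0 := by
          rw [Int.cast_zero] at hc
          exact not_le.1 hc
        simp [this]
      · rw [if_neg hpq, add_zero, sub_zero]
        refine if_congr (and_congr_left fun _ => ?_) rfl rfl
        omega

theorem seed_spec : ∃ K : ℕ, ∀ {s t : ℕ} {I : Problem s t} {σ : State}, WordsFit I σ →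
    Rep I σ (fun _ _ => 0) →
    Runs I seed σ (Seeded I s s) (K * (s + t + 1) ^ 2) := by
  refine ⟨(Prog.assign aU (.const 0)).flatTime + ((Test.not (.wordLE .sizeA (.var aU))).steps + 1 +
    ((Prog.assign aV .sizeA).flatTime +
      (((Test.not (.wordLE .size (.var aV))).steps + 1 + seedBody.flatTime) +
        (Prog.assign aU (.add (.var aU) (.const 1))).flatTime))), ?_⟩
  intro s t I σ hσ hR
  have h5 : s + t + 8 ≤ top I := by simp only [top]; omega
  have h6 : s + t ≤ top I := by omega
  refine Runs.seq (R := fun σ' => σ'.word aU 0 = 0) hσ (Runs.flat hσ (by simp))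
    (T₂ := (s + 1) * ((Test.not (.wordLE .sizeA (.var aU))).steps + 1 +
    ((Prog.assign aV .sizeA).flatTime +
      ((t + 1) * ((Test.not (.wordLE .size (.var aV))).steps + 1 + seedBody.flatTime) +
        (Prog.assign aU (.add (.var aU) (.const 1))).flatTime)))) ?_ ?_
  · intro σ₁ hF₁ hσ₁ hU₁
    refine Runs.loop (Inv := fun σ' => σ'.word aU 0 ≤ s ∧ Seeded I (σ'.word aU 0) s σ')
      (μ := fun σ' => s - σ'.word aU 0) hσ₁ ⟨by omega, ?_⟩ (by omega) ?_
    · refine ⟨fun _ _ => 0, hR.congr (hF₁.word _ (by simp)) (hF₁.word _ (by simp))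
        (hF₁.word _ (by simp)) (hF₁.real _ (by simp)) (hF₁.real _ (by simp)), fun p _ => ?_, ?_⟩
      · simp [outflow]
      · intro p hp q hq hq'
        rw [if_neg (by omega)]
    rintro σ₂ - hσ₂ ⟨hle, hI⟩
    obtain ⟨u, hU⟩ : ∃ u, σ₂.word aU 0 = u := ⟨_, rfl⟩
    rw [hU] at hle hI
    simp only [WExp.wp, Test.wp, Nat.reduceLT, Nat.zero_le, true_and, hU]
    refine ⟨fun hlt => ?_, fun hge => ?_⟩
    · refine Runs.seq (R := fun σ' => σ'.word aV 0 = s ∧ Seeded I u s σ') hσ₂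
        (Runs.flat hσ₂ ?_) ?_ le_rfl
      · obtain ⟨F, hR', x⟩ := hI
        simp only [Prog.wp, WExp.wp, State.setWord_word, Nat.reduceLT,
          Nat.zero_le, true_and, and_self, if_true]
        exact ⟨F, hR'.congr (by ext; simp) (by ext; simp) (by ext; simp) rfl rfl, x⟩
      rintro σ₃ hF₃ hσ₃ ⟨hV₃, hI₃⟩
      have hU₃ : σ₃.word aU 0 = u := by rw [hF₃.word aU (by simp), hU]
      refine Runs.seq (R := Seeded I u (s + t)) hσ₃ (Runs.loop (k := t) (Inv := fun σ' =>
        s ≤ σ'.word aV 0 ∧ σ'.word aV 0 ≤ s + t ∧ Seeded I u (σ'.word aV 0) σ')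
        (μ := fun σ' => s + t - σ'.word aV 0) hσ₃ ⟨by omega, by omega, by rwa [hV₃]⟩ (by omega) ?_)
        ?_ le_rfl
      · rintro σ₄ hF₄ hσ₄ ⟨a, b, c⟩
        have hU₄ : σ₄.word aU 0 = u := by rw [hF₄.word aU (by simp [seedBody]), hU₃]
        simp only [WExp.wp, Test.wp, Nat.reduceLT, Nat.zero_le, true_and, h6]
        refine ⟨fun hlt' => ?_, fun hge => ?_⟩
        · refine (seedBody_spec hσ₄ hU₄ rfl (by omega) a (by omega) c).mono hσ₄ ?_ le_rfl
          rintro σ₅ - - ⟨x, y⟩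
          rw [y]
          exact ⟨⟨by omega, by omega, x⟩, by omega⟩
        · rwa [show σ₄.word aV 0 = s + t by omega] at c
      · rintro σ₄ hF₄ hσ₄ ⟨F, hR', h0, hF⟩
        have hU₄ : σ₄.word aU 0 = u := by rw [hF₄.word aU (by simp [seedBody]), hU₃]
        refine Runs.flat hσ₄ ?_
        have h7 : u + 1 ≤ top I := by omega
        simp only [Prog.wp, WExp.wp, State.setWord_word, Nat.reduceLeDiff, Nat.reduceLT,
          Nat.zero_le, true_and, and_self, if_true, hU₄, h7]
        refine ⟨⟨by omega, F, hR'.congr (by ext; simp) (by ext; simp) (by ext; simp) rfl rfl, h0,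
          fun p hp q hq hq' => ?_⟩, by omega⟩
        rw [hF p hp q hq hq']
        refine if_congr (and_congr_left fun _ => ?_) rfl rfl
        omega
    · rwa [show u = s by omega] at hI
  · generalize (Test.not (.wordLE .sizeA (.var aU))).steps = c₁
    generalize (Test.not (.wordLE .size (.var aV))).steps = c₂
    generalize (Prog.assign aU (.const 0)).flatTime = c₃
    generalize (Prog.assign aV .sizeA).flatTime = c₄
    generalize (Prog.assign aU (.add (.var aU) (.const 1))).flatTime = c₅
    generalize seedBody.flatTime = c₆
    have e1 : c₁ + 1 + (c₄ + ((t + 1) * (c₂ + 1 + c₆) + c₅)) ≤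
        (c₁ + 1 + (c₄ + ((c₂ + 1 + c₆) + c₅))) * (s + t + 1) := by nlinarith
    have e2 := Nat.mul_le_mul (show s + 1 ≤ s + t + 1 by omega) e1
    have e3 : c₃ ≤ c₃ * (s + t + 1) ^ 2 := Nat.le_mul_of_pos_right _ (by positivity)
    nlinarith

theorem Seeded.settled {σ : State} (h : Seeded I s s σ) (hpot : ∀ v, σ.real rPot v = 0) :
    ∃ F, Settled I σ F := by
  obtain ⟨F, hR, h0, hF⟩ := h
  refine ⟨F, hR, h0, fun p hp q hq hres => ?_⟩
  rw [redCost, hpot, hpot, add_zero, sub_zero, arcCost]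
  split_ifs with h1 h2
  · by_contra hcon
    rw [Residual, hF p h1.1 q h1.2.1 h1.2.2, if_pos ⟨Or.inl h1.1, not_le.1 hcon⟩, bound,
      if_pos (by omega), if_pos h1.2.2, if_pos ⟨h1.1, h1.2.1⟩] at hres
    exact lt_irrefl _ hres
  · by_contra hcon
    rw [Residual, hR.skew, hF q h2.1 p h2.2.1 h2.2.2, if_neg (fun hh => hcon (by linarith [hh.2])),
      bound, if_pos h2.2.2, if_pos (by omega), if_neg (by omega)] at hres
    exact lt_irrefl _ hres
  · exact le_rfl

/-! ### Output -/

variable (s t) in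
/-- The output consists of the pairs of the matching before the pair of the nodes `u` and `v` in
lexicographic order. -/
def Emitted (F : ℕ → ℕ → ℤ) (u v : ℕ) (σ : State) : Prop :=
  σ.out.Nodup ∧ ∀ a b, (a, b) ∈ σ.out ↔
    a < s ∧ b < t ∧ F a (s + b) = 1 ∧ (a < u ∨ (a = u ∧ s + b < v))

theorem emitBody_spec {σ : State} {F : ℕ → ℕ → ℤ} {u v : ℕ} (hσ : WordsFit I σ)
    (hU : σ.word aU 0 = u) (hV : σ.word aV 0 = v) (hu : u < s) (hsv : s ≤ v) (hv : v < s + t)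
    (hbox : InBox I F) (hskew : Skew F) (hA : ArcAt I F u σ v) (h : Emitted s t F u v σ) :
    Runs I emitBody σ (fun σ' => Emitted s t F u (v + 1) σ' ∧ σ'.word aV 0 = v + 1)
      emitBody.flatTime := by
  have h5 : s + t + 8 ≤ top I := by simp only [top]; omega
  have h7 : v + 1 ≤ top I := by omega
  have hvn : v ≤ s + t := by omega
  have hbd : bound I u v = 1 := by
    rw [bound, if_pos (by omega), if_pos hv, if_pos ⟨hu, hsv⟩]
  have h01 := hbox.unit hskew hu hsv hv
  rw [ArcAt, hbd] at hA
  refine Runs.flat hσ ?_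
  simp only [emitBody, Prog.wp, WExp.wp, Test.wp, hU, hV, hvn, State.emit_word,
    Nat.reduceLeDiff, Nat.reduceLT, Nat.zero_le, true_and, h7, State.setWord_word, and_self,
    if_true, and_true]
  obtain ⟨hnd, hmem⟩ := h
  refine ⟨fun h1 => ⟨hnd, fun a b => ?_⟩, fun h1 => ⟨?_, fun a b => ?_⟩⟩
  · have hF0 : F u v = 0 := by
      rcases h01 with h | h
      · exact h
      · rw [hA.2 (by omega)] at h1
        omega
    rw [State.setWord_out, hmem]
    refine and_congr_right fun _ => and_congr_right fun _ => and_congr_right fun hF1 => ?_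
    constructor
    · omega
    · rintro (h | ⟨rfl, h⟩)
      · exact Or.inl h
      · refine Or.inr ⟨rfl, ?_⟩
        by_contra hcon
        rw [show s + b = v by omega] at hF1
        omega
  · rw [State.setWord_out, State.emit_out]
    refine List.nodup_append.2 ⟨hnd, List.nodup_singleton _, ?_⟩
    rintro ⟨a, b⟩ hab ⟨a', b'⟩ hab' heq
    rw [List.mem_singleton] at hab'
    rw [heq, hab', hmem] at hab
    omega
  · have hF1 : F u v = 1 := by
      rcases h01 with h | h
      · exact absurd (hA.1 (by omega)).1 (by omega)
      · exact h
    rw [State.setWord_out, State.emit_out, List.mem_append, hmem, List.mem_singleton,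
      Prod.mk.injEq]
    constructor
    · rintro (⟨h2, h3, h4, h6⟩ | ⟨rfl, rfl⟩)
      · exact ⟨h2, h3, h4, by omega⟩
      · rw [show s + (v - s) = v by omega]
        exact ⟨hu, by omega, hF1, by omega⟩
    · rintro ⟨h2, h3, h4, h6⟩
      by_cases hx : a = u ∧ b = v - s
      · exact Or.inr hx
      · exact Or.inl ⟨h2, h3, h4, by omega⟩

theorem emitAll_spec : ∃ K : ℕ, ∀ {s t : ℕ} {I : Problem s t} {σ : State} {F : ℕ → ℕ → ℤ},
    WordsFit I σ → Rep I σ F → σ.out = [] →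
    Runs I emitAll σ (fun σ' => Enumerates σ'.out (matchOf s t F)) (K * (s + t + 1) ^ 2) := by
  obtain ⟨K, hexpand⟩ := expand_spec
  refine ⟨(Prog.assign aU (.const 0)).flatTime + ((Test.not (.wordLE .sizeA (.var aU))).steps + 1 +
    (K + ((Prog.assign aV .sizeA).flatTime +
      (((Test.not (.wordLE .size (.var aV))).steps + 1 + emitBody.flatTime) +
        (Prog.assign aU (.add (.var aU) (.const 1))).flatTime)))), ?_⟩
  intro s t I σ F hσ hR hout
  have h5 : s + t + 8 ≤ top I := by simp only [top]; omega
  have h6 : s + t ≤ top I := by omega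
  refine Runs.seq (R := fun σ' => σ'.word aU 0 = 0) hσ (Runs.flat hσ (by simp))
    (T₂ := (s + 1) * ((Test.not (.wordLE .sizeA (.var aU))).steps + 1 +
    (K * (s + t + 1) + ((Prog.assign aV .sizeA).flatTime +
      ((t + 1) * ((Test.not (.wordLE .size (.var aV))).steps + 1 + emitBody.flatTime) +
        (Prog.assign aU (.add (.var aU) (.const 1))).flatTime))))) ?_ ?_
  · intro σ₁ hF₁ hσ₁ hU₁
    have hR₁ : Rep I σ₁ F := hR.congr (hF₁.word _ (by simp)) (hF₁.word _ (by simp))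
      (hF₁.word _ (by simp)) (hF₁.real _ (by simp)) (hF₁.real _ (by simp))
    refine Runs.loop (Inv := fun σ' => σ'.word aU 0 ≤ s ∧ Emitted s t F (σ'.word aU 0) s σ')
      (μ := fun σ' => s - σ'.word aU 0) hσ₁ ⟨by omega, ?_⟩ (by omega) ?_
    · rw [Emitted, hF₁.out (by simp), hout, hU₁]
      refine ⟨List.nodup_nil, fun a b => ?_⟩
      simp only [List.not_mem_nil, false_iff]
      omega
    rintro σ₂ hF₂ hσ₂ ⟨hle, hI⟩
    have hR₂ : Rep I σ₂ F := by
      refine hR₁.congr (hF₂.word _ ?_) (hF₂.word _ ?_) (hF₂.word _ ?_)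
        (hF₂.real _ ?_) (hF₂.real _ ?_) <;>
      simp [emitRow, emitBody, expand, expandInit, expandBody]
    obtain ⟨u, hU⟩ : ∃ u, σ₂.word aU 0 = u := ⟨_, rfl⟩
    rw [hU] at hle hI
    simp only [WExp.wp, Test.wp, Nat.reduceLT, Nat.zero_le, true_and, hU]
    refine ⟨fun hlt => ?_, fun hge => ?_⟩
    · refine Runs.seq hσ₂ (hexpand hσ₂ hR₂ (by omega)) ?_ le_rfl
      intro σ₃ hF₃ hσ₃ hA
      rw [hU] at hA
      have hU₃ : σ₃.word aU 0 = u := by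
        rw [hF₃.word aU (by simp [expand, expandInit, expandBody]), hU]
      have hI₃ : Emitted s t F u s σ₃ := by
        rw [Emitted, hF₃.out (by simp [expand, expandInit, expandBody])]
        exact hI
      refine Runs.seq (R := fun σ' => σ'.word aV 0 = s) hσ₃ (Runs.flat hσ₃ (by simp)) ?_ le_rfl
      intro σ₄ hF₄ hσ₄ hV₄
      have hU₄ : σ₄.word aU 0 = u := by rw [hF₄.word aU (by simp), hU₃]
      have eA₄ : σ₄.word aArc = σ₃.word aArc := hF₄.word _ (by simp)
      have eC₄ : σ₄.real rCost = σ₃.real rCost := hF₄.real _ (by simp)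
      have hI₄ : Emitted s t F u s σ₄ := by
        rw [Emitted, hF₄.out (by simp)]
        exact hI₃
      refine Runs.seq (R := Emitted s t F u (s + t)) hσ₄ (Runs.loop (k := t) (Inv := fun σ' =>
        s ≤ σ'.word aV 0 ∧ σ'.word aV 0 ≤ s + t ∧ Emitted s t F u (σ'.word aV 0) σ')
        (μ := fun σ' => s + t - σ'.word aV 0) hσ₄ ⟨by omega, by omega, by rwa [hV₄]⟩ (by omega) ?_)
        ?_ le_rfl
      · rintro σ₅ hF₅ hσ₅ ⟨a, b, c⟩
        have hU₅ : σ₅.word aU 0 = u := by rw [hF₅.word aU (by simp [emitBody]), hU₄]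
        simp only [WExp.wp, Test.wp, Nat.reduceLT, Nat.zero_le, true_and, h6]
        refine ⟨fun hlt' => ?_, fun hge => ?_⟩
        · have hA₅ : ArcAt I F u σ₅ (σ₅.word aV 0) := by
            rw [ArcAt, hF₅.word aArc (by simp [emitBody]), hF₅.real rCost (by simp [emitBody]),
              eA₄, eC₄]
            exact hA _ b
          refine (emitBody_spec hσ₅ hU₅ rfl (by omega) a (by omega) hR.box hR.skew hA₅ c).mono hσ₅
            ?_ le_rfl
          rintro σ₆ - - ⟨x, y⟩
          rw [y]
          exact ⟨⟨by omega, by omega, x⟩, by omega⟩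
        · rwa [show σ₅.word aV 0 = s + t by omega] at c
      · rintro σ₅ hF₅ hσ₅ ⟨hnd, hmem⟩
        have hU₅ : σ₅.word aU 0 = u := by rw [hF₅.word aU (by simp [emitBody]), hU₄]
        refine Runs.flat hσ₅ ?_
        have h7 : u + 1 ≤ top I := by omega
        simp only [Prog.wp, WExp.wp, State.setWord_word, Nat.reduceLeDiff, Nat.reduceLT,
          Nat.zero_le, true_and, and_self, if_true, hU₅, h7]
        refine ⟨⟨by omega, hnd, fun a b => ?_⟩, by omega⟩
        rw [State.setWord_out, hmem]
        refine and_congr_right fun _ => and_congr_right fun _ => and_congr_right fun _ => ?_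
        omega
    · obtain ⟨hnd, hmem⟩ := hI
      have hinj : Function.Injective fun e : Fin s × Fin t => ((e.1 : ℕ), (e.2 : ℕ)) := by
        rintro ⟨a, b⟩ ⟨c, d⟩ h
        simpa [Fin.ext_iff] using h
      refine (Multiset.Nodup.ext (Multiset.coe_nodup.2 hnd)
        ((matchOf s t F).nodup.map hinj)).2 ?_
      rintro ⟨a, b⟩
      rw [Multiset.mem_coe, hmem, Multiset.mem_map]
      constructor
      · rintro ⟨h1, h2, h3, -⟩
        exact ⟨(⟨a, h1⟩, ⟨b, h2⟩), by simpa [matchOf] using h3, rfl⟩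
      · rintro ⟨⟨i, j⟩, h1, h2⟩
        simp only [Prod.mk.injEq] at h2
        obtain ⟨rfl, rfl⟩ := h2
        refine ⟨i.2, j.2, by simpa [matchOf] using h1, Or.inl ?_⟩
        have := i.2
        omega
  · generalize (Test.not (.wordLE .sizeA (.var aU))).steps = c₁
    generalize (Test.not (.wordLE .size (.var aV))).steps = c₂
    generalize (Prog.assign aU (.const 0)).flatTime = c₃
    generalize (Prog.assign aV .sizeA).flatTime = c₄
    generalize (Prog.assign aU (.add (.var aU) (.const 1))).flatTime = c₅
    generalize emitBody.flatTime = c₆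
    have e1 : c₁ + 1 + (K * (s + t + 1) + (c₄ + ((t + 1) * (c₂ + 1 + c₆) + c₅))) ≤
        (c₁ + 1 + (K + (c₄ + ((c₂ + 1 + c₆) + c₅)))) * (s + t + 1) := by nlinarith
    have e2 := Nat.mul_le_mul (show s + 1 ≤ s + t + 1 by omega) e1
    have e3 : c₃ ≤ c₃ * (s + t + 1) ^ 2 := Nat.le_mul_of_pos_right _ (by positivity)
    nlinarith

/-- The algorithm outputs a generalized assignment of minimum cost. -/
theorem algorithm_spec : ∃ K : ℕ, ∀ {s t : ℕ} {I : Problem s t}, Feasible I →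
    Runs I algorithm State.init (fun σ => ∃ M, Enumerates σ.out M ∧ I.IsMinCostAssignment M)
      (K * (s + t + 1) ^ 4) := by
  obtain ⟨K₁, hpowers⟩ := powers_spec
  obtain ⟨K₂, hbounds⟩ := bounds_spec
  obtain ⟨K₃, hseed⟩ := seed_spec
  obtain ⟨K₄, hrepair⟩ := repair_spec
  obtain ⟨K₅, hemit⟩ := emitAll_spec
  refine ⟨K₁ + K₂ + K₃ + K₄ + K₅, ?_⟩
  intro s t I hf
  have hσ : WordsFit I State.init := fun a i => fit_of_le_top I (Nat.zero_le _)
  refine Runs.seq (T₂ := K₂ * (s + t + 1) + (K₃ * (s + t + 1) ^ 2 + (K₄ * (s + t + 1) ^ 4 +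
    K₅ * (s + t + 1) ^ 2))) hσ (hpowers hσ) ?_ ?_
  · intro σ₁ hF₁ hσ₁ hpow
    refine Runs.seq hσ₁ (hbounds hf hσ₁) ?_ le_rfl
    intro σ₂ hF₂ hσ₂ hbd
    have hR : Rep I σ₂ (fun _ _ => 0) := by
      refine ⟨fun v hv => ?_, fun v hv => (hbd v hv).2.1, fun v hv => (hbd v hv).2.2,
        fun u hu => ?_, fun v hv => ?_, fun _ _ => by simp, fun p hp q hq => ?_⟩
      · rw [(hbd v hv).1]
        simp
      · rw [hF₂.real rRow (by simp [bounds, boundsBody]),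
          hF₁.real rRow (by simp [powers, powInit, powBody])]
        simp [State.init]
      · rw [hF₂.real rPow (by simp [bounds, boundsBody]), hpow v hv.le]
      · rw [bound, if_pos hp, if_pos hq]
        split_ifs <;> simp
    refine Runs.seq hσ₂ (hseed hσ₂ hR) ?_ le_rfl
    intro σ₃ hF₃ hσ₃ hS
    obtain ⟨F, hF⟩ := hS.settled fun v => by
      rw [hF₃.real rPot (by simp [seed, seedRow, seedBody]),
        hF₂.real rPot (by simp [bounds, boundsBody]),
        hF₁.real rPot (by simp [powers, powInit, powBody])]
      rfl
    refine Runs.seq hσ₃ (hrepair hf hσ₃ hF) ?_ le_rfl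
    rintro σ₄ hF₄ hσ₄ ⟨F', hF', hmin⟩
    refine (hemit hσ₄ hF'.rep ?_).mono hσ₄ (fun σ₅ _ _ h => ⟨_, h, hmin⟩) le_rfl
    rw [hF₄.out (by simp [repair, repairBody, raise, lower, carry, search, searchInit, clearBody,
        labelRoot, searchBody, finishU, pick, pickInit, pickBody, expand, expandInit, expandBody,
        relax, relaxBody, reprice, repriceBody, augment, augmentBody, pushUV]),
      hF₃.out (by simp [seed, seedRow, seedBody]), hF₂.out (by simp [bounds, boundsBody]),
      hF₁.out (by simp [powers, powInit, powBody])]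
    rfl
  · have h1 : 1 ≤ s + t + 1 := by omega
    generalize s + t + 1 = n at *
    have e1 : n ≤ n ^ 4 := Nat.le_self_pow (by norm_num) n
    have e2 : n ^ 2 ≤ n ^ 4 := Nat.pow_le_pow_right h1 (by norm_num)
    have := Nat.mul_le_mul_left K₁ e1
    have := Nat.mul_le_mul_left K₂ e1
    have := Nat.mul_le_mul_left K₃ e2
    have := Nat.mul_le_mul_left K₅ e2
    nlinarith

end

end

end GenAssign

/-- One program solves all instances: there are a program and a constant `C` such that for every
instance with `n = s + t ≥ 1` objects that admits a generalized assignment, the program outputs a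
generalized assignment of minimum cost after at most `C * n ^ 4` steps, on a machine with at most
`C * n` memory cells and words of `O(log (n + U))` bits, where `U` is the largest capacity. -/
theorem theorem2 :
    ∃ (p : GenAssign.Prog) (C : ℕ), ∀ (s t : ℕ) (I : GenAssign.Problem s t), 1 ≤ s + t →
      (∃ M : Finset (Fin s × Fin t), I.IsAssignment M) →
      ∃ (m : GenAssign.Machine) (σ : GenAssign.State) (T : ℕ) (M : Finset (Fin s × Fin t)),
        GenAssign.Exec I m p GenAssign.State.init σ T ∧
        GenAssign.Enumerates σ.out M ∧
        I.IsMinCostAssignment M ∧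
        T ≤ C * (s + t) ^ 4 ∧
        m.space ≤ C * (s + t) ∧
        m.bits ≤ C * (Nat.log 2 (s + t + I.maxCap) + 1) := by
  obtain ⟨K, hK⟩ := GenAssign.algorithm_spec
  refine ⟨GenAssign.algorithm, 16 * K + 52, ?_⟩
  rintro s t I hn ⟨M₀, hM₀⟩
  obtain ⟨σ, T, hexec, ⟨M, hout, hmin⟩, hT⟩ := hK (I := I)
    ⟨fun j => (hM₀.2 j).1.trans (GenAssign.degB_le M₀ j), M₀, hM₀⟩
  refine ⟨GenAssign.mach I, σ, T, M, hexec, hout, hmin, ?_, ?_, ?_⟩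
  · have h1 : (s + t + 1) ^ 4 ≤ (2 * (s + t)) ^ 4 := Nat.pow_le_pow_left (by omega) 4
    have h2 := Nat.mul_le_mul_left K h1
    rw [mul_pow] at h2
    generalize (s + t) ^ 4 = x at *
    exact hT.trans (h2.trans (by nlinarith [Nat.zero_le x]))
  · simp only [GenAssign.Machine.space, GenAssign.mach]
    nlinarith [Nat.zero_le (K * (s + t))]
  · simp only [GenAssign.mach]
    nlinarith [Nat.zero_le (K * (Nat.log 2 (s + t + I.maxCap) + 1))]
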